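/- **Setting.** Let $\mu$ be a probability law on $\mathbb R$ that is symmetric about $0$ and has a finite first moment, let $h\sim\mu$, and let $\theta_1>0$. For $S\subset[n]$ with $|S|=k$, one observation $\sigma\in\{-1,1\}^n$ from $\mathbb P_S$ is generated by drawing $h_1,\dots,h_n$ i.i.d. from $\mu$ and then $\sigma$ from $$\mathbb P_S(\sigma\mid h)\propto\exp\Big(\frac{\theta_1}{2k}\Big(\sum_{i\in S}\sigma_i\Big)^2+\sum_{i=1}^n h_i\sigma_i\Big);$$ under the null hypothesis $\mathbb P_0$ the quadratic term is absent. One observes $m$ independent copies $\sigma^{(1)},\dots,\sigma^{(m)}$ (with independent fields, which are not observed). Write $\widehat\Sigma=\frac1m\sum_{l}\sigma^{(l)}\sigma^{(l)\top}$. For a symmetric $A\in\mathbb R^{n\times n}$ let $$SDP_k(A)=\max\Big\{\operatorname{Tr}(AX): X\succeq0,\ \operatorname{Tr}X=1,\ \sum_{i,j}|X_{ij}|\le k\Big\},$$ let $\lambda^k_{\max}(A)$ be the maximum of $v^\top Av$ over unit vectors $v$ with at most $k$ nonzero coordinates, and for $z\ge0$ let $Y_z(A)_{ij}=-A_{ij}$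 if $|A_{ij}|\le z$ and $Y_z(A)_{ij}=-\operatorname{sign}(A_{ij})z$ otherwise. Put $f_C=1+Ck\sqrt{\log n/m}$ and $$H(x)=\frac{x^2}2-\mathbb E\log\cosh(\sqrt{\theta_1}x+h).$$ $H$ has flatness $\tau\ge1$ at $0$ if $H(x)=H(0)+\frac{H^{(2\tau)}(0)}{(2\tau)!}x^{2\tau}+O(x^{2\tau+1})$ as $x\to 0$ with $H^{(2\tau)}(0)>0$. A test $\psi$ (a rule that, given $n,m,k$ and the data, rejects or accepts) is asymptotically powerful along $k=k_n$, $m=m_n$ if $\mathbb P_0(\psi\text{ rejects})+\max_{|S|=k}\mathbb P_S(\psi\text{ accepts})\to0$ as $n\to\infty$. **Statement.** 1. For all $1\le k\le n$, all symmetric $A\in\mathbb R^{n\times n}$ and all $z\ge0$, $$\lambda^k_{\max}(A)\le SDP_k(A)\le\lambda_{\max}(A+Y_z(A))+kz .$$ 2. There are a universal constant $C_1>0$ and a test $\psi$ that is decided (for $n\ge2$, $m\ge1$, $1\le k\le n$) by a single program on a random access machine with logarithmic (bit) cost in time polynomial in $nm$, and that thresholds $SDP_k(\widehat\Sigma)$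 up to a tolerance: it accepts whenever $SDP_k(\widehat\Sigma)\le f_{C_1}$ and rejects whenever $SDP_k(\widehat\Sigma)\ge f_{2C_1}$. For every $\mu$ and $\theta_1$ as above, both $\psi$ and the exact test that rejects if and only if $SDP_k(\widehat\Sigma)\ge f_{C_1}$ are asymptotically powerful along all sequences $k=k_n\le n$ (for all large $n$), $k_n\to\infty$, and $m=m_n$ such that, for a constant $C$ depending only on $\mu$ and $\theta_1$ and for all large $n$: - (high temperature) $m\ge Ck^2\log n$, if $\theta_1<1/\mathbb E[\operatorname{sech}^2 h]$; - (low temperature) $m\ge C\log n$, if $\theta_1>1/\mathbb E[\operatorname{sech}^2 h]$, or if $\theta_1=1/\mathbb E[\operatorname{sech}^2 h]$ and $0$ is not a global minimizer of $H$; - (critical temperature) $m\ge Ck^{\frac{2}{2\tau-1}}\log n$, if $\theta_1=1/\mathbb E[\operatorname{sech}^2 h]$, $0$ is a global minimizer of $H$, $H$ has flatness $\tau$ at $0$, and $h$ is not almost surely $0$. -/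

import Mathlib

open Filter Topology MeasureTheory

namespace PlantedRFCW

/-! ### The planted random field Curie-Weiss model -/

/-- A spin configuration on `n` sites; `spin` turns an entry into `+1` or `-1`. -/
abbrev Config (n : ℕ) : Type := Fin n → Bool

/-- `m` observed configurations. -/
abbrev Sample (n m : ℕ) : Type := Fin m → Config n

def spin (b : Bool) : ℤ := if b then 1 else -1

/-- The unnormalised Gibbs weight
`exp (θ / (2 |S|) (∑_{i ∈ S} σ_i)² + ∑_i h_i σ_i)` for a planted set `S` and an external field `h`. -/
noncomputable def weight {n : ℕ} (θ : ℝ) (S : Finset (Fin n)) (h : Fin n → ℝ) (σ : Config n) : ℝ :=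
  Real.exp (θ / (2 * (S.card : ℝ)) * (∑ i ∈ S, (spin (σ i) : ℝ)) ^ 2
    + ∑ i, h i * (spin (σ i) : ℝ))

/-- The conditional probability of `σ` given the field `h`. -/
noncomputable def gibbs {n : ℕ} (θ : ℝ) (S : Finset (Fin n)) (h : Fin n → ℝ) (σ : Config n) : ℝ :=
  weight θ S h σ / ∑ σ', weight θ S h σ'

/-- The law of one observed configuration: the fields `h_1, …, h_n` are i.i.d. with law `μ`, and are
integrated out. -/
noncomputable def configLaw {n : ℕ} (μ : Measure ℝ) (θ : ℝ) (S : Finset (Fin n)) :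
    Measure (Config n) :=
  ∑ σ : Config n,
    ENNReal.ofReal (∫ h, gibbs θ S h σ ∂(Measure.pi fun _ : Fin n => μ)) • Measure.dirac σ

/-- The law of `m` independent observations, each with its own independent field. -/
noncomputable def altLaw {n : ℕ} (m : ℕ) (μ : Measure ℝ) (θ : ℝ) (S : Finset (Fin n)) :
    Measure (Sample n m) :=
  Measure.pi fun _ : Fin m => configLaw μ θ S

/-- The law of `m` independent observations under the null hypothesis: no interaction. -/
noncomputable def nullLaw (n m : ℕ) (μ : Measure ℝ) : Measure (Sample n m) :=
  altLaw m μ 0 ∅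

/-- `𝔼 [sech² h]`, where `h` has law `μ`. -/
noncomputable def meanSechSq (μ : Measure ℝ) : ℝ := ∫ h, 1 / Real.cosh h ^ 2 ∂μ

/-- The population free energy `x² / 2 - 𝔼 [log cosh (√θ x + h)]`. -/
noncomputable def freeEnergy (μ : Measure ℝ) (θ x : ℝ) : ℝ :=
  x ^ 2 / 2 - ∫ h, Real.log (Real.cosh (√θ * x + h)) ∂μ

/-- `0` is a global minimum of the free energy. -/
def ZeroIsGlobalMin (μ : Measure ℝ) (θ : ℝ) : Prop :=
  ∀ x : ℝ, freeEnergy μ θ 0 ≤ freeEnergy μ θ x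

/-- The free energy `H` has flatness `τ` at `0`:
`H x = H 0 + H^{(2τ)}(0) / (2τ)! * x^{2τ} + O(x^{2τ+1})` with `H^{(2τ)}(0) > 0`. -/
def HasFlatness (μ : Measure ℝ) (θ : ℝ) (τ : ℕ) : Prop :=
  1 ≤ τ ∧ 0 < iteratedDeriv (2 * τ) (freeEnergy μ θ) 0 ∧
    (fun x : ℝ => freeEnergy μ θ x - freeEnergy μ θ 0
        - iteratedDeriv (2 * τ) (freeEnergy μ θ) 0 / ((2 * τ).factorial : ℝ) * x ^ (2 * τ))
      =O[𝓝 0] fun x : ℝ => x ^ (2 * τ + 1)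

/-! ### Sparse PCA and its semidefinite relaxation -/

/-- The empirical second moment matrix `m⁻¹ ∑_l σ^{(l)} (σ^{(l)})ᵀ`. -/
noncomputable def empCov {n m : ℕ} (x : Sample n m) : Matrix (Fin n) (Fin n) ℝ :=
  fun i j => (∑ l, (spin (x l i) : ℝ) * (spin (x l j) : ℝ)) / (m : ℝ)

/-- The value of the semidefinite program
`max Tr (A X)` subject to `X ⪰ 0`, `Tr X = 1`, `∑_{i,j} |X_{ij}| ≤ k`. -/
noncomputable def sdp {n : ℕ} (k : ℕ) (A : Matrix (Fin n) (Fin n) ℝ) : ℝ :=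
  sSup {r : ℝ | ∃ X : Matrix (Fin n) (Fin n) ℝ, X.PosSemidef ∧ X.trace = 1 ∧
    ∑ i, ∑ j, |X i j| ≤ (k : ℝ) ∧ r = (A * X).trace}

/-- The `k`-sparse largest eigenvalue: `max vᵀ A v` over unit vectors with at most `k` nonzero
coordinates. -/
noncomputable def sparseEig {n : ℕ} (k : ℕ) (A : Matrix (Fin n) (Fin n) ℝ) : ℝ :=
  sSup {r : ℝ | ∃ v : Fin n → ℝ, ∑ i, v i ^ 2 = 1 ∧ {i | v i ≠ 0}.ncard ≤ k ∧
    r = ∑ i, ∑ j, v i * A i j * v j}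

/-- The largest eigenvalue of a symmetric matrix. -/
noncomputable def lamMax {n : ℕ} (A : Matrix (Fin n) (Fin n) ℝ) : ℝ := sSup (spectrum ℝ A)

/-- The matrix `Y` such that `A + Y` is the entrywise soft thresholding of `A` at level `z`. -/
noncomputable def softCert {n : ℕ} (z : ℝ) (A : Matrix (Fin n) (Fin n) ℝ) :
    Matrix (Fin n) (Fin n) ℝ :=
  fun i j => if |A i j| ≤ z then -A i j else -(Real.sign (A i j) * z)

/-! ### Tests -/

/-- A test, for all `n`, `m` and `k` at once: the set of data on which it rejects the null
hypothesis. -/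
abbrev Test : Type := ∀ n m : ℕ, ℕ → Sample n m → Prop

/-- The threshold `1 + C k √(log n / m)`. -/
noncomputable def threshold (C : ℝ) (n m k : ℕ) : ℝ :=
  1 + C * (k : ℝ) * √(Real.log (n : ℝ) / (m : ℝ))

/-- The test that rejects if the value of the semidefinite program reaches the threshold. -/
noncomputable def sdpTest (C : ℝ) : Test :=
  fun n m k x => threshold C n m k ≤ sdp k (empCov x)

/-- Type I error plus worst-case Type II error tends to zero as `n → ∞`, for `k = k n`, `m = m n`. -/
def AsymptoticallyPowerful (μ : Measure ℝ) (θ : ℝ) (k m : ℕ → ℕ) (ψ : Test) : Prop :=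
  Tendsto (fun n : ℕ => nullLaw n (m n) μ {x | ψ n (m n) (k n) x}
      + ⨆ S : {S : Finset (Fin n) // S.card = k n},
          altLaw (m n) μ θ S.1 {x | ¬ ψ n (m n) (k n) x})
    atTop (𝓝 0)

/-- The test `ψ` is asymptotically powerful as soon as `m ≥ C r(k) log n`, where `C` depends only on
the model (`μ` and `θ`) and on `ψ`. -/
def DetectsAtRate (μ : Measure ℝ) (θ : ℝ) (ψ : Test) (r : ℕ → ℝ) : Prop :=
  ∃ C : ℝ, 0 < C ∧ ∀ k m : ℕ → ℕ, Tendsto k atTop atTop → (∀ᶠ n in atTop, k n ≤ n) →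
    (∀ᶠ n : ℕ in atTop, C * r (k n) * Real.log (n : ℝ) ≤ (m n : ℝ)) →
    AsymptoticallyPowerful μ θ k m ψ

/-! ### Polynomial time: a random access machine with logarithmic (bit) cost -/

/-- The memory: two-dimensional arrays of integers, named by natural numbers. A program names
only finitely many of them. -/
abbrev Store : Type := ℕ → ℤ → ℤ → ℤ

/-- Integer expressions; `read a i j` is the entry `(i, j)` of the array named `a`. -/
inductive Expr : Type
  | const (c : ℤ) : Expr
  | read (a : ℕ) (i j : Expr) : Expr
  | add (e f : Expr) : Expr
  | sub (e f : Expr) : Expr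
  | mul (e f : Expr) : Expr
  | div (e f : Expr) : Expr

namespace Expr

def eval (s : Store) : Expr → ℤ
  | const c => c
  | read a i j => s a (i.eval s) (j.eval s)
  | add e f => e.eval s + f.eval s
  | sub e f => e.eval s - f.eval s
  | mul e f => e.eval s * f.eval s
  | div e f => e.eval s / f.eval s

/-- The number of binary digits of an integer, plus one. -/
def bits (z : ℤ) : ℕ := z.natAbs.size + 1

/-- Evaluating an expression costs the total bit length of all the integers that occur. -/
def cost (s : Store) : Expr → ℕ
  | const c => bits c
  | read a i j => i.cost s + j.cost s + bits ((read a i j).eval s)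
  | add e f => e.cost s + f.cost s + bits ((add e f).eval s)
  | sub e f => e.cost s + f.cost s + bits ((sub e f).eval s)
  | mul e f => e.cost s + f.cost s + bits ((mul e f).eval s)
  | div e f => e.cost s + f.cost s + bits ((div e f).eval s)

end Expr

/-- Programs: `write a i j e` stores `e` in the entry `(i, j)` of the array named `a`; the guards of
`cond` and `loop` test whether an expression is positive. -/
inductive Cmd : Type
  | write (a : ℕ) (i j e : Expr) : Cmd
  | seq (c d : Cmd) : Cmd
  | cond (e : Expr) (c d : Cmd) : Cmd
  | loop (e : Expr) (c : Cmd) : Cmd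

/-- The memory after one entry was overwritten. -/
def Store.set (s : Store) (a : ℕ) (i j v : ℤ) : Store :=
  fun a' i' j' => if a' = a ∧ i' = i ∧ j' = j then v else s a' i' j'

/-- `Exec c s s' t`: the program `c`, started in the memory `s`, halts in the memory `s'` after a
total cost of `t`. -/
inductive Exec : Cmd → Store → Store → ℕ → Prop
  | write (s : Store) (a : ℕ) (i j e : Expr) :
      Exec (.write a i j e) s (s.set a (i.eval s) (j.eval s) (e.eval s))
        (i.cost s + j.cost s + e.cost s + 1)
  | seq {c d : Cmd} {s s₁ s₂ : Store} {t₁ t₂ : ℕ} :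
      Exec c s s₁ t₁ → Exec d s₁ s₂ t₂ → Exec (.seq c d) s s₂ (t₁ + t₂)
  | cond_pos {e : Expr} {c d : Cmd} {s s₁ : Store} {t : ℕ} :
      0 < e.eval s → Exec c s s₁ t → Exec (.cond e c d) s s₁ (e.cost s + t)
  | cond_neg {e : Expr} {c d : Cmd} {s s₁ : Store} {t : ℕ} :
      ¬ 0 < e.eval s → Exec d s s₁ t → Exec (.cond e c d) s s₁ (e.cost s + t)
  | loop_stop {e : Expr} {c : Cmd} {s : Store} :
      ¬ 0 < e.eval s → Exec (.loop e c) s s (e.cost s)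
  | loop_step {e : Expr} {c : Cmd} {s s₁ s₂ : Store} {t₁ t₂ : ℕ} :
      0 < e.eval s → Exec c s s₁ t₁ → Exec (.loop e c) s₁ s₂ t₂ →
      Exec (.loop e c) s s₂ (e.cost s + t₁ + t₂)

/-- The initial memory: array `0` holds `n, m, k` in its entries `(0, 0), (0, 1), (0, 2)`, array `1`
holds the spin `x l i` in its entry `(l, i)`, and all other entries are zero. -/
def inputStore {n m : ℕ} (k : ℕ) (x : Sample n m) : Store := fun a l i =>
  if a = 0 then
    if l = 0 then (if i = 0 then (n : ℤ) else if i = 1 then (m : ℤ) else if i = 2 then (k : ℤ) else 0)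
    else 0
  else if a = 1 then
    if h : 0 ≤ l ∧ l.toNat < m ∧ 0 ≤ i ∧ i.toNat < n then
      spin (x ⟨l.toNat, h.2.1⟩ ⟨i.toNat, h.2.2.2⟩)
    else 0
  else 0

/-- The test is decided by one program whose running time is bounded by a polynomial in the number
`n m` of observed spins; the program rejects by leaving a positive number in entry `(0, 0)` of
array `0`. -/
def PolynomialTime (ψ : Test) : Prop :=
  ∃ (c : Cmd) (p : Polynomial ℕ), ∀ (n m k : ℕ) (x : Sample n m),
    2 ≤ n → 1 ≤ m → 1 ≤ k → k ≤ n →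
      ∃ (s : Store) (t : ℕ), Exec c (inputStore k x) s t ∧ t ≤ p.eval (n * m) ∧
        (0 < s 0 0 0 ↔ ψ n m k x)

/-- The test `ψ` thresholds the value of the semidefinite program up to a tolerance: it does not
reject below `threshold C`, and it rejects above `threshold (2 C)`. -/
def ThresholdsSDP (C : ℝ) (ψ : Test) : Prop :=
  ∀ (n m k : ℕ) (x : Sample n m), 2 ≤ n → 1 ≤ m → 1 ≤ k → k ≤ n →
    (sdp k (empCov x) ≤ threshold C n m k → ¬ ψ n m k x) ∧
    (threshold (2 * C) n m k ≤ sdp k (empCov x) → ψ n m k x)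

end PlantedRFCW

open PlantedRFCW

namespace PlantedRFCW

theorem isHermitian_of_isSymm {n : ℕ} {A : Matrix (Fin n) (Fin n) ℝ} (hA : A.IsSymm) :
    A.IsHermitian := by
  rw [Matrix.IsHermitian, Matrix.conjTranspose_eq_transpose_of_trivial]; exact hA

theorem isSymm_of_isHermitian {n : ℕ} {A : Matrix (Fin n) (Fin n) ℝ} (hA : A.IsHermitian) :
    A.IsSymm := by
  rw [Matrix.IsHermitian, Matrix.conjTranspose_eq_transpose_of_trivial] at hA; exact hA

theorem trace_mul_le_of_eigenvalues_le {n : ℕ} {M X : Matrix (Fin n) (Fin n) ℝ}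
    (hM : M.IsHermitian) (hX : X.PosSemidef) {c : ℝ} (hc : ∀ i, hM.eigenvalues i ≤ c) :
    (M * X).trace ≤ c * X.trace := by
  set U : Matrix (Fin n) (Fin n) ℝ := (hM.eigenvectorUnitary : Matrix (Fin n) (Fin n) ℝ) with hU
  have hUU : U * star U = 1 := Unitary.mul_star_self_of_mem hM.eigenvectorUnitary.2
  have hspec : M = U * Matrix.diagonal hM.eigenvalues * star U := by
    conv_lhs => rw [hM.spectral_theorem]
    rw [Unitary.conjStarAlgAut_apply]
    rfl
  set Z := star U * X * U with hZ
  have hZp : Z.PosSemidef := hX.conjTranspose_mul_mul_same U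
  have h1 : (M * X).trace = ∑ i, hM.eigenvalues i * Z i i := by
    have : (M * X).trace = (Matrix.diagonal hM.eigenvalues * Z).trace := by
      conv_lhs => rw [hspec]
      rw [hZ, Matrix.mul_assoc, Matrix.mul_assoc, Matrix.trace_mul_comm, Matrix.mul_assoc]
    rw [this, Matrix.trace]
    simp [Matrix.diagonal_mul]
  have h2 : X.trace = ∑ i, Z i i := by
    have : X.trace = Z.trace := by
      rw [hZ, Matrix.mul_assoc, Matrix.trace_mul_comm, Matrix.mul_assoc, hUU, Matrix.mul_one]
    rw [this]; rfl
  rw [h1, h2, Finset.mul_sum]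
  exact Finset.sum_le_sum fun i _ => mul_le_mul_of_nonneg_right (hc i) hZp.diag_nonneg

theorem trace_pow_eq_sum_eigenvalues {n : ℕ} {M : Matrix (Fin n) (Fin n) ℝ}
    (hM : M.IsHermitian) (p : ℕ) : (M ^ p).trace = ∑ i, hM.eigenvalues i ^ p := by
  set U : Matrix (Fin n) (Fin n) ℝ := (hM.eigenvectorUnitary : Matrix (Fin n) (Fin n) ℝ) with hU
  have hUU : star U * U = 1 := Unitary.star_mul_self_of_mem hM.eigenvectorUnitary.2
  have hspec : M = Unitary.conjStarAlgAut ℝ _ hM.eigenvectorUnitary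
      (Matrix.diagonal hM.eigenvalues) := hM.spectral_theorem
  have : M ^ p = U * Matrix.diagonal (fun i => hM.eigenvalues i ^ p) * star U := by
    conv_lhs => rw [hspec]
    rw [← map_pow, Unitary.conjStarAlgAut_apply, Matrix.diagonal_pow]
    rfl
  rw [this, Matrix.mul_assoc, Matrix.trace_mul_comm, Matrix.mul_assoc, hUU, Matrix.mul_one,
    Matrix.trace]
  simp

theorem abs_entry_le_one {n : ℕ} {X : Matrix (Fin n) (Fin n) ℝ} (hX : X.PosSemidef)
    (ht : X.trace = 1) (i j : Fin n) : |X i j| ≤ 1 := by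
  have hd : ∀ i, X i i ≤ 1 := fun i => by
    rw [← ht]
    exact Finset.single_le_sum (f := fun i => X i i) (fun i _ => hX.diag_nonneg)
      (Finset.mem_univ i)
  have key : ∀ s : ℝ, 0 ≤ X i i + s ^ 2 * X j j + 2 * s * X i j := by
    intro s
    have h := hX.dotProduct_mulVec_nonneg (Pi.single i 1 + s • Pi.single j 1)
    have hs := (isSymm_of_isHermitian hX.1).apply i j
    simp [Matrix.mulVec_add, Matrix.mulVec_smul, add_dotProduct,
      smul_dotProduct, hs] at h
    nlinarith [h]
  have h1 := key 1
  have h2 := key (-1)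
  have := hd i
  have := hd j
  rw [abs_le]; constructor <;> linarith

theorem trace_mul_eq_sum {n : ℕ} (A X : Matrix (Fin n) (Fin n) ℝ) (hX : X.IsSymm) :
    (A * X).trace = ∑ i, ∑ j, A i j * X i j := by
  simp only [Matrix.trace, Matrix.diag_apply, Matrix.mul_apply]
  refine Finset.sum_congr rfl fun i _ => Finset.sum_congr rfl fun j _ => ?_
  rw [hX.apply i j]

theorem bddAbove_sdp {n : ℕ} (k : ℕ) (A : Matrix (Fin n) (Fin n) ℝ) :
    BddAbove {r : ℝ | ∃ X : Matrix (Fin n) (Fin n) ℝ, X.PosSemidef ∧ X.trace = 1 ∧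
      ∑ i, ∑ j, |X i j| ≤ (k : ℝ) ∧ r = (A * X).trace} := by
  refine ⟨∑ i, ∑ j, |A i j|, ?_⟩
  rintro r ⟨X, hX, ht, -, rfl⟩
  rw [trace_mul_eq_sum A X (isSymm_of_isHermitian hX.1)]
  refine Finset.sum_le_sum fun i _ => Finset.sum_le_sum fun j _ => ?_
  refine (le_abs_self _).trans ?_
  rw [abs_mul]
  exact mul_le_of_le_one_right (abs_nonneg _) (abs_entry_le_one hX ht i j)

theorem le_sdp {n k : ℕ} (A : Matrix (Fin n) (Fin n) ℝ) {X : Matrix (Fin n) (Fin n) ℝ}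
    (hX : X.PosSemidef) (ht : X.trace = 1) (h1 : ∑ i, ∑ j, |X i j| ≤ (k : ℝ)) :
    (A * X).trace ≤ sdp k A :=
  le_csSup (bddAbove_sdp k A) ⟨X, hX, ht, h1, rfl⟩

theorem posSemidef_rankOne {n : ℕ} (v : Fin n → ℝ) :
    (Matrix.of fun i j => v i * v j : Matrix (Fin n) (Fin n) ℝ).PosSemidef :=
  Matrix.posSemidef_vecMulVec_self_star v

theorem sum_abs_sq_le_of_sparse {n k : ℕ} {v : Fin n → ℝ} (hv : ∑ i, v i ^ 2 = 1)
    (hk : {i | v i ≠ 0}.ncard ≤ k) : ∑ i, ∑ j, |v i * v j| ≤ (k : ℝ) := by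
  classical
  have h1 : ∑ i, ∑ j, |v i * v j| = (∑ i, |v i|) ^ 2 := by
    rw [sq, Finset.sum_mul_sum]; simp [abs_mul]
  set s : Finset (Fin n) := Finset.univ.filter fun i => v i ≠ 0 with hs
  have hsk : s.card ≤ k := by
    rwa [Set.ncard_eq_toFinset_card', Set.toFinset_ofPred] at hk
  have h2 : ∑ i, |v i| = ∑ i ∈ s, |v i| := by
    rw [hs, Finset.sum_filter]
    refine Finset.sum_congr rfl fun i _ => ?_
    by_cases h : v i = 0 <;> simp [h]
  have h3 : ∑ i ∈ s, |v i| ^ 2 ≤ 1 := by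
    rw [← hv]
    simp only [sq_abs]
    exact Finset.sum_le_univ_sum_of_nonneg fun i => sq_nonneg _
  rw [h1, h2]
  refine (sq_sum_le_card_mul_sum_sq).trans ?_
  have : (s.card : ℝ) ≤ k := by exact_mod_cast hsk
  nlinarith [Finset.sum_nonneg (s := s) (f := fun i => |v i| ^ 2) fun i _ => sq_nonneg _]

theorem exists_sparse_unit {n k : ℕ} (hk : 1 ≤ k) (hkn : k ≤ n) :
    ∃ v : Fin n → ℝ, ∑ i, v i ^ 2 = 1 ∧ {i | v i ≠ 0}.ncard ≤ k := by
  refine ⟨Pi.single ⟨0, by omega⟩ 1, ?_, ?_⟩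
  · rw [Finset.sum_eq_single ⟨0, by omega⟩]
    · simp
    · intro b _ hb; simp [hb]
    · simp
  · have : {i : Fin n | (Pi.single (⟨0, by omega⟩ : Fin n) (1 : ℝ) : Fin n → ℝ) i ≠ 0}
        = {⟨0, by omega⟩} := by
      ext i
      by_cases h : i = ⟨0, by omega⟩
      · subst h; simp
      · simp [h]
    rw [this, Set.ncard_singleton]; exact hk

theorem trace_rankOne {n : ℕ} {v : Fin n → ℝ} (hv : ∑ i, v i ^ 2 = 1) :
    (Matrix.of fun i j => v i * v j : Matrix (Fin n) (Fin n) ℝ).trace = 1 := by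
  simp [Matrix.trace, ← sq, hv]

theorem quadForm_le_sdp {n k : ℕ} (A : Matrix (Fin n) (Fin n) ℝ) {v : Fin n → ℝ}
    (hv : ∑ i, v i ^ 2 = 1) (hk : {i | v i ≠ 0}.ncard ≤ k) :
    ∑ i, ∑ j, v i * A i j * v j ≤ sdp k A := by
  refine le_trans (le_of_eq ?_) (le_sdp A (posSemidef_rankOne v) (trace_rankOne hv)
    (sum_abs_sq_le_of_sparse hv hk))
  rw [trace_mul_eq_sum]
  · exact Finset.sum_congr rfl fun i _ => Finset.sum_congr rfl fun j _ => by
      simp only [Matrix.of_apply]; ring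
  · ext i j; simp [mul_comm]

theorem sparseEig_le_sdp {n k : ℕ} (A : Matrix (Fin n) (Fin n) ℝ) (hk : 1 ≤ k) (hkn : k ≤ n) :
    sparseEig k A ≤ sdp k A := by
  obtain ⟨v, hv, hvk⟩ := exists_sparse_unit hk hkn
  refine csSup_le ⟨_, v, hv, hvk, rfl⟩ ?_
  rintro r ⟨v, hv, hk, rfl⟩
  exact quadForm_le_sdp A hv hk

theorem sdp_le {n k : ℕ} {A : Matrix (Fin n) (Fin n) ℝ} (hk : 1 ≤ k) (hkn : k ≤ n) {b : ℝ}
    (h : ∀ X : Matrix (Fin n) (Fin n) ℝ, X.PosSemidef → X.trace = 1 →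
      ∑ i, ∑ j, |X i j| ≤ (k : ℝ) → (A * X).trace ≤ b) : sdp k A ≤ b := by
  obtain ⟨v, hv, hvk⟩ := exists_sparse_unit hk hkn
  refine csSup_le ⟨_, _, posSemidef_rankOne v, trace_rankOne hv,
    sum_abs_sq_le_of_sparse hv hvk, rfl⟩ ?_
  rintro r ⟨X, hX, ht, h1, rfl⟩
  exact h X hX ht h1

theorem eigenvalues_le_lamMax {n : ℕ} {A : Matrix (Fin n) (Fin n) ℝ} (hA : A.IsHermitian)
    (i : Fin n) : hA.eigenvalues i ≤ lamMax A :=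
  le_csSup A.finite_real_spectrum.bddAbove (hA.eigenvalues_mem_spectrum_real i)

theorem neg_trace_mul_le {n k : ℕ} {Y X : Matrix (Fin n) (Fin n) ℝ} {z : ℝ} (hz : 0 ≤ z)
    (hX : X.IsSymm) (h1 : ∑ i, ∑ j, |X i j| ≤ (k : ℝ)) (hY : ∀ i j, |Y i j| ≤ z) :
    -(Y * X).trace ≤ k * z := by
  rw [trace_mul_eq_sum Y X hX, ← Finset.sum_neg_distrib]
  calc ∑ i, -∑ j, Y i j * X i j ≤ ∑ i, ∑ j, z * |X i j| := by
        refine Finset.sum_le_sum fun i _ => ?_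
        rw [← Finset.sum_neg_distrib]
        refine Finset.sum_le_sum fun j _ => ?_
        refine (neg_le_abs _).trans ?_
        rw [abs_mul]
        exact mul_le_mul_of_nonneg_right (hY i j) (abs_nonneg _)
    _ = z * ∑ i, ∑ j, |X i j| := by simp [Finset.mul_sum]
    _ ≤ k * z := by nlinarith

theorem sdp_le_lamMax_softCert {n k : ℕ} {A : Matrix (Fin n) (Fin n) ℝ} (hA : A.IsSymm)
    (hk : 1 ≤ k) (hkn : k ≤ n) {z : ℝ} (hz : 0 ≤ z) :
    sdp k A ≤ lamMax (A + softCert z A) + k * z := by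
  have hYs : (softCert z A).IsSymm := by
    ext i j
    simp [softCert, hA.apply i j]
  have hY : ∀ i j, |softCert z A i j| ≤ z := by
    intro i j
    unfold softCert
    split_ifs with h
    · rwa [abs_neg]
    · rw [abs_neg, abs_mul, abs_of_nonneg hz]
      rcases Real.sign_apply_eq (A i j) with h | h | h <;> simp [h, hz]
  have hM : (A + softCert z A).IsHermitian := isHermitian_of_isSymm (hA.add hYs)
  refine sdp_le hk hkn fun X hX ht h1 => ?_
  have e : (A * X).trace = ((A + softCert z A) * X).trace - (softCert z A * X).trace := by
    rw [Matrix.add_mul, Matrix.trace_add]; ring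
  have h2 := trace_mul_le_of_eigenvalues_le hM hX (eigenvalues_le_lamMax hM)
  have h3 := neg_trace_mul_le hz (isSymm_of_isHermitian hX.1) h1 hY
  rw [ht, mul_one] at h2
  rw [e]; linarith

/-- Power iteration: `M ^ p / tr (M ^ p)` almost maximises `tr (M X)`. -/
theorem trace_mul_trace_pow_le {n N p : ℕ} {M X : Matrix (Fin n) (Fin n) ℝ}
    (hM : M.PosSemidef) (hX : X.PosSemidef) (ht : X.trace = 1) (hN : 1 ≤ N) (hp : n * N ^ 2 ≤ p) :
    (1 - 1 / (N : ℝ)) * (M * X).trace * (M ^ p).trace ≤ (M ^ (p + 1)).trace := by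
  have hn : Nonempty (Fin n) := by
    by_contra h
    rw [not_nonempty_iff] at h
    simp [Matrix.trace] at ht
  set lam := hM.1.eigenvalues with hlam
  have hl0 : ∀ i, 0 ≤ lam i := hM.eigenvalues_nonneg
  obtain ⟨i₀, hi₀⟩ := Finite.exists_max lam
  have h1 : (M * X).trace ≤ lam i₀ := by
    simpa [ht] using trace_mul_le_of_eigenvalues_le hM.1 hX hi₀
  have hNr : (1 : ℝ) ≤ N := by exact_mod_cast hN
  set δ : ℝ := 1 / (N : ℝ) with hδ
  have hδ0 : 0 < δ := by positivity
  have hδ1 : δ ≤ 1 := by rw [hδ, div_le_one (by positivity)]; exact hNr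
  have hbern : (n : ℝ) * (1 - δ) ^ p ≤ δ := by
    have e1 : (1 - δ) ^ p * (1 + p * δ) ≤ 1 := by
      have h2 : 1 + (p : ℝ) * δ ≤ (1 + δ) ^ p := one_add_mul_le_pow (by linarith) p
      calc (1 - δ) ^ p * (1 + p * δ) ≤ (1 - δ) ^ p * (1 + δ) ^ p :=
            mul_le_mul_of_nonneg_left h2 (pow_nonneg (by linarith) _)
        _ = ((1 - δ) * (1 + δ)) ^ p := by rw [mul_pow]
        _ ≤ 1 := pow_le_one₀ (mul_nonneg (by linarith) (by linarith)) (by nlinarith)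
    have e2 : (n : ℝ) ≤ (1 + p * δ) * δ := by
      have : (n : ℝ) * N ^ 2 ≤ p := by exact_mod_cast hp
      have e3 : (n : ℝ) = n * N ^ 2 * δ * δ := by rw [hδ]; field_simp
      nlinarith [mul_le_mul_of_nonneg_right this (mul_nonneg hδ0.le hδ0.le)]
    have e4 : 0 ≤ (1 - δ) ^ p := pow_nonneg (by linarith) _
    nlinarith
  have hsum : 0 ≤ ∑ i, (lam i ^ (p + 1) - (1 - δ) * lam i₀ * lam i ^ p) := by
    have hterm : ∀ i, -((1 - δ) ^ p * lam i₀ ^ (p + 1)) ≤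
        lam i ^ (p + 1) - (1 - δ) * lam i₀ * lam i ^ p := by
      intro i
      have hp0 : 0 ≤ lam i ^ p := pow_nonneg (hl0 i) _
      have hnn : 0 ≤ (1 - δ) ^ p * lam i₀ ^ (p + 1) :=
        mul_nonneg (pow_nonneg (by linarith) _) (pow_nonneg (hl0 _) _)
      by_cases h : (1 - δ) * lam i₀ ≤ lam i
      · have : 0 ≤ (lam i - (1 - δ) * lam i₀) * lam i ^ p := mul_nonneg (by linarith) hp0
        have e5 : lam i ^ (p + 1) = lam i * lam i ^ p := by ring
        rw [e5]; linarith
      · push Not at h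
        have h3 : lam i ^ p ≤ ((1 - δ) * lam i₀) ^ p := pow_le_pow_left₀ (hl0 i) h.le p
        have h4 : (1 - δ) * lam i₀ * lam i ^ p ≤ lam i₀ * ((1 - δ) * lam i₀) ^ p := by
          apply mul_le_mul _ h3 hp0 (hl0 _)
          nlinarith [hl0 i₀]
        have h5 : 0 ≤ lam i ^ (p + 1) := pow_nonneg (hl0 i) _
        have h6 : lam i₀ * ((1 - δ) * lam i₀) ^ p = (1 - δ) ^ p * lam i₀ ^ (p + 1) := by
          rw [mul_pow]; ring
        linarith
    rw [← Finset.add_sum_erase _ _ (Finset.mem_univ i₀)]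
    have h7 : ∑ i ∈ Finset.univ.erase i₀, -((1 - δ) ^ p * lam i₀ ^ (p + 1)) ≤
        ∑ i ∈ Finset.univ.erase i₀, (lam i ^ (p + 1) - (1 - δ) * lam i₀ * lam i ^ p) :=
      Finset.sum_le_sum fun i _ => hterm i
    rw [Finset.sum_const, nsmul_eq_mul] at h7
    have h8 : ((Finset.univ.erase i₀).card : ℝ) ≤ n := by
      exact_mod_cast (Finset.card_le_univ _).trans (by simp)
    have h9 : 0 ≤ lam i₀ ^ (p + 1) := pow_nonneg (hl0 _) _
    have h10 : 0 ≤ (1 - δ) ^ p * lam i₀ ^ (p + 1) :=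
      mul_nonneg (pow_nonneg (by linarith) _) h9
    have h11 := mul_le_mul_of_nonneg_right h8 h10
    have h12 := mul_le_mul_of_nonneg_right hbern h9
    have h13 : lam i₀ ^ (p + 1) - (1 - δ) * lam i₀ * lam i₀ ^ p = δ * lam i₀ ^ (p + 1) := by
      rw [pow_succ]; ring
    rw [h13]; nlinarith
  rw [Finset.sum_sub_distrib, ← Finset.mul_sum, ← trace_pow_eq_sum_eigenvalues,
    ← trace_pow_eq_sum_eigenvalues] at hsum
  have hT : 0 ≤ (M ^ p).trace := (hM.pow p).trace_nonneg
  have := mul_le_mul_of_nonneg_right (mul_le_mul_of_nonneg_left h1 (by linarith : 0 ≤ 1 - δ)) hT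
  linarith


/-! ### A subgradient method for the dual of the semidefinite program, in integer arithmetic -/

/-- The indicator of positivity. -/
def ipos (d : ℤ) : ℤ := if 0 < d then 1 else 0

/-- `matPow n M p` is the `(p + 1)`-st power of the `n × n` matrix `M`. -/
def matPow (n : ℕ) (M : ℕ → ℕ → ℤ) : ℕ → ℕ → ℕ → ℤ
  | 0 => M
  | p + 1 => fun i j => ∑ l ∈ Finset.range n, matPow n M p i l * M l j

/-- The data of the subgradient method: the matrix `G` is scaled by `q` and shifted by `c`. -/
structure SubgradData where
  n : ℕ
  k : ℕ
  G : ℕ → ℕ → ℤ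
  U : ℕ
  q : ℕ
  c : ℕ
  p : ℕ

namespace SubgradData

variable (D : SubgradData)

def shifted (Y : ℕ → ℕ → ℤ) (i j : ℕ) : ℤ := D.q * D.G i j + Y i j + if i = j then (D.c : ℤ) else 0

def powM (Y : ℕ → ℕ → ℤ) : ℕ → ℕ → ℕ → ℤ := matPow D.n (D.shifted Y)

def trPow (Y : ℕ → ℕ → ℤ) : ℤ := ∑ i ∈ Finset.range D.n, D.powM Y D.p i i

/-- The best response, rounded to multiples of `1 / U`. -/
def resp (Y : ℕ → ℕ → ℤ) (i j : ℕ) : ℤ := (D.U * D.powM Y D.p i j) / D.trPow Y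

def newY (Y : ℕ → ℕ → ℤ) (z : ℤ) (i j : ℕ) : ℤ :=
  Y i j - (D.resp Y i j + D.U * D.k * (ipos (Y i j - z) - ipos (-Y i j - z)))

def viol (Y : ℕ → ℕ → ℤ) (z : ℤ) (i j : ℕ) : ℤ := ipos (Y i j - z) + ipos (-Y i j - z)

def newz (Y : ℕ → ℕ → ℤ) (z : ℤ) : ℤ :=
  z - D.U * D.k * (1 - ∑ i ∈ Finset.range D.n, ∑ j ∈ Finset.range D.n, viol Y z i j)

def gainEntry (Y : ℕ → ℕ → ℤ) (z : ℤ) (i j : ℕ) : ℤ :=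
  D.resp Y i j * (D.q * D.G i j + Y i j)
    + D.U * D.k * ((Y i j - z) * ipos (Y i j - z) + (-Y i j - z) * ipos (-Y i j - z))

def gain (Y : ℕ → ℕ → ℤ) (z : ℤ) : ℤ :=
  D.U * D.k * z + ∑ i ∈ Finset.range D.n, ∑ j ∈ Finset.range D.n, D.gainEntry Y z i j

/-- The state `(Y, z, S)` after `t` steps. -/
def iter : ℕ → (ℕ → ℕ → ℤ) × ℤ × ℤ
  | 0 => (fun _ _ => 0, 0, 0)
  | t + 1 => (D.newY (iter t).1 (iter t).2.1, D.newz (iter t).1 (iter t).2.1,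
      (iter t).2.2 + D.gain (iter t).1 (iter t).2.1)

end SubgradData

theorem ipos_nonneg (d : ℤ) : 0 ≤ ipos d := by unfold ipos; split_ifs <;> norm_num

theorem ipos_le_one (d : ℤ) : ipos d ≤ 1 := by unfold ipos; split_ifs <;> norm_num

/-- The real `n × n` matrix with the given integer entries. -/
def toMat (n : ℕ) (M : ℕ → ℕ → ℤ) : Matrix (Fin n) (Fin n) ℝ := Matrix.of fun i j => (M i j : ℝ)

theorem toMat_matPow (n : ℕ) (M : ℕ → ℕ → ℤ) (p : ℕ) :
    toMat n (matPow n M p) = toMat n M ^ (p + 1) := by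
  induction p with
  | zero => simp [matPow]
  | succ p ih =>
    rw [pow_succ, ← ih]
    ext i j
    simp only [toMat, Matrix.of_apply, matPow, Matrix.mul_apply]
    push_cast
    rw [Finset.sum_range]

theorem posSemidef_of_shift {n : ℕ} {B : Matrix (Fin n) (Fin n) ℝ} (hB : B.IsSymm) {b c : ℝ}
    (hb : ∀ i j, |B i j| ≤ b) (hc : n * b ≤ c) :
    (B + c • (1 : Matrix (Fin n) (Fin n) ℝ)).PosSemidef := by
  have hs : (B + c • (1 : Matrix (Fin n) (Fin n) ℝ)).IsSymm := by
    ext i j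
    simp [hB.apply i j, Matrix.one_apply, eq_comm]
  refine Matrix.PosSemidef.of_dotProduct_mulVec_nonneg (isHermitian_of_isSymm hs) fun v => ?_
  have h1 : star v ⬝ᵥ ((B + c • (1 : Matrix (Fin n) (Fin n) ℝ)).mulVec v)
      = (∑ i, ∑ j, v i * B i j * v j) + c * ∑ i, v i ^ 2 := by
    rw [Matrix.add_mulVec, dotProduct_add, Matrix.smul_mulVec, Matrix.one_mulVec,
      dotProduct_smul]
    simp only [dotProduct, Matrix.mulVec, star_trivial, smul_eq_mul, Finset.mul_sum]
    congr 1
    · exact Finset.sum_congr rfl fun i _ => Finset.sum_congr rfl fun j _ => by ring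
    · exact Finset.sum_congr rfl fun i _ => by ring
  have h2 : -(b * (∑ i, |v i|) ^ 2) ≤ ∑ i, ∑ j, v i * B i j * v j := by
    rw [sq, Finset.sum_mul_sum, Finset.mul_sum, ← Finset.sum_neg_distrib]
    refine Finset.sum_le_sum fun i _ => ?_
    rw [Finset.mul_sum, ← Finset.sum_neg_distrib]
    refine Finset.sum_le_sum fun j _ => ?_
    refine le_trans ?_ (neg_abs_le _)
    rw [neg_le_neg_iff, abs_mul, abs_mul]
    nlinarith [mul_le_mul_of_nonneg_right (hb i j) (mul_nonneg (abs_nonneg (v i)) (abs_nonneg (v j)))]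
  have h3 : (∑ i, |v i|) ^ 2 ≤ n * ∑ i, v i ^ 2 := by
    have := sq_sum_le_card_mul_sum_sq (s := Finset.univ) (f := fun i => |v i|)
    simpa using this
  rw [h1]
  rcases isEmpty_or_nonempty (Fin n) with h | ⟨⟨i₀⟩⟩
  · simp
  have hb0 : 0 ≤ b := (abs_nonneg _).trans (hb i₀ i₀)
  have h4 : 0 ≤ ∑ i, v i ^ 2 := Finset.sum_nonneg fun i _ => sq_nonneg _
  nlinarith [mul_le_mul_of_nonneg_left h3 hb0, mul_le_mul_of_nonneg_right hc h4]

/-- The exact penalty: a violation of the `ℓ¹` constraint never pays off. -/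
theorem exists_penalty_le_sdp {n k : ℕ} {A X : Matrix (Fin n) (Fin n) ℝ}
    (hA : ∀ i j, |A i j| ≤ 1) (hX : X.PosSemidef) (ht : X.trace = 1) (hk : 1 ≤ k) :
    ∃ z₀ : ℝ, (z₀ = 0 ∨ z₀ = 1) ∧
      ∑ i, ∑ j, A i j * X i j - z₀ * (∑ i, ∑ j, |X i j| - k) ≤ sdp k A := by
  have hXs := isSymm_of_isHermitian hX.1
  by_cases h : ∑ i, ∑ j, |X i j| ≤ (k : ℝ)
  · refine ⟨0, Or.inl rfl, ?_⟩
    rw [zero_mul, sub_zero, ← trace_mul_eq_sum A X hXs]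
    exact le_sdp A hX ht h
  · push Not at h
    refine ⟨1, Or.inr rfl, ?_⟩
    have hk1 : (1 : ℝ) ≤ k := by exact_mod_cast hk
    set a := ∑ i, ∑ j, |X i j| with ha
    set s : ℝ := (k - 1) / (a - 1) with hs
    have ha1 : 0 < a - 1 := by linarith
    have hs0 : 0 ≤ s := div_nonneg (by linarith) ha1.le
    have hs1 : s ≤ 1 := by rw [hs, div_le_one ha1]; linarith
    have hsa : s * (a - 1) = k - 1 := by rw [hs]; field_simp
    have hd : ∑ i, |X i i| = 1 := by
      rw [← ht]
      exact Finset.sum_congr rfl fun i _ => abs_of_nonneg hX.diag_nonneg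
    set X' : Matrix (Fin n) (Fin n) ℝ := s • X + (1 - s) • Matrix.diagonal fun i => X i i with hX'
    have hX'p : X'.PosSemidef :=
      (hX.smul hs0).add ((Matrix.PosSemidef.diagonal fun i => hX.diag_nonneg).smul (by linarith))
    have e : ∀ i j, X' i j = s * X i j + (1 - s) * (if i = j then X i i else 0) := by
      intro i j; simp [hX', Matrix.diagonal_apply]
    have ht' : X'.trace = 1 := by
      rw [← ht]
      refine Finset.sum_congr rfl fun i _ => ?_
      simp only [Matrix.diag_apply, e, if_true]; ring
    have h1 : ∑ i, ∑ j, |X' i j| ≤ (k : ℝ) := by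
      calc ∑ i, ∑ j, |X' i j| ≤ ∑ i, ∑ j, (s * |X i j| + (1 - s) * if i = j then |X i i| else 0) := by
            refine Finset.sum_le_sum fun i _ => Finset.sum_le_sum fun j _ => ?_
            rw [e]
            refine (abs_add_le _ _).trans ?_
            rw [abs_mul, abs_mul, abs_of_nonneg hs0, abs_of_nonneg (by linarith : 0 ≤ 1 - s)]
            gcongr
            split_ifs <;> simp
        _ = s * a + (1 - s) * 1 := by
            simp only [Finset.sum_add_distrib, ← Finset.mul_sum, Finset.sum_ite_eq,
              Finset.mem_univ, if_true, hd, ha]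
        _ ≤ k := by linarith
    have h2 := le_sdp A hX'p ht' h1
    rw [trace_mul_eq_sum A X' (isSymm_of_isHermitian hX'p.1)] at h2
    refine le_trans ?_ h2
    have h3 : ∑ i, ∑ j, A i j * X i j - ∑ i, ∑ j, A i j * X' i j
        ≤ ∑ i, ∑ j, (1 - s) * (|X i j| - if i = j then |X i i| else 0) := by
      rw [← Finset.sum_sub_distrib]
      refine Finset.sum_le_sum fun i _ => ?_
      rw [← Finset.sum_sub_distrib]
      refine Finset.sum_le_sum fun j _ => ?_
      rw [e]
      by_cases hij : i = j
      · subst hij; simp; nlinarith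
      · simp only [hij, if_false]
        have : A i j * X i j ≤ |X i j| := by
          refine (le_abs_self _).trans ?_
          rw [abs_mul]
          exact mul_le_of_le_one_left (abs_nonneg _) (hA i j)
        nlinarith
    have h4 : ∑ i, ∑ j, (1 - s) * (|X i j| - if i = j then |X i i| else 0) = (1 - s) * (a - 1) := by
      simp only [mul_sub, Finset.sum_sub_distrib, ← Finset.mul_sum, Finset.sum_ite_eq,
              Finset.mem_univ, if_true, hd, ha]
    rw [h4] at h3
    nlinarith


theorem cast_div_mem {a t : ℤ} (ht : 0 < t) :
    (a : ℝ) / t - 1 ≤ ((a / t : ℤ) : ℝ) ∧ ((a / t : ℤ) : ℝ) ≤ (a : ℝ) / t := by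
  have ht' : (0 : ℝ) < t := by exact_mod_cast ht
  constructor
  · have := Int.lt_ediv_add_one_mul_self a ht
    have h : (a : ℝ) < (((a / t : ℤ) : ℝ) + 1) * t := by exact_mod_cast this
    rw [sub_le_iff_le_add, div_le_iff₀ ht']; exact h.le
  · rw [le_div_iff₀ ht']; exact_mod_cast Int.ediv_mul_le a ht.ne'

theorem trace_pow_pos {n : ℕ} {M : Matrix (Fin n) (Fin n) ℝ} (hM : M.PosSemidef)
    (ht : 0 < M.trace) (p : ℕ) : 0 < (M ^ p).trace := by
  have h0 := hM.eigenvalues_nonneg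
  have h1 : M.trace = ∑ i, hM.1.eigenvalues i := by
    simpa using trace_pow_eq_sum_eigenvalues hM.1 1
  rw [h1] at ht
  obtain ⟨i, -, hi⟩ := Finset.exists_lt_of_sum_lt (s := Finset.univ) (f := fun _ : Fin n => (0 : ℝ))
    (g := hM.1.eigenvalues) (by simpa using ht)
  rw [trace_pow_eq_sum_eigenvalues hM.1]
  exact Finset.sum_pos' (fun j _ => pow_nonneg (h0 j) _) ⟨i, Finset.mem_univ _, pow_pos hi _⟩

theorem abs_sum_mul_le {n : ℕ} {X B : Fin n → Fin n → ℝ} {a b : ℝ} (ha : 0 ≤ a)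
    (hX : ∀ i j, |X i j| ≤ a) (hB : ∀ i j, |B i j| ≤ b) :
    |∑ i, ∑ j, X i j * B i j| ≤ n ^ 2 * (a * b) := by
  calc |∑ i, ∑ j, X i j * B i j| ≤ ∑ i, ∑ j, |X i j * B i j| :=
        (Finset.abs_sum_le_sum_abs _ _).trans
          (Finset.sum_le_sum fun i _ => Finset.abs_sum_le_sum_abs _ _)
    _ ≤ ∑ _i : Fin n, ∑ _j : Fin n, a * b := by
        refine Finset.sum_le_sum fun i _ => Finset.sum_le_sum fun j _ => ?_
        rw [abs_mul]
        exact mul_le_mul (hX i j) (hB i j) (abs_nonneg _) ha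
    _ = n ^ 2 * (a * b) := by simp; ring

namespace SubgradData

variable (D : SubgradData)

theorem toMat_shifted (Y : ℕ → ℕ → ℤ) :
    toMat D.n (D.shifted Y) = toMat D.n (fun i j => D.q * D.G i j + Y i j)
      + (D.c : ℝ) • (1 : Matrix (Fin D.n) (Fin D.n) ℝ) := by
  ext i j
  simp only [toMat, shifted, Matrix.of_apply, Matrix.add_apply, Matrix.smul_apply,
    Matrix.one_apply, Fin.val_inj]
  split_ifs <;> simp

theorem exists_response {b : ℕ} {Y : ℕ → ℕ → ℤ} (hn : 1 ≤ D.n)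
    (hs : (toMat D.n fun i j => D.q * D.G i j + Y i j).IsSymm)
    (hb : ∀ i j : Fin D.n, |D.q * D.G i j + Y i j| ≤ b) (hc : D.n * b + 1 ≤ D.c)
    {N : ℕ} (hN : 1 ≤ N) (hp : D.n * N ^ 2 ≤ D.p) :
    ∃ X : Matrix (Fin D.n) (Fin D.n) ℝ, X.PosSemidef ∧ X.trace = 1 ∧
      (∀ i j : Fin D.n, (D.U : ℝ) * X i j - 1 ≤ D.resp Y i j ∧ (D.resp Y i j : ℝ) ≤ D.U * X i j) ∧
      ∀ X' : Matrix (Fin D.n) (Fin D.n) ℝ, X'.PosSemidef → X'.trace = 1 →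
        (1 - 1 / (N : ℝ)) * (∑ i : Fin D.n, ∑ j : Fin D.n, ((D.q * D.G i j + Y i j : ℤ) : ℝ) * X' i j + D.c)
          ≤ ∑ i : Fin D.n, ∑ j : Fin D.n, ((D.q * D.G i j + Y i j : ℤ) : ℝ) * X i j + D.c := by
  set B := toMat D.n fun i j => D.q * D.G i j + Y i j with hBdef
  set M := toMat D.n (D.shifted Y) with hMdef
  have hMB : M = B + (D.c : ℝ) • (1 : Matrix (Fin D.n) (Fin D.n) ℝ) := D.toMat_shifted Y
  have hB : ∀ i j, |B i j| ≤ (b : ℝ) := fun i j => by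
    simp only [hBdef, toMat, Matrix.of_apply]; exact_mod_cast hb i j
  have hcr : (D.n : ℝ) * b + 1 ≤ D.c := by exact_mod_cast hc
  have hM : M.PosSemidef := by
    rw [hMB]; exact posSemidef_of_shift hs hB (by linarith)
  have hnr : (1 : ℝ) ≤ D.n := by exact_mod_cast hn
  have hMt : 0 < M.trace := by
    have : M.trace = ∑ i, (B i i + D.c) := by
      rw [hMB]; simp [Matrix.trace]
    rw [this]
    have : Nonempty (Fin D.n) := ⟨⟨0, hn⟩⟩
    refine Finset.sum_pos (fun i _ => ?_) Finset.univ_nonempty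
    have := (abs_le.mp (hB i i)).1
    have hb0 : (0 : ℝ) ≤ b := by positivity
    nlinarith
  have hP : toMat D.n (D.powM Y D.p) = M ^ (D.p + 1) := toMat_matPow _ _ _
  have htr : (D.trPow Y : ℝ) = (M ^ (D.p + 1)).trace := by
    rw [← hP, trPow, Finset.sum_range]; simp [toMat, Matrix.trace]
  have htp : 0 < (M ^ (D.p + 1)).trace := trace_pow_pos hM hMt _
  have htpi : 0 < D.trPow Y := by rw [← htr] at htp; exact_mod_cast htp
  set X := ((M ^ (D.p + 1)).trace)⁻¹ • M ^ (D.p + 1) with hX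
  have hXp : X.PosSemidef := (hM.pow _).smul (inv_nonneg.mpr htp.le)
  have hXt : X.trace = 1 := by
    rw [hX, Matrix.trace_smul, smul_eq_mul, inv_mul_cancel₀ htp.ne']
  have hconv : ∀ X' : Matrix (Fin D.n) (Fin D.n) ℝ, X'.PosSemidef → X'.trace = 1 →
      (M * X').trace = ∑ i : Fin D.n, ∑ j : Fin D.n, ((D.q * D.G i j + Y i j : ℤ) : ℝ) * X' i j + D.c := by
    intro X' hX' ht'
    rw [hMB, Matrix.add_mul, Matrix.trace_add, Matrix.smul_mul, Matrix.one_mul, Matrix.trace_smul,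
      ht', trace_mul_eq_sum _ _ (isSymm_of_isHermitian hX'.1)]
    simp [hBdef, toMat]
  refine ⟨X, hXp, hXt, fun i j => ?_, fun X' hX' ht' => ?_⟩
  · have h1 := cast_div_mem (a := D.U * D.powM Y D.p i j) htpi
    have h2 : ((D.U * D.powM Y D.p i j : ℤ) : ℝ) / (D.trPow Y : ℝ) = D.U * X i j := by
      have h3 : (D.powM Y D.p i j : ℝ) = (M ^ (D.p + 1)) i j := by rw [← hP]; rfl
      rw [hX, Matrix.smul_apply, smul_eq_mul, htr, Int.cast_mul, h3]
      push_cast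
      ring
    rw [h2] at h1
    exact h1
  · rw [← hconv X' hX' ht', ← hconv X hXp hXt]
    have h1 := trace_mul_trace_pow_le hM hX' ht' hN (hp.trans (Nat.le_succ D.p))
    have h2 : (M * X).trace = ((M ^ (D.p + 1)).trace)⁻¹ * (M ^ (D.p + 1 + 1)).trace := by
      rw [hX, Matrix.mul_smul, Matrix.trace_smul, smul_eq_mul, pow_succ' M (D.p + 1)]
    rw [h2, le_inv_mul_iff₀ htp]
    linarith

theorem abs_resp_le {r : ℤ} {U : ℕ} {x : ℝ} (hU : 1 ≤ U) (hx : |x| ≤ 1)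
    (h : (U : ℝ) * x - 1 ≤ r ∧ (r : ℝ) ≤ U * x) : |r| ≤ 2 * U := by
  have h1 := abs_le.mp hx
  have hU : (1 : ℝ) ≤ U := by exact_mod_cast hU
  have h2 : (r : ℝ) ≤ 2 * U := by nlinarith
  have h3 : -(2 * U : ℝ) ≤ r := by nlinarith
  rw [abs_le]
  exact ⟨by exact_mod_cast h3, by exact_mod_cast h2⟩

/-- The invariant of the subgradient method. -/
def Good (y : ℕ) (Y : ℕ → ℕ → ℤ) : Prop :=
  (∀ i j : Fin D.n, Y i j = Y j i) ∧ ∀ i j : Fin D.n, |Y i j| ≤ y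

theorem resp_symm {Y : ℕ → ℕ → ℤ} (hs : (toMat D.n fun i j => D.q * D.G i j + Y i j).IsSymm)
    (i j : Fin D.n) : D.resp Y i j = D.resp Y j i := by
  have hM : (toMat D.n (D.shifted Y)).IsSymm := by
    rw [D.toMat_shifted Y]
    ext i j
    simp [hs.apply i j, Matrix.one_apply, eq_comm]
  have hP : (toMat D.n (D.powM Y D.p)).IsSymm := by
    rw [powM, toMat_matPow]; exact hM.pow _
  have h := hP.apply j i
  simp only [toMat, Matrix.of_apply, Int.cast_inj] at h
  rw [resp, resp, h]

theorem good_newY {y : ℕ} {Y : ℕ → ℕ → ℤ} {z : ℤ} (hY : D.Good y Y)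
    (hs : (toMat D.n fun i j => D.q * D.G i j + Y i j).IsSymm)
    (hr : ∀ i j : Fin D.n, |D.resp Y i j| ≤ 2 * D.U) :
    D.Good (y + D.U * (D.k + 2)) (D.newY Y z) := by
  refine ⟨fun i j => ?_, fun i j => ?_⟩
  · rw [newY, newY, hY.1 i j, D.resp_symm hs i j]
  · have h1 := abs_le.mp (hY.2 i j)
    have h2 := abs_le.mp (hr i j)
    have a1 := ipos_nonneg (Y i j - z)
    have a2 := ipos_le_one (Y i j - z)
    have a3 := ipos_nonneg (-Y i j - z)
    have a4 := ipos_le_one (-Y i j - z)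
    have h5 : (0 : ℤ) ≤ D.U * D.k := by positivity
    rw [newY, abs_le]
    push_cast
    constructor <;> nlinarith

theorem gain_le {Ys : Fin D.n → Fin D.n → ℝ} {zs : ℝ} (hYs : ∀ i j, |Ys i j| ≤ zs)
    {Y : ℕ → ℕ → ℤ} {z : ℤ} (hr : ∀ i j : Fin D.n, |D.resp Y i j| ≤ 2 * D.U) (hn : 1 ≤ D.n) :
    (D.gain Y z : ℝ) ≤ D.U * D.k * zs +
      ∑ i : Fin D.n, ∑ j : Fin D.n, (D.resp Y i j : ℝ) * (D.q * D.G i j + Ys i j)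
      + ((∑ i : Fin D.n, ∑ j : Fin D.n, ((Y i j : ℝ) - Ys i j) ^ 2 + (z - zs) ^ 2)
        - (∑ i : Fin D.n, ∑ j : Fin D.n, ((D.newY Y z i j : ℝ) - Ys i j) ^ 2
            + (D.newz Y z - zs) ^ 2)) / 2
      + (D.n ^ 2 * (D.U * (D.k + 2)) ^ 2 + (2 * D.n ^ 2 * D.U * D.k) ^ 2) / 2 := by
  set V : ℝ := ∑ i : Fin D.n, ∑ j : Fin D.n, (viol Y z i j : ℝ) with hV
  have hVc : ((∑ i ∈ Finset.range D.n, ∑ j ∈ Finset.range D.n, viol Y z i j : ℤ) : ℝ) = V := by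
    rw [Finset.sum_range]; push_cast
    exact Finset.sum_congr rfl fun i _ => by rw [Finset.sum_range]
  have hv : ∀ i j : Fin D.n, (0 : ℝ) ≤ viol Y z i j ∧ (viol Y z i j : ℝ) ≤ 2 := by
    intro i j
    have a1 := ipos_nonneg (Y i j - z)
    have a2 := ipos_le_one (Y i j - z)
    have a3 := ipos_nonneg (-Y i j - z)
    have a4 := ipos_le_one (-Y i j - z)
    unfold viol
    constructor <;> [(have : (0 : ℤ) ≤ ipos (Y i j - z) + ipos (-Y i j - z) := by linarith);
      (have : ipos (Y i j - z) + ipos (-Y i j - z) ≤ (2 : ℤ) := by linarith)] <;>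
      exact_mod_cast this
  have hV0 : 0 ≤ V := Finset.sum_nonneg fun i _ => Finset.sum_nonneg fun j _ => (hv i j).1
  have hV1 : V ≤ 2 * D.n ^ 2 := by
    calc V ≤ ∑ _i : Fin D.n, ∑ _j : Fin D.n, (2 : ℝ) :=
          Finset.sum_le_sum fun i _ => Finset.sum_le_sum fun j _ => (hv i j).2
      _ = 2 * D.n ^ 2 := by simp; ring
  have hnr : (1 : ℝ) ≤ D.n := by exact_mod_cast hn
  have hUk : (0 : ℝ) ≤ D.U * D.k := by positivity
  have hz : (D.newz Y z : ℝ) = z - D.U * D.k * (1 - V) := by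
    rw [newz]; push_cast [← hVc]; ring
  have hzb : (D.U * D.k * (1 - V)) ^ 2 ≤ (2 * D.n ^ 2 * D.U * D.k) ^ 2 := by
    have h1 : -(2 * (D.n : ℝ) ^ 2) ≤ 1 - V := by linarith
    have h2 : 1 - V ≤ 2 * (D.n : ℝ) ^ 2 := by nlinarith
    have h3 := mul_le_mul_of_nonneg_left h1 hUk
    have h4 := mul_le_mul_of_nonneg_left h2 hUk
    apply sq_le_sq' <;> linarith
  have hentry : ∀ i j : Fin D.n, (D.gainEntry Y z i j : ℝ) ≤
      (D.resp Y i j : ℝ) * (D.q * D.G i j + Ys i j)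
      + (((Y i j : ℝ) - Ys i j) ^ 2 - ((D.newY Y z i j : ℝ) - Ys i j) ^ 2) / 2
      + (D.U * (D.k + 2)) ^ 2 / 2 - D.U * D.k * viol Y z i j * (z - zs) := by
    intro i j
    have a1 : (0 : ℝ) ≤ ipos (Y i j - z) := by exact_mod_cast ipos_nonneg _
    have a2 : (ipos (Y i j - z) : ℝ) ≤ 1 := by exact_mod_cast ipos_le_one _
    have a3 : (0 : ℝ) ≤ ipos (-Y i j - z) := by exact_mod_cast ipos_nonneg _
    have a4 : (ipos (-Y i j - z) : ℝ) ≤ 1 := by exact_mod_cast ipos_le_one _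
    have h1 := abs_le.mp (hYs i j)
    have hr' : |(D.resp Y i j : ℝ)| ≤ 2 * D.U := by exact_mod_cast hr i j
    have h2 := abs_le.mp hr'
    simp only [gainEntry, newY, viol]
    push_cast
    set r : ℝ := (D.resp Y i j : ℝ)
    set y : ℝ := (Y i j : ℝ)
    set p1 : ℝ := (ipos (Y i j - z) : ℝ)
    set p2 : ℝ := (ipos (-Y i j - z) : ℝ)
    set w : ℝ := r + D.U * D.k * (p1 - p2) with hw
    have hw2 : w ^ 2 ≤ (D.U * (D.k + 2)) ^ 2 := by
      apply sq_le_sq' <;> nlinarith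
    have hnn : 0 ≤ D.U * D.k * (p1 * (zs - Ys i j) + p2 * (zs + Ys i j)) :=
      mul_nonneg hUk (add_nonneg (mul_nonneg a1 (by linarith)) (mul_nonneg a3 (by linarith)))
    have e1 : (y - w - Ys i j) ^ 2 = (y - Ys i j) ^ 2 - 2 * w * (y - Ys i j) + w ^ 2 := by ring
    have e2 : 2 * w * (y - Ys i j) = 2 * (r * (y - Ys i j) + D.U * D.k * (p1 - p2) * (y - Ys i j)) := by
      rw [hw]; ring
    rw [e1, e2]
    linarith
  have hsum := Finset.sum_le_sum (s := Finset.univ) fun i (_ : i ∈ Finset.univ) =>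
    Finset.sum_le_sum (s := Finset.univ) fun j (_ : j ∈ Finset.univ) => hentry i j
  have hg : (D.gain Y z : ℝ) = D.U * D.k * z + ∑ i : Fin D.n, ∑ j : Fin D.n,
      (D.gainEntry Y z i j : ℝ) := by
    rw [gain, Finset.sum_range]
    push_cast
    congr 1
    exact Finset.sum_congr rfl fun i _ => by rw [Finset.sum_range]
  rw [hg]
  have hsplit : ∑ i : Fin D.n, ∑ j : Fin D.n, ((D.resp Y i j : ℝ) * (D.q * D.G i j + Ys i j)
      + (((Y i j : ℝ) - Ys i j) ^ 2 - ((D.newY Y z i j : ℝ) - Ys i j) ^ 2) / 2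
      + (D.U * (D.k + 2)) ^ 2 / 2 - D.U * D.k * viol Y z i j * (z - zs))
      = ∑ i : Fin D.n, ∑ j : Fin D.n, (D.resp Y i j : ℝ) * (D.q * D.G i j + Ys i j)
      + (∑ i : Fin D.n, ∑ j : Fin D.n, ((Y i j : ℝ) - Ys i j) ^ 2
        - ∑ i : Fin D.n, ∑ j : Fin D.n, ((D.newY Y z i j : ℝ) - Ys i j) ^ 2) / 2
      + D.n ^ 2 * (D.U * (D.k + 2)) ^ 2 / 2 - D.U * D.k * V * (z - zs) := by
    simp only [Finset.sum_add_distrib, Finset.sum_sub_distrib, ← Finset.sum_div,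
      ← Finset.sum_mul, ← Finset.mul_sum, hV]
    simp
    ring
  rw [hsplit] at hsum
  rw [hz]
  nlinarith

theorem le_gain {m b N : ℕ} {Y : ℕ → ℕ → ℤ} {z : ℤ} (hk : 1 ≤ D.k) (hkn : D.k ≤ D.n) (hm : 1 ≤ m)
    (hb : ∀ i j : Fin D.n, |D.q * D.G i j + Y i j| ≤ b) (hN : 1 ≤ N)
    {X : Matrix (Fin D.n) (Fin D.n) ℝ}
    (hr : ∀ i j : Fin D.n, (D.U : ℝ) * X i j - 1 ≤ D.resp Y i j ∧ (D.resp Y i j : ℝ) ≤ D.U * X i j)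
    (hmax : ∀ X' : Matrix (Fin D.n) (Fin D.n) ℝ, X'.PosSemidef → X'.trace = 1 →
        (1 - 1 / (N : ℝ)) * (∑ i : Fin D.n, ∑ j : Fin D.n,
            ((D.q * D.G i j + Y i j : ℤ) : ℝ) * X' i j + D.c)
          ≤ ∑ i : Fin D.n, ∑ j : Fin D.n, ((D.q * D.G i j + Y i j : ℤ) : ℝ) * X i j + D.c)
    (hU : 1 ≤ D.U) (hq : 1 ≤ D.q) :
    (D.U : ℝ) * (D.q * m) * sdp D.k (Matrix.of fun i j : Fin D.n => (D.G i j : ℝ) / m)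
      ≤ D.gain Y z + D.U * (D.n ^ 2 * b + D.c) / N + D.n ^ 2 * b := by
  have hUr : (1 : ℝ) ≤ D.U := by exact_mod_cast hU
  have hqr : (1 : ℝ) ≤ D.q := by exact_mod_cast hq
  have hmr : (1 : ℝ) ≤ m := by exact_mod_cast hm
  have hNr : (1 : ℝ) ≤ N := by exact_mod_cast hN
  have hpos : (0 : ℝ) < D.U * (D.q * m) := by positivity
  rw [mul_comm, ← le_div_iff₀ hpos]
  refine sdp_le hk hkn fun X' hX' ht' h1' => ?_
  rw [le_div_iff₀ hpos]
  set B : Fin D.n → Fin D.n → ℝ := fun i j => ((D.q * D.G i j + Y i j : ℤ) : ℝ) with hB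
  have hBb : ∀ i j, |B i j| ≤ (b : ℝ) := fun i j => by
    simp only [hB]; exact_mod_cast hb i j
  set H : Fin D.n → Fin D.n → ℝ := fun i j =>
    (((Y i j - z) * ipos (Y i j - z) + (-Y i j - z) * ipos (-Y i j - z) : ℤ) : ℝ) with hH
  have hH0 : ∀ i j, 0 ≤ H i j ∧ |(Y i j : ℝ)| ≤ z + H i j := by
    intro i j
    have : 0 ≤ (Y i j - z) * ipos (Y i j - z) + (-Y i j - z) * ipos (-Y i j - z) ∧
        |Y i j| ≤ z + ((Y i j - z) * ipos (Y i j - z) + (-Y i j - z) * ipos (-Y i j - z)) := by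
      unfold ipos
      rw [abs_le]
      split_ifs <;> (refine ⟨?_, ?_, ?_⟩ <;> linarith)
    simp only [hH]
    exact ⟨by exact_mod_cast this.1, by exact_mod_cast this.2⟩
  set Hs := ∑ i, ∑ j, H i j with hHs
  have hHle : ∀ i j, H i j ≤ Hs := fun i j =>
    (Finset.single_le_sum (f := fun j => H i j) (fun j _ => (hH0 i j).1) (Finset.mem_univ j)).trans
      (Finset.single_le_sum (f := fun i => ∑ j, H i j)
        (fun i _ => Finset.sum_nonneg fun j _ => (hH0 i j).1) (Finset.mem_univ i))
  have hn0 : 0 < D.n := by omega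
  have hzH : 0 ≤ z + Hs := by
    have := (hH0 ⟨0, hn0⟩ ⟨0, hn0⟩).2
    linarith [abs_nonneg ((Y (⟨0, hn0⟩ : Fin D.n) (⟨0, hn0⟩ : Fin D.n) : ℤ) : ℝ),
      hHle ⟨0, hn0⟩ ⟨0, hn0⟩]
  have hg : (D.gain Y z : ℝ) = D.U * D.k * z + ∑ i : Fin D.n, ∑ j : Fin D.n,
      (D.resp Y i j : ℝ) * B i j + D.U * D.k * Hs := by
    rw [gain, Finset.sum_range]
    push_cast
    rw [hHs, Finset.mul_sum, add_assoc, ← Finset.sum_add_distrib]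
    congr 1
    refine Finset.sum_congr rfl fun i _ => ?_
    rw [Finset.sum_range, Finset.mul_sum, ← Finset.sum_add_distrib]
    refine Finset.sum_congr rfl fun j _ => ?_
    simp only [gainEntry, hB, hH]
    push_cast; ring
  have h1 : |∑ i : Fin D.n, ∑ j : Fin D.n, ((D.resp Y i j : ℝ) - D.U * X i j) * B i j|
      ≤ D.n ^ 2 * (1 * b) :=
    abs_sum_mul_le zero_le_one (fun i j => by
      rw [abs_le]; constructor <;> linarith [(hr i j).1, (hr i j).2]) hBb
  have h1e : ∑ i : Fin D.n, ∑ j : Fin D.n, ((D.resp Y i j : ℝ) - D.U * X i j) * B i j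
      = ∑ i : Fin D.n, ∑ j : Fin D.n, (D.resp Y i j : ℝ) * B i j
        - D.U * ∑ i : Fin D.n, ∑ j : Fin D.n, B i j * X i j := by
    simp only [Finset.mul_sum, ← Finset.sum_sub_distrib]
    exact Finset.sum_congr rfl fun i _ => Finset.sum_congr rfl fun j _ => by ring
  rw [h1e] at h1
  have h2 := hmax X' hX' ht'
  have h3 : |∑ i, ∑ j, X' i j * B i j| ≤ D.n ^ 2 * (1 * b) :=
    abs_sum_mul_le zero_le_one (abs_entry_le_one hX' ht') hBb
  have h3e : ∑ i, ∑ j, X' i j * B i j = ∑ i, ∑ j, B i j * X' i j :=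
    Finset.sum_congr rfl fun i _ => Finset.sum_congr rfl fun j _ => mul_comm _ _
  rw [h3e] at h3
  have h4 : D.q * m * ((Matrix.of fun i j : Fin D.n => (D.G i j : ℝ) / m) * X').trace
      ≤ ∑ i, ∑ j, B i j * X' i j + D.k * (z + Hs) := by
    rw [trace_mul_eq_sum _ _ (isSymm_of_isHermitian hX'.1)]
    have h5 : ∑ i : Fin D.n, ∑ j : Fin D.n, -((Y i j : ℝ) * X' i j) ≤ ∑ i, ∑ j, (z + Hs) * |X' i j| := by
      refine Finset.sum_le_sum fun i _ => Finset.sum_le_sum fun j _ => ?_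
      refine (neg_le_abs _).trans ?_
      rw [abs_mul]
      exact mul_le_mul_of_nonneg_right ((hH0 i j).2.trans (by linarith [hHle i j])) (abs_nonneg _)
    simp only [← Finset.mul_sum] at h5
    have h6 : D.q * m * ∑ i : Fin D.n, ∑ j : Fin D.n,
        (Matrix.of fun i j : Fin D.n => (D.G i j : ℝ) / m) i j * X' i j
        = ∑ i, ∑ j, B i j * X' i j + ∑ i : Fin D.n, ∑ j : Fin D.n, -((Y i j : ℝ) * X' i j) := by
      simp only [Finset.mul_sum, ← Finset.sum_add_distrib]
      refine Finset.sum_congr rfl fun i _ => Finset.sum_congr rfl fun j _ => ?_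
      simp only [hB, Matrix.of_apply]
      push_cast
      field_simp
      ring
    rw [h6]
    nlinarith [mul_le_mul_of_nonneg_left h1' hzH]
  have h7 := (abs_le.mp h1).1
  have h8 := (abs_le.mp h3).2
  have hδ : (0 : ℝ) ≤ 1 / N := by positivity
  have h9 : ∑ i, ∑ j, B i j * X' i j - (1 / N : ℝ) * (D.n ^ 2 * b + D.c)
      ≤ ∑ i, ∑ j, B i j * X i j := by nlinarith
  have h10 := mul_le_mul_of_nonneg_left h9 (by linarith : (0 : ℝ) ≤ D.U)
  have h11 := mul_le_mul_of_nonneg_left h4 (by linarith : (0 : ℝ) ≤ D.U)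
  rw [hg]
  have e : (D.U : ℝ) * (D.n ^ 2 * b + D.c) / N = D.U * ((1 / N : ℝ) * (D.n ^ 2 * b + D.c)) := by
    ring
  rw [e]
  nlinarith

end SubgradData

/-- The parameters of the subgradient method for `m` observations of `n` spins. -/
def sdpData (n m k : ℕ) (G : ℕ → ℕ → ℤ) : SubgradData where
  n := n
  k := k
  G := G
  U := 4 * n ^ 5 * m ^ 2
  q := 28 * n ^ 11 * m ^ 2
  c := n * (28 * n ^ 11 * m ^ 2 * m * (1 + 3 * n ^ 3 * m)) + 1
  p := 144 * n ^ 11 * m ^ 4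

def sdpSteps (n m : ℕ) : ℕ := 7 * n ^ 8 * m ^ 2

section

variable {n m k : ℕ} {G : ℕ → ℕ → ℤ}

theorem sdpData_shift_bound (hkn : k ≤ n) (hn : 1 ≤ n)
    (hGb : ∀ i j : Fin n, |G i j| ≤ m) {y : ℕ}
    (hy : y ≤ sdpSteps n m * ((sdpData n m k G).U * (k + 2)))
    {Y : ℕ → ℕ → ℤ} (hY : ∀ i j : Fin n, |Y i j| ≤ y) (i j : Fin n) :
    |(sdpData n m k G).q * G i j + Y i j|
      ≤ ((28 * n ^ 11 * m ^ 2 * m * (1 + 3 * n ^ 3 * m) : ℕ) : ℤ) := by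
  have h1 : |((sdpData n m k G).q : ℤ) * G i j| ≤ (28 * n ^ 11 * m ^ 2 : ℕ) * m := by
    rw [abs_mul, abs_of_nonneg (by positivity)]
    exact mul_le_mul_of_nonneg_left (hGb i j) (by positivity)
  have h2 : y ≤ 28 * n ^ 11 * m ^ 2 * m * (3 * n ^ 3 * m) := by
    refine hy.trans ?_
    simp only [sdpSteps, sdpData]
    have : k + 2 ≤ 3 * n := by omega
    calc 7 * n ^ 8 * m ^ 2 * (4 * n ^ 5 * m ^ 2 * (k + 2))
        ≤ 7 * n ^ 8 * m ^ 2 * (4 * n ^ 5 * m ^ 2 * (3 * n)) := by gcongr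
      _ = 28 * n ^ 11 * m ^ 2 * m * (3 * n ^ 3 * m) := by ring
  have h3 : (y : ℤ) ≤ ((28 * n ^ 11 * m ^ 2 * m * (3 * n ^ 3 * m) : ℕ) : ℤ) := by exact_mod_cast h2
  refine (abs_add_le _ _).trans ?_
  have := (hY i j).trans h3
  push_cast at *
  nlinarith

theorem sdpData_step (hk : 1 ≤ k) (hkn : k ≤ n) (hm : 1 ≤ m)
    (hGs : ∀ i j : Fin n, G i j = G j i) (hGb : ∀ i j : Fin n, |G i j| ≤ m) {y : ℕ}
    (hy : y ≤ sdpSteps n m * ((sdpData n m k G).U * (k + 2)))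
    {Y : ℕ → ℕ → ℤ} (hY : (sdpData n m k G).Good y Y) :
    ∃ X : Matrix (Fin n) (Fin n) ℝ, X.PosSemidef ∧ X.trace = 1 ∧
      (∀ i j : Fin n, ((sdpData n m k G).U : ℝ) * X i j - 1 ≤ (sdpData n m k G).resp Y i j ∧
        ((sdpData n m k G).resp Y i j : ℝ) ≤ (sdpData n m k G).U * X i j) ∧
      (∀ i j : Fin n, |(sdpData n m k G).resp Y i j| ≤ 2 * (sdpData n m k G).U) ∧
      (∀ z, (sdpData n m k G).Good (y + (sdpData n m k G).U * (k + 2))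
        ((sdpData n m k G).newY Y z)) ∧
      ∀ z, ((sdpData n m k G).U : ℝ) * ((sdpData n m k G).q * m) *
        sdp k (Matrix.of fun i j : Fin n => (G i j : ℝ) / m) ≤ (sdpData n m k G).gain Y z
          + 2 * ((sdpData n m k G).U * (sdpData n m k G).q) := by
  set D := sdpData n m k G with hD
  have hn : 1 ≤ n := hk.trans hkn
  have hU : 1 ≤ D.U := Nat.one_le_iff_ne_zero.mpr (by simp [hD, sdpData]; omega)
  have hq : 1 ≤ D.q := Nat.one_le_iff_ne_zero.mpr (by simp [hD, sdpData]; omega)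
  set b : ℕ := 28 * n ^ 11 * m ^ 2 * m * (1 + 3 * n ^ 3 * m) with hb
  have hbb : ∀ i j : Fin n, |D.q * G i j + Y i j| ≤ (b : ℤ) :=
    sdpData_shift_bound hkn hn hGb hy hY.2
  have hs : (toMat D.n fun i j => D.q * D.G i j + Y i j).IsSymm := by
    ext i j
    have e1 : Y j i = Y i j := hY.1 j i
    have e2 : D.G j i = D.G i j := hGs j i
    simp only [toMat, Matrix.transpose_apply, Matrix.of_apply, e1, e2]
  set N : ℕ := 12 * n ^ 5 * m ^ 2 with hN
  have hN1 : 1 ≤ N := Nat.one_le_iff_ne_zero.mpr (by simp [hN]; omega)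
  obtain ⟨X, hX, ht, hr, hmax⟩ := D.exists_response (b := b) (Y := Y) (N := N) hn hs hbb
    (le_of_eq (by simp [hD, sdpData, hb])) hN1 (le_of_eq (by simp [hD, sdpData, hN]; ring))
  have hr2 : ∀ i j : Fin n, |D.resp Y i j| ≤ 2 * D.U := fun i j =>
    SubgradData.abs_resp_le hU (abs_entry_le_one hX ht i j) (hr i j)
  refine ⟨X, hX, ht, hr, hr2, fun z => D.good_newY hY hs hr2, fun z => ?_⟩
  refine (D.le_gain (m := m) (b := b) (N := N) (z := z) hk hkn hm hbb hN1 hr hmax hU hq).trans ?_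
  have hnr : (1 : ℝ) ≤ n := by exact_mod_cast hn
  have hmr : (1 : ℝ) ≤ m := by exact_mod_cast hm
  have hnm : (1 : ℝ) ≤ (n : ℝ) ^ 3 * m := by
    calc (1 : ℝ) = 1 ^ 3 * 1 := by norm_num
      _ ≤ n ^ 3 * m := by gcongr
  have hbr : (b : ℝ) ≤ D.q * m * (4 * n ^ 3 * m) := by
    have : (b : ℝ) = D.q * m * (1 + 3 * n ^ 3 * m) := by simp [hb, hD, sdpData]
    rw [this]
    have : (0 : ℝ) ≤ D.q * m := by positivity
    apply mul_le_mul_of_nonneg_left _ this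
    linarith
  have hb1 : (1 : ℝ) ≤ b := by
    have : b ≠ 0 := by simp [hb]; omega
    exact_mod_cast Nat.one_le_iff_ne_zero.mpr this
  have hc : (D.c : ℝ) = n * b + 1 := by simp [hD, sdpData, hb]
  have hn2 : (n : ℝ) ≤ n ^ 2 := by nlinarith
  have hDn : (D.n : ℝ) = n := rfl
  have h3 : (D.n : ℝ) ^ 2 * b + D.c ≤ 3 * n ^ 2 * b := by
    rw [hc, hDn]; nlinarith
  have h4 : (D.n : ℝ) ^ 2 * b ≤ D.U * D.q := by
    rw [hDn]
    calc (n : ℝ) ^ 2 * b ≤ n ^ 2 * ((D.q : ℝ) * m * (4 * n ^ 3 * m)) := by gcongr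
      _ = (D.U : ℝ) * D.q := by simp [hD, sdpData]; ring
  have h5 : (D.U : ℝ) * (D.n ^ 2 * b + D.c) / N ≤ D.U * D.q := by
    have hN0 : (0 : ℝ) < N := by exact_mod_cast hN1
    rw [div_le_iff₀ hN0, mul_assoc]
    refine mul_le_mul_of_nonneg_left (h3.trans ?_) (by positivity)
    calc 3 * (n : ℝ) ^ 2 * b ≤ 3 * n ^ 2 * ((D.q : ℝ) * m * (4 * n ^ 3 * m)) := by gcongr
      _ = (D.q : ℝ) * N := by simp [hN]; ring
  linarith

theorem sdpData_iter_good (hk : 1 ≤ k) (hkn : k ≤ n) (hm : 1 ≤ m)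
    (hGs : ∀ i j : Fin n, G i j = G j i) (hGb : ∀ i j : Fin n, |G i j| ≤ m) :
    ∀ t ≤ sdpSteps n m, (sdpData n m k G).Good (t * ((sdpData n m k G).U * (k + 2)))
      ((sdpData n m k G).iter t).1
  | 0, _ => ⟨fun _ _ => rfl, fun i j => by simp [SubgradData.iter]⟩
  | t + 1, ht => by
    have ih := sdpData_iter_good hk hkn hm hGs hGb t (by omega)
    obtain ⟨X, -, -, -, -, h, -⟩ := sdpData_step hk hkn hm hGs hGb
      (Nat.mul_le_mul_right _ (by omega : t ≤ sdpSteps n m)) ih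
    rw [Nat.succ_mul]
    exact h _

theorem sdp_le_iter (hk : 1 ≤ k) (hkn : k ≤ n) (hm : 1 ≤ m)
    (hGs : ∀ i j : Fin n, G i j = G j i) (hGb : ∀ i j : Fin n, |G i j| ≤ m) :
    ∀ t ≤ sdpSteps n m, t * (((sdpData n m k G).U : ℝ) * ((sdpData n m k G).q * m) *
        sdp k (Matrix.of fun i j : Fin n => (G i j : ℝ) / m))
      ≤ ((sdpData n m k G).iter t).2.2 + t * (2 * ((sdpData n m k G).U * (sdpData n m k G).q))
  | 0, _ => by simp [SubgradData.iter]
  | t + 1, ht => by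
    have ih := sdp_le_iter hk hkn hm hGs hGb t (by omega)
    obtain ⟨X, -, -, -, -, -, h⟩ := sdpData_step hk hkn hm hGs hGb
      (Nat.mul_le_mul_right _ (by omega : t ≤ sdpSteps n m))
      (sdpData_iter_good hk hkn hm hGs hGb t (by omega))
    have := h ((sdpData n m k G).iter t).2.1
    simp only [SubgradData.iter]
    push_cast
    linarith

theorem sdpData_error_bounds (hn : 1 ≤ n) (hm : 1 ≤ m) (hkn : k ≤ n) :
    ((n : ℝ) ^ 2 * ((sdpData n m k G).U * (k + 2)) ^ 2
      + (2 * (n : ℝ) ^ 2 * (sdpData n m k G).U * k) ^ 2) / 2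
        ≤ (sdpData n m k G).U * (sdpData n m k G).q ∧
    (n : ℝ) ^ 2 * ((sdpData n m k G).q * m) ^ 2
      = sdpSteps n m * ((sdpData n m k G).U * (sdpData n m k G).q) ∧
    (n : ℝ) ^ 2 * (1 * (2 * ((sdpData n m k G).q * m)))
      ≤ (sdpData n m k G).U * (sdpData n m k G).q := by
  have hnr : (1 : ℝ) ≤ n := by exact_mod_cast hn
  have hmr : (1 : ℝ) ≤ m := by exact_mod_cast hm
  have hkn' : (k : ℝ) ≤ n := by exact_mod_cast hkn
  have hTv : (sdpSteps n m : ℝ) = 7 * n ^ 8 * m ^ 2 := by simp [sdpSteps]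
  have hUv : ((sdpData n m k G).U : ℝ) = 4 * n ^ 5 * m ^ 2 := by simp [sdpData]
  have hqv : ((sdpData n m k G).q : ℝ) = 28 * n ^ 11 * m ^ 2 := by simp [sdpData]
  generalize ((sdpData n m k G).U : ℝ) = U at *
  generalize ((sdpData n m k G).q : ℝ) = q at *
  have hU0 : 0 ≤ U := by rw [hUv]; positivity
  refine ⟨?_, ?_, ?_⟩
  · have h1 : (n : ℝ) ^ 2 * (U * (k + 2)) ^ 2 ≤ n ^ 2 * (U * (3 * n)) ^ 2 := by
      gcongr
      linarith
    have h2 : (2 * (n : ℝ) ^ 2 * U * k) ^ 2 ≤ (2 * n ^ 2 * U * n) ^ 2 := by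
      gcongr
    have h3 : (n : ℝ) ^ 2 * (U * (3 * n)) ^ 2 + (2 * n ^ 2 * U * n) ^ 2 ≤ 14 * n ^ 6 * U ^ 2 := by
      have h4 : (n : ℝ) ^ 4 ≤ n ^ 6 := pow_le_pow_right₀ hnr (by norm_num)
      have h5 := mul_le_mul_of_nonneg_right h4 (sq_nonneg U)
      have h6 : 0 ≤ (n : ℝ) ^ 6 * U ^ 2 := by positivity
      linarith
    have h6 : U * q = 7 * n ^ 6 * U ^ 2 := by rw [hUv, hqv]; ring
    rw [h6]
    linarith
  · rw [hTv, hUv, hqv]; ring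
  · have h4 : (n : ℝ) ^ 2 ≤ n ^ 5 := pow_le_pow_right₀ hnr (by norm_num)
    have h2 : 2 * (n : ℝ) ^ 2 ≤ 4 * n ^ 5 * m := by
      have : (n : ℝ) ^ 5 * 1 ≤ n ^ 5 * m := by gcongr
      linarith [pow_pos (by linarith : (0 : ℝ) < n) 5]
    have hq0 : 0 ≤ q * m := by rw [hqv]; positivity
    have h5 := mul_le_mul_of_nonneg_right h2 hq0
    rw [hUv] at *
    linarith

set_option maxHeartbeats 1000000 in
theorem iter_le_sdp (hk : 1 ≤ k) (hkn : k ≤ n) (hm : 1 ≤ m)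
    (hGs : ∀ i j : Fin n, G i j = G j i) (hGb : ∀ i j : Fin n, |G i j| ≤ m) :
    (((sdpData n m k G).iter (sdpSteps n m)).2.2 : ℝ) ≤
      sdpSteps n m * (((sdpData n m k G).U : ℝ) * ((sdpData n m k G).q * m) *
        sdp k (Matrix.of fun i j : Fin n => (G i j : ℝ) / m))
      + sdpSteps n m * (3 * ((sdpData n m k G).U * (sdpData n m k G).q)) := by
  set D := sdpData n m k G with hD
  set T := sdpSteps n m with hT
  have hn : 1 ≤ n := hk.trans hkn
  have hnr : (1 : ℝ) ≤ n := by exact_mod_cast hn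
  have hmr : (1 : ℝ) ≤ m := by exact_mod_cast hm
  have hkr : (1 : ℝ) ≤ k := by exact_mod_cast hk
  have hT1 : 1 ≤ T := Nat.one_le_iff_ne_zero.mpr (by simp [hT, sdpSteps]; omega)
  have hTr : (1 : ℝ) ≤ T := by exact_mod_cast hT1
  have hstep : ∀ t : Fin T, _ := fun t => sdpData_step hk hkn hm hGs hGb
      (Nat.mul_le_mul_right _ (by omega : (t : ℕ) ≤ sdpSteps n m))
      (sdpData_iter_good hk hkn hm hGs hGb t (by omega))
  choose X hX ht hr hr2 _ _ using hstep
  set Xb : Matrix (Fin n) (Fin n) ℝ := (T : ℝ)⁻¹ • ∑ t, X t with hXb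
  have hXbp : Xb.PosSemidef :=
    (Matrix.posSemidef_sum _ fun t _ => hX t).smul (by positivity)
  have hXbt : Xb.trace = 1 := by
    rw [hXb, Matrix.trace_smul, Matrix.trace_sum]
    simp only [ht, Finset.sum_const, Finset.card_univ, Fintype.card_fin, nsmul_eq_mul, mul_one,
      smul_eq_mul]
    field_simp
  obtain ⟨z₀, hz₀, hpen⟩ := exists_penalty_le_sdp
    (A := Matrix.of fun i j : Fin n => (G i j : ℝ) / m) (k := k) (fun i j => by
      rw [Matrix.of_apply, abs_div, abs_of_nonneg (by linarith : (0 : ℝ) ≤ m),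
        div_le_one (by linarith)]
      exact_mod_cast hGb i j) hXbp hXbt hk
  have hz0 : 0 ≤ z₀ := by rcases hz₀ with h | h <;> simp [h]
  have hz1 : z₀ ≤ 1 := by rcases hz₀ with h | h <;> simp [h]
  set Q : ℝ := D.q * m with hQ
  have hQ0 : 0 ≤ Q := by positivity
  set zs : ℝ := z₀ * Q with hzs
  have hzs0 : 0 ≤ zs := by positivity
  have hzsQ : zs ≤ Q := by nlinarith
  set Ys : Fin n → Fin n → ℝ := fun i j => if 0 ≤ Xb i j then -zs else zs with hYs
  have hYsb : ∀ i j, |Ys i j| ≤ zs := fun i j => by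
    simp only [hYs]; split_ifs <;> simp [abs_of_nonneg hzs0]
  set E : ℝ := (D.n ^ 2 * (D.U * (D.k + 2)) ^ 2 + (2 * D.n ^ 2 * D.U * D.k) ^ 2) / 2 with hE
  set P : ℕ → ℝ := fun t => (∑ i : Fin n, ∑ j : Fin n, (((D.iter t).1 i j : ℝ) - Ys i j) ^ 2
    + ((D.iter t).2.1 - zs) ^ 2) with hP
  set C : Fin n → Fin n → ℝ := fun i j => D.q * G i j + Ys i j with hC
  have hCb : ∀ i j, |C i j| ≤ 2 * Q := by
    intro i j
    have h1 : |(D.q : ℝ) * G i j| ≤ Q := by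
      rw [abs_mul, abs_of_nonneg (by positivity)]
      exact mul_le_mul_of_nonneg_left (by exact_mod_cast hGb i j) (by positivity)
    exact (abs_add_le _ _).trans (by linarith [hYsb i j])
  have hterm : ∀ t : Fin T, ∑ i : Fin n, ∑ j : Fin n, (D.resp (D.iter t).1 i j : ℝ) * C i j
      ≤ D.U * (∑ i, ∑ j, X t i j * C i j) + n ^ 2 * (1 * (2 * Q)) := by
    intro t
    have h1 := abs_sum_mul_le (X := fun i j : Fin n => (D.resp (D.iter t).1 i j : ℝ) - D.U * X t i j)
      zero_le_one (fun i j => by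
        rw [abs_le]; constructor <;> linarith [(hr t i j).1, (hr t i j).2]) hCb
    have h2 : ∑ i : Fin n, ∑ j : Fin n, ((D.resp (D.iter t).1 i j : ℝ) - D.U * X t i j) * C i j
        = ∑ i : Fin n, ∑ j : Fin n, (D.resp (D.iter t).1 i j : ℝ) * C i j
          - D.U * (∑ i, ∑ j, X t i j * C i j) := by
      simp only [Finset.mul_sum, ← Finset.sum_sub_distrib]
      exact Finset.sum_congr rfl fun i _ => Finset.sum_congr rfl fun j _ => by ring
    rw [h2] at h1
    linarith [(abs_le.mp h1).2]
  have hgain : ∀ t : Fin T, (D.gain (D.iter t).1 (D.iter t).2.1 : ℝ) ≤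
      D.U * k * zs + (D.U * (∑ i, ∑ j, X t i j * C i j) + n ^ 2 * (1 * (2 * Q)))
      + (P t - P (t + 1)) / 2 + E := by
    intro t
    have h1 := D.gain_le (z := (D.iter t).2.1) hYsb (hr2 t) hn
    exact h1.trans (add_le_add (add_le_add (add_le_add le_rfl (hterm t)) le_rfl) le_rfl)
  have hS : ∀ t : ℕ, ((D.iter t).2.2 : ℝ) = ∑ s ∈ Finset.range t,
      (D.gain (D.iter s).1 (D.iter s).2.1 : ℝ) := by
    intro t
    induction t with
    | zero => simp [SubgradData.iter]
    | succ t ih => rw [Finset.sum_range_succ, ← ih]; simp [SubgradData.iter]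
  have htot := Finset.sum_le_sum fun t (_ : t ∈ Finset.univ) => hgain t
  rw [hS, Finset.sum_range]
  refine htot.trans ?_
  have htel : ∑ t : Fin T, (P t - P (t + 1)) = P 0 - P T := by
    rw [← Finset.sum_range fun t => P t - P (t + 1)]
    exact Finset.sum_range_sub' P T
  have hXC : ∑ t : Fin T, ∑ i, ∑ j, X t i j * C i j = T * ∑ i, ∑ j, Xb i j * C i j := by
    rw [Finset.sum_comm, Finset.mul_sum]
    refine Finset.sum_congr rfl fun i _ => ?_
    rw [Finset.sum_comm, Finset.mul_sum]
    refine Finset.sum_congr rfl fun j _ => ?_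
    rw [hXb, Matrix.smul_apply, Matrix.sum_apply, smul_eq_mul, ← Finset.sum_mul]
    field_simp
  have hXbC : ∑ i, ∑ j, Xb i j * C i j =
      Q * ∑ i, ∑ j, (Matrix.of fun i j : Fin n => (G i j : ℝ) / m) i j * Xb i j
        - zs * ∑ i, ∑ j, |Xb i j| := by
    simp only [Finset.mul_sum, ← Finset.sum_sub_distrib]
    refine Finset.sum_congr rfl fun i _ => Finset.sum_congr rfl fun j _ => ?_
    simp only [hC, hYs, Matrix.of_apply, hQ]
    split_ifs with h
    · rw [abs_of_nonneg h]; field_simp; ring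
    · rw [abs_of_neg (not_le.mp h)]; field_simp; ring
  have hP0 : P 0 ≤ 2 * (n ^ 2 * Q ^ 2) := by
    have h1 : ∀ i j, ((0 : ℝ) - Ys i j) ^ 2 ≤ Q ^ 2 := by
      intro i j
      rw [zero_sub, neg_sq]
      have := abs_le.mp (hYsb i j)
      apply sq_le_sq' <;> linarith
    have h2 : ∑ i : Fin n, ∑ j : Fin n, ((0 : ℝ) - Ys i j) ^ 2 ≤ n ^ 2 * Q ^ 2 := by
      calc ∑ i : Fin n, ∑ j : Fin n, ((0 : ℝ) - Ys i j) ^ 2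
          ≤ ∑ _i : Fin n, ∑ _j : Fin n, Q ^ 2 :=
            Finset.sum_le_sum fun i _ => Finset.sum_le_sum fun j _ => h1 i j
        _ = n ^ 2 * Q ^ 2 := by simp; ring
    have h3 : ((0 : ℝ) - zs) ^ 2 ≤ n ^ 2 * Q ^ 2 := by
      rw [zero_sub, neg_sq]
      have : zs ^ 2 ≤ Q ^ 2 := by gcongr
      nlinarith [sq_nonneg Q, one_le_pow₀ (n := 2) hnr]
    simp only [hP, SubgradData.iter, Int.cast_zero]
    linarith
  have hPT : 0 ≤ P T := by
    simp only [hP]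
    exact add_nonneg (Finset.sum_nonneg fun i _ => Finset.sum_nonneg fun j _ => sq_nonneg _)
      (sq_nonneg _)
  obtain ⟨hEb, hPb, hrb⟩ := sdpData_error_bounds (G := G) hn hm hkn
  change E ≤ D.U * D.q at hEb
  change (n : ℝ) ^ 2 * Q ^ 2 = T * (D.U * D.q) at hPb
  change (n : ℝ) ^ 2 * (1 * (2 * Q)) ≤ D.U * D.q at hrb
  have hmain : D.U * k * zs + D.U * ∑ i, ∑ j, Xb i j * C i j ≤
      D.U * Q * sdp k (Matrix.of fun i j : Fin n => (G i j : ℝ) / m) := by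
    rw [hXbC]
    have h1 := mul_le_mul_of_nonneg_left hpen (by positivity : (0 : ℝ) ≤ D.U * Q)
    refine le_trans (le_of_eq ?_) h1
    rw [hzs]; ring
  calc ∑ t : Fin T, (D.U * k * zs + (D.U * (∑ i, ∑ j, X t i j * C i j) + n ^ 2 * (1 * (2 * Q)))
        + (P t - P (t + 1)) / 2 + E)
      = T * (D.U * k * zs) + (D.U * (∑ t : Fin T, ∑ i, ∑ j, X t i j * C i j)
          + T * (n ^ 2 * (1 * (2 * Q)))) + (∑ t : Fin T, (P t - P (t + 1))) / 2 + T * E := by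
        simp only [Finset.sum_add_distrib, ← Finset.mul_sum, ← Finset.sum_div, Finset.sum_const,
          Finset.card_univ, Fintype.card_fin, nsmul_eq_mul]
        ring
    _ ≤ _ := by
        rw [htel, hXC]
        have hTn : (0 : ℝ) ≤ T := by positivity
        have a1 := mul_le_mul_of_nonneg_left hmain hTn
        have a2 := mul_le_mul_of_nonneg_left hrb hTn
        have a3 := mul_le_mul_of_nonneg_left hEb hTn
        linarith

end


/-! ### A program logic for the random access machine -/

theorem natAbs_lt_two_pow_bits (z : ℤ) : z.natAbs < 2 ^ (Expr.bits z - 1) := by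
  simpa [Expr.bits] using Nat.lt_size_self z.natAbs

theorem bits_le_of_natAbs_le {z : ℤ} {W : ℕ} (h : z.natAbs < 2 ^ W) : Expr.bits z ≤ W + 1 := by
  simpa [Expr.bits] using Nat.size_le.mpr h

theorem bits_pos (z : ℤ) : 1 ≤ Expr.bits z := by simp [Expr.bits]

theorem bits_add_le_of_natAbs_le {a b c : ℤ} (h : c.natAbs ≤ a.natAbs + b.natAbs) :
    Expr.bits c ≤ Expr.bits a + Expr.bits b := by
  have ha := natAbs_lt_two_pow_bits a
  have hb := natAbs_lt_two_pow_bits b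
  have ha' := bits_pos a
  have hb' := bits_pos b
  have h1 : c.natAbs < 2 ^ (Expr.bits a - 1 + (Expr.bits b - 1) + 1) := by
    have e1 : 2 ^ (Expr.bits a - 1) ≤ 2 ^ (Expr.bits a - 1 + (Expr.bits b - 1)) :=
      Nat.pow_le_pow_right (by norm_num) (by omega)
    have e2 : 2 ^ (Expr.bits b - 1) ≤ 2 ^ (Expr.bits a - 1 + (Expr.bits b - 1)) :=
      Nat.pow_le_pow_right (by norm_num) (by omega)
    rw [pow_succ]; omega
  have := bits_le_of_natAbs_le h1
  omega

theorem bits_mul_le (a b : ℤ) : Expr.bits (a * b) ≤ Expr.bits a + Expr.bits b := by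
  have ha := natAbs_lt_two_pow_bits a
  have hb := natAbs_lt_two_pow_bits b
  have ha' := bits_pos a
  have hb' := bits_pos b
  have h1 : (a * b).natAbs < 2 ^ (Expr.bits a - 1 + (Expr.bits b - 1)) := by
    rw [Int.natAbs_mul, pow_add]
    exact Nat.mul_lt_mul'' ha hb
  have := bits_le_of_natAbs_le h1
  omega

/-- All entries of the memory are bounded by `2 ^ W`. -/
def Bounded (W : ℕ) (s : Store) : Prop := ∀ a i j, |s a i j| ≤ 2 ^ W

theorem Expr.cost_le (e : Expr) : ∃ K : ℕ, ∀ (W : ℕ) (s : Store), Bounded W s →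
    e.cost s ≤ K * (W + 1) ∧ Expr.bits (e.eval s) ≤ K * (W + 1) := by
  have hbin : ∀ (e f g : Expr), (∀ s, g.cost s = e.cost s + f.cost s + Expr.bits (g.eval s)) →
      (∀ s, Expr.bits (g.eval s) ≤ Expr.bits (e.eval s) + Expr.bits (f.eval s)) →
      (∃ K : ℕ, ∀ (W : ℕ) (s : Store), Bounded W s →
        e.cost s ≤ K * (W + 1) ∧ Expr.bits (e.eval s) ≤ K * (W + 1)) →
      (∃ K : ℕ, ∀ (W : ℕ) (s : Store), Bounded W s →
        f.cost s ≤ K * (W + 1) ∧ Expr.bits (f.eval s) ≤ K * (W + 1)) →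
      ∃ K : ℕ, ∀ (W : ℕ) (s : Store), Bounded W s →
        g.cost s ≤ K * (W + 1) ∧ Expr.bits (g.eval s) ≤ K * (W + 1) := by
    rintro e f g hc hb ⟨K₁, h₁⟩ ⟨K₂, h₂⟩
    refine ⟨2 * (K₁ + K₂), fun W s hs => ?_⟩
    obtain ⟨a1, a2⟩ := h₁ W s hs
    obtain ⟨b1, b2⟩ := h₂ W s hs
    have h3 := hb s
    have e1 : 2 * (K₁ + K₂) * (W + 1) = 2 * (K₁ * (W + 1)) + 2 * (K₂ * (W + 1)) := by ring
    rw [hc, e1]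
    constructor <;> omega
  induction e with
  | const c =>
    refine ⟨Expr.bits c, fun W s _ => ?_⟩
    simp only [Expr.cost, Expr.eval]
    exact ⟨Nat.le_mul_of_pos_right _ (by omega), Nat.le_mul_of_pos_right _ (by omega)⟩
  | read a i j hi hj =>
    obtain ⟨K₁, h₁⟩ := hi
    obtain ⟨K₂, h₂⟩ := hj
    refine ⟨K₁ + K₂ + 2, fun W s hs => ?_⟩
    obtain ⟨a1, a2⟩ := h₁ W s hs
    obtain ⟨b1, b2⟩ := h₂ W s hs
    have h3 : Expr.bits ((Expr.read a i j).eval s) ≤ W + 2 := by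
      apply bits_le_of_natAbs_le
      have h := hs a (i.eval s) (j.eval s)
      rw [Int.abs_eq_natAbs] at h
      have h' : (s a (i.eval s) (j.eval s)).natAbs ≤ 2 ^ W := by exact_mod_cast h
      simp only [Expr.eval]
      exact h'.trans_lt (Nat.pow_lt_pow_right (by norm_num) (by omega))
    have e1 : (K₁ + K₂ + 2) * (W + 1) = K₁ * (W + 1) + K₂ * (W + 1) + 2 * (W + 1) := by ring
    simp only [Expr.cost]
    rw [e1]
    constructor <;> omega
  | add e f he hf =>
    exact hbin e f _ (fun s => rfl)
      (fun s => bits_add_le_of_natAbs_le (Int.natAbs_add_le _ _)) he hf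
  | sub e f he hf =>
    exact hbin e f _ (fun s => rfl)
      (fun s => bits_add_le_of_natAbs_le (Int.natAbs_sub_le _ _)) he hf
  | mul e f he hf =>
    exact hbin e f _ (fun s => rfl) (fun s => bits_mul_le _ _) he hf
  | div e f he hf =>
    exact hbin e f _ (fun s => rfl)
      (fun s => bits_add_le_of_natAbs_le
        ((Int.natAbs_ediv_le_natAbs _ _).trans (Nat.le_add_right _ _))) he hf

/-- The arrays that a program may write to. -/
def Cmd.writes : Cmd → Finset ℕ
  | .write a _ _ _ => {a}
  | .seq c d => c.writes ∪ d.writes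
  | .cond _ c d => c.writes ∪ d.writes
  | .loop _ c => c.writes

theorem Exec.frame {c : Cmd} {s s' : Store} {t : ℕ} (h : Exec c s s' t) {a : ℕ}
    (ha : a ∉ c.writes) : s' a = s a := by
  induction h with
  | write s b i j e =>
    have : a ≠ b := by simpa [Cmd.writes] using ha
    funext i' j'
    simp [Store.set, this]
  | seq _ _ ih₁ ih₂ =>
    simp only [Cmd.writes, Finset.mem_union, not_or] at ha
    rw [ih₂ ha.2, ih₁ ha.1]
  | cond_pos _ _ ih =>
    simp only [Cmd.writes, Finset.mem_union, not_or] at ha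
    exact ih ha.1
  | cond_neg _ _ ih =>
    simp only [Cmd.writes, Finset.mem_union, not_or] at ha
    exact ih ha.2
  | loop_stop _ => rfl
  | loop_step _ _ _ ih₁ ih₂ => rw [ih₂ ha, ih₁ ha]

theorem Store.set_same (s : Store) (a : ℕ) (i j v : ℤ) : s.set a i j v a i j = v := by
  simp [Store.set]

theorem Store.set_cell (s : Store) (a i j i' j' : ℕ) (v : ℤ) :
    s.set a (i : ℤ) (j : ℤ) v a (i' : ℤ) (j' : ℤ) = if i' = i ∧ j' = j then v else s a i' j' := by
  simp [Store.set]

theorem Store.set_other (s : Store) {a a' : ℕ} (h : a' ≠ a) (i j v : ℤ) :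
    s.set a i j v a' = s a' := by
  funext i' j'
  simp [Store.set, h]

/-- `Spec sz w P c Q`: started in a memory `s` with `P x s` and entries at most `2 ^ w`, the program
`c` halts in a memory `s'` with `Q x s s'` and entries at most `2 ^ w`, within a time that is
polynomial in the size `sz x`. -/
def Spec {α : Type*} (sz : α → ℕ) (w : Polynomial ℕ) (P : α → Store → Prop) (c : Cmd)
    (Q : α → Store → Store → Prop) : Prop :=
  ∃ p : Polynomial ℕ, ∀ x s, Bounded (w.eval (sz x)) s → P x s →
    ∃ s' t, Exec c s s' t ∧ t ≤ p.eval (sz x) ∧ Bounded (w.eval (sz x)) s' ∧ Q x s s'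

section

variable {α β : Type*} {sz : α → ℕ} {w : Polynomial ℕ} {P : α → Store → Prop}
  {c d : Cmd} {Q R : α → Store → Store → Prop}

theorem Spec.mono {P' : α → Store → Prop} (h : Spec sz w P' c R) (hP : ∀ x s, P x s → P' x s)
    (hQ : ∀ x s s', P x s → R x s s' → Q x s s') : Spec sz w P c Q := by
  obtain ⟨p, hp⟩ := h
  refine ⟨p, fun x s hb hx => ?_⟩
  obtain ⟨s', t, h1, h2, h3, h4⟩ := hp x s hb (hP x s hx)
  exact ⟨s', t, h1, h2, h3, hQ x s s' hx h4⟩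

theorem Spec.comap (h : Spec sz w P c Q) (f : β → α) :
    Spec (fun y => sz (f y)) w (fun y => P (f y)) c (fun y => Q (f y)) := by
  obtain ⟨p, hp⟩ := h
  exact ⟨p, fun y => hp (f y)⟩

theorem Spec.seq (hc : Spec sz w P c R)
    (hd : Spec (fun y : α × Store => sz y.1) w
      (fun y s => P y.1 y.2 ∧ R y.1 y.2 s ∧ ∀ a ∉ c.writes, s a = y.2 a) d
      (fun y _ s' => Q y.1 y.2 s')) : Spec sz w P (.seq c d) Q := by
  obtain ⟨p, hp⟩ := hc
  obtain ⟨q, hq⟩ := hd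
  refine ⟨p + q, fun x s hb hx => ?_⟩
  obtain ⟨s₁, t₁, e₁, ht₁, hb₁, h₁⟩ := hp x s hb hx
  obtain ⟨s₂, t₂, e₂, ht₂, hb₂, h₂⟩ := hq (x, s) s₁ hb₁ ⟨hx, h₁, fun a ha => e₁.frame ha⟩
  refine ⟨s₂, t₁ + t₂, .seq e₁ e₂, ?_, hb₂, h₂⟩
  rw [Polynomial.eval_add]
  exact Nat.add_le_add ht₁ ht₂

theorem Spec.write {a : ℕ} {i j e : Expr}
    (h : ∀ x s, P x s → |e.eval s| ≤ 2 ^ (w.eval (sz x)) ∧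
      Q x s (s.set a (i.eval s) (j.eval s) (e.eval s))) :
    Spec sz w P (.write a i j e) Q := by
  obtain ⟨K₁, h₁⟩ := i.cost_le
  obtain ⟨K₂, h₂⟩ := j.cost_le
  obtain ⟨K₃, h₃⟩ := e.cost_le
  refine ⟨Polynomial.C (K₁ + K₂ + K₃) * (w + 1) + 1, fun x s hs hx => ?_⟩
  refine ⟨_, _, .write s a i j e, ?_, ?_, (h x s hx).2⟩
  · simp only [Polynomial.eval_add, Polynomial.eval_mul, Polynomial.eval_C, Polynomial.eval_one]
    have := (h₁ _ s hs).1
    have := (h₂ _ s hs).1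
    have := (h₃ _ s hs).1
    rw [add_mul, add_mul]
    omega
  · intro a' i' j'
    simp only [Store.set]
    split_ifs
    · exact (h x s hx).1
    · exact hs a' i' j'

/-- `for` loop: the counter, in entry `(0, 0)` of array `v`, runs from `N - 1` down to `0`. -/
def forCmd (v : ℕ) (N : Expr) (c : Cmd) : Cmd :=
  .seq (.write v (.const 0) (.const 0) N)
    (.loop (.read v (.const 0) (.const 0))
      (.seq (.write v (.const 0) (.const 0) (.sub (.read v (.const 0) (.const 0)) (.const 1))) c))

theorem Spec.forCmd {v : ℕ} {eN : Expr} {N : α → ℕ} (I : α → Store → ℕ → Store → Prop)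
    (hN : ∀ x s, P x s → N x ≤ w.eval (sz x)) (heN : ∀ x s, P x s → eN.eval s = N x)
    (hinit : ∀ x s, P x s → I x s (N x) s)
    (hI : ∀ x s₀ i s z, I x s₀ i s → I x s₀ i (s.set v 0 0 z)) (hv : v ∉ c.writes)
    (hc : Spec (fun y : α × Store × ℕ => sz y.1) w
      (fun y s => P y.1 y.2.1 ∧ y.2.2 < N y.1 ∧ I y.1 y.2.1 (y.2.2 + 1) s ∧ s v 0 0 = y.2.2 ∧
        ∀ a ∉ insert v c.writes, s a = y.2.1 a) c (fun y _ s' => I y.1 y.2.1 y.2.2 s')) :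
    Spec sz w P (forCmd v eN c) (fun x s s' => I x s 0 s') := by
  obtain ⟨K₁, h₁⟩ := eN.cost_le
  obtain ⟨K₂, h₂⟩ := (Expr.read v (.const 0) (.const 0)).cost_le
  obtain ⟨K₃, h₃⟩ := (Expr.sub (.read v (.const 0) (.const 0)) (.const 1)).cost_le
  obtain ⟨q, hq⟩ := hc
  set k₀ := Expr.cost (fun _ _ _ => 0) (.const 0) with hk₀
  set r : Polynomial ℕ := Polynomial.C (K₂ + K₃) * (w + 1) + Polynomial.C (2 * k₀ + 1) + q with hr
  have hset : ∀ (W : ℕ) (s : Store) (z : ℤ), Bounded W s → |z| ≤ 2 ^ W →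
      Bounded W (s.set v 0 0 z) := by
    intro W s z hs hz a i j
    simp only [Store.set]
    split_ifs
    · exact hz
    · exact hs a i j
  have hpow : ∀ n W : ℕ, n ≤ W → |(n : ℤ)| ≤ 2 ^ W := by
    intro n W h
    rw [abs_of_nonneg (by positivity)]
    have : n < 2 ^ W := h.trans_lt Nat.lt_two_pow_self
    exact_mod_cast this.le
  have hloop : ∀ (x : α) (s₀ : Store), P x s₀ → ∀ i ≤ N x, ∀ s, Bounded (w.eval (sz x)) s →
      I x s₀ i s → s v 0 0 = i → (∀ a ∉ insert v c.writes, s a = s₀ a) →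
      ∃ s' t, Exec (.loop (.read v (.const 0) (.const 0))
        (.seq (.write v (.const 0) (.const 0) (.sub (.read v (.const 0) (.const 0)) (.const 1))) c))
        s s' t ∧ t ≤ i * r.eval (sz x) + K₂ * (w.eval (sz x) + 1) ∧ Bounded (w.eval (sz x)) s' ∧
        I x s₀ 0 s' := by
    intro x s₀ hx i
    induction i with
    | zero =>
      intro _ s hs hi hvi _
      refine ⟨s, _, Exec.loop_stop ?_, ?_, hs, hi⟩
      · simp [Expr.eval, hvi]
      · simpa using (h₂ _ s hs).1
    | succ i ih =>
      intro hiN s hs hi hvi hfr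
      have hev : (Expr.sub (.read v (.const 0) (.const 0)) (.const 1)).eval s = i := by
        simp [Expr.eval, hvi]
      set s₁ := s.set v 0 0 (i : ℤ) with hs₁
      have hb₁ : Bounded (w.eval (sz x)) s₁ :=
        hset _ _ _ hs (hpow _ _ ((by omega : i ≤ N x).trans (hN x s₀ hx)))
      have hw := Exec.write s v (.const 0) (.const 0)
        (.sub (.read v (.const 0) (.const 0)) (.const 1))
      rw [hev] at hw
      have hfr₁ : ∀ a ∉ insert v c.writes, s₁ a = s₀ a := by
        intro a ha
        rw [← hfr a ha]
        have : a ≠ v := fun h => ha (by simp [h])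
        funext i' j'
        simp [hs₁, Store.set, this]
      obtain ⟨s₂, t₂, e₂, ht₂, hb₂, hI₂⟩ := hq (x, s₀, i) s₁ hb₁
        ⟨hx, hiN, hI _ _ _ _ _ hi, by simp [hs₁, Store.set], hfr₁⟩
      have hv₂ : s₂ v 0 0 = i := by rw [e₂.frame hv]; simp [hs₁, Store.set]
      have hfr₂ : ∀ a ∉ insert v c.writes, s₂ a = s₀ a := by
        intro a ha
        rw [e₂.frame fun h => ha (Finset.mem_insert_of_mem h), hfr₁ a ha]
      obtain ⟨s₃, t₃, e₃, ht₃, hb₃, hI₃⟩ := ih (by omega) s₂ hb₂ hI₂ hv₂ hfr₂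
      refine ⟨s₃, _, .loop_step ?_ (.seq hw e₂) e₃, ?_, hb₃, hI₃⟩
      · simp only [Expr.eval, hvi]; positivity
      · have a1 := (h₂ _ s hs).1
        have a2 := (h₃ _ s hs).1
        have a3 : Expr.cost s (.const 0) = k₀ := rfl
        have e1 : r.eval (sz x) = K₂ * (w.eval (sz x) + 1) + K₃ * (w.eval (sz x) + 1)
            + (2 * k₀ + 1) + q.eval (sz x) := by
          simp only [hr, Polynomial.eval_add, Polynomial.eval_mul, Polynomial.eval_C,
            Polynomial.eval_one]
          ring
        have ht₂' : t₂ ≤ q.eval (sz x) := ht₂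
        rw [Nat.succ_mul, a3]
        omega
  refine ⟨Polynomial.C (K₁ + K₂) * (w + 1) + Polynomial.C (2 * k₀ + 1) + w * r, fun x s hs hx => ?_⟩
  have hb₁ : Bounded (w.eval (sz x)) (s.set v 0 0 (N x : ℤ)) :=
    hset _ _ _ hs (hpow _ _ (hN x s hx))
  obtain ⟨s₂, t₂, e₂, ht₂, hb₂, hI₂⟩ := hloop x s hx (N x) le_rfl (s.set v 0 0 (N x : ℤ)) hb₁
    (hI _ _ _ _ _ (hinit x s hx)) (by simp [Store.set]) (by
      intro a ha
      have : a ≠ v := fun h => ha (by simp [h])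
      funext i' j'
      simp [Store.set, this])
  have hw := Exec.write s v (.const 0) (.const 0) eN
  rw [heN x s hx] at hw
  refine ⟨s₂, _, .seq hw e₂, ?_, hb₂, hI₂⟩
  have a1 := (h₁ _ s hs).1
  have a3 : Expr.cost s (.const 0) = k₀ := rfl
  have a4 : N x * r.eval (sz x) ≤ w.eval (sz x) * r.eval (sz x) :=
    Nat.mul_le_mul_right _ (hN x s hx)
  simp only [Polynomial.eval_add, Polynomial.eval_mul, Polynomial.eval_C, Polynomial.eval_one]
  rw [a3, add_mul]
  omega

/-- Two nested `for` loops. -/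
theorem Spec.forCmd₂ {v v' : ℕ} {eN eM : Expr} {N M : α → ℕ} (J : α → Store → ℕ → ℕ → Store → Prop)
    (hN : ∀ x s, P x s → N x ≤ w.eval (sz x)) (hM : ∀ x s, P x s → M x ≤ w.eval (sz x))
    (heN : ∀ x s, P x s → eN.eval s = N x)
    (heM : ∀ x s₀ s, P x s₀ → (∀ a ∉ insert v (insert v' c.writes), s a = s₀ a) → eM.eval s = M x)
    (hinit : ∀ x s, P x s → J x s (N x) 0 s)
    (hstep : ∀ x s₀ i s, J x s₀ (i + 1) 0 s → J x s₀ i (M x) s)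
    (hI : ∀ x s₀ i j s z, J x s₀ i j s → J x s₀ i j (s.set v 0 0 z))
    (hI' : ∀ x s₀ i j s z, J x s₀ i j s → J x s₀ i j (s.set v' 0 0 z))
    (hv : v ∉ c.writes) (hv' : v' ∉ c.writes) (hvv : v ≠ v')
    (hc : Spec (fun y : α × Store × ℕ × ℕ => sz y.1) w
      (fun y s => P y.1 y.2.1 ∧ y.2.2.1 < N y.1 ∧ y.2.2.2 < M y.1 ∧
        J y.1 y.2.1 y.2.2.1 (y.2.2.2 + 1) s ∧ s v 0 0 = y.2.2.1 ∧ s v' 0 0 = y.2.2.2 ∧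
        ∀ a ∉ insert v (insert v' c.writes), s a = y.2.1 a) c
      (fun y _ s' => J y.1 y.2.1 y.2.2.1 y.2.2.2 s')) :
    Spec sz w P (PlantedRFCW.forCmd v eN (PlantedRFCW.forCmd v' eM c)) (fun x s s' => J x s 0 0 s') := by
  have hwr : (PlantedRFCW.forCmd v' eM c).writes = insert v' c.writes := by
    ext a; simp [PlantedRFCW.forCmd, Cmd.writes]
  refine Spec.forCmd (N := N) (fun x s₀ i s => J x s₀ i 0 s) hN heN hinit
    (fun x s₀ i s z h => hI x s₀ i 0 s z h) (by rw [hwr]; simp [hv, hvv]) ?_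
  rw [hwr]
  refine Spec.mono (Spec.forCmd (N := fun y => M y.1) (fun y _ j s => J y.1 y.2.1 y.2.2 j s)
    (P := fun (y : α × Store × ℕ) s => P y.1 y.2.1 ∧ y.2.2 < N y.1 ∧ J y.1 y.2.1 (y.2.2 + 1) 0 s ∧
        s v 0 0 = y.2.2 ∧ ∀ a ∉ insert v (insert v' c.writes), s a = y.2.1 a)
    (fun y s h => hM _ _ h.1) (fun y s h => heM _ _ _ h.1 h.2.2.2.2)
    (fun y s h => hstep _ _ _ _ h.2.2.1) (fun y _ i s z h => hI' _ _ _ _ _ _ h) hv' ?_)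
    (fun _ _ h => h) (fun _ _ _ _ h => h)
  refine Spec.mono (hc.comap fun y : (α × Store × ℕ) × Store × ℕ => (y.1.1, y.1.2.1, y.1.2.2, y.2.2))
    ?_ (fun _ _ _ _ h => h)
  rintro ⟨⟨x, s₀, i⟩, s₁, j⟩ s ⟨⟨h1, h2, h3, h4, h5⟩, h6, h7, h8, h9⟩
  refine ⟨h1, h2, h6, h7, ?_, h8, fun a ha => ?_⟩
  · have := h9 v (by simp [hv, hvv])
    simp only at this h4 ⊢
    rw [this, h4]
  · simp only at h9 h5 ⊢
    rw [h9 a fun h => ha (Finset.mem_insert_of_mem h), h5 a ha]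

end


/-! ### The program -/

namespace Expr

def var (a : ℕ) : Expr := read a (const 0) (const 0)

def pow (e : Expr) : ℕ → Expr
  | 0 => const 1
  | r + 1 => mul (pow e r) e

/-- The indicator of positivity, by integer division. -/
def pos (e : Expr) : Expr := add (const 1) (div (sub e (const 1)) (add (mul e e) (const 1)))

def eN : Expr := read 0 (const 0) (const 0)
def eM : Expr := read 0 (const 0) (const 1)
def eK : Expr := read 0 (const 0) (const 2)
def eU : Expr := mul (const 4) (mul (pow eN 5) (pow eM 2))
def eq : Expr := mul (const 28) (mul (pow eN 11) (pow eM 2))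
def eC : Expr := add (mul eN (mul (mul eq eM)
  (add (const 1) (mul (const 3) (mul (pow eN 3) eM))))) (const 1)
def eP : Expr := mul (const 144) (mul (pow eN 11) (pow eM 4))
def eT : Expr := mul (const 7) (mul (pow eN 8) (pow eM 2))

theorem eval_var (s : Store) (a : ℕ) : (var a).eval s = s a 0 0 := rfl

theorem eval_pow (s : Store) (e : Expr) (r : ℕ) : (pow e r).eval s = e.eval s ^ r := by
  induction r with
  | zero => simp [pow, eval]
  | succ r ih => rw [pow_succ, ← ih]; rfl

theorem eval_pos (s : Store) (e : Expr) : (pos e).eval s = ipos (e.eval s) := by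
  simp only [pos, eval, ipos]
  set d := e.eval s
  have hpos : 0 < d * d + 1 := by nlinarith [mul_self_nonneg d]
  split_ifs with h
  · rw [Int.ediv_eq_zero_of_lt (by omega) (by nlinarith)]; rfl
  · have : (d - 1) / (d * d + 1) = -1 := by
      rw [Int.ediv_eq_iff_of_pos hpos]
      constructor <;> nlinarith
    rw [this]; rfl

end Expr

/-- An instance of the testing problem, with the spins as a function of two natural numbers. -/
structure Inst where
  n : ℕ
  m : ℕ
  k : ℕ
  xs : ℕ → ℕ → ℤ

namespace Inst

variable (x : Inst)

def size : ℕ := x.n * x.m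

def Valid : Prop := 2 ≤ x.n ∧ 1 ≤ x.m ∧ 1 ≤ x.k ∧ x.k ≤ x.n ∧ ∀ l i, |x.xs l i| ≤ 1

def gram (i j : ℕ) : ℤ := ∑ l ∈ Finset.range x.m, x.xs l i * x.xs l j

def data : SubgradData := sdpData x.n x.m x.k x.gram

/-- The entries of array `0` are as in the initial memory. -/
def Env (s : Store) : Prop := x.Valid ∧ s 0 0 0 = x.n ∧ s 0 0 1 = x.m ∧ s 0 0 2 = x.k

end Inst

section eval

variable {x : Inst} {s : Store}

theorem eval_eN (h : x.Env s) : Expr.eN.eval s = x.n := h.2.1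
theorem eval_eM (h : x.Env s) : Expr.eM.eval s = x.m := h.2.2.1
theorem eval_eK (h : x.Env s) : Expr.eK.eval s = x.k := h.2.2.2

theorem eval_eU (h : x.Env s) : Expr.eU.eval s = x.data.U := by
  simp [Expr.eU, Expr.eval, Expr.eval_pow, eval_eN h, eval_eM h, Inst.data, sdpData, mul_assoc]

theorem eval_eq (h : x.Env s) : Expr.eq.eval s = x.data.q := by
  simp [Expr.eq, Expr.eval, Expr.eval_pow, eval_eN h, eval_eM h, Inst.data, sdpData, mul_assoc]

theorem eval_eC (h : x.Env s) : Expr.eC.eval s = x.data.c := by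
  simp [Expr.eC, Expr.eval, Expr.eval_pow, eval_eN h, eval_eM h, eval_eq h, Inst.data, sdpData,
    mul_assoc]

theorem eval_eP (h : x.Env s) : Expr.eP.eval s = x.data.p := by
  simp [Expr.eP, Expr.eval, Expr.eval_pow, eval_eN h, eval_eM h, Inst.data, sdpData, mul_assoc]

theorem eval_eT (h : x.Env s) : Expr.eT.eval s = sdpSteps x.n x.m := by
  simp [Expr.eT, Expr.eval, Expr.eval_pow, eval_eN h, eval_eM h, sdpSteps, mul_assoc]

theorem Inst.Env.of_eq {s' : Store} (h : x.Env s) (he : s' 0 = s 0) : x.Env s' := by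
  unfold Inst.Env at *; rwa [he]

end eval

/-! #### A bound for all integers that occur -/

section bound

variable {R : Type*} [CommSemiring R]

def shiftBoundGen (n m : R) : R := 28 * n ^ 11 * m ^ 2 * m * (1 + 3 * n ^ 3 * m)
def entryBoundGen (n m : R) : R := shiftBoundGen n m + (n * shiftBoundGen n m + 1)
def stepsGen (n m : R) : R := 7 * n ^ 8 * m ^ 2
def yBoundGen (n m k : R) : R := stepsGen n m * (4 * n ^ 5 * m ^ 2 * (k + 2))
def zBoundGen (n m k : R) : R := stepsGen n m * (4 * n ^ 5 * m ^ 2 * k * (2 * n ^ 2))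
def gainEntryBoundGen (n m k : R) : R :=
  2 * (4 * n ^ 5 * m ^ 2) * shiftBoundGen n m
    + 4 * n ^ 5 * m ^ 2 * k * (2 * (yBoundGen n m k + zBoundGen n m k))
def gainBoundGen (n m k : R) : R :=
  4 * n ^ 5 * m ^ 2 * k * zBoundGen n m k + n ^ 2 * gainEntryBoundGen n m k
def totalBoundGen (n m k : R) : R :=
  n * entryBoundGen n m * (144 * n ^ 11 * m ^ 4 + 3) + stepsGen n m + 144 * n ^ 11 * m ^ 4
    + yBoundGen n m k + zBoundGen n m k + (stepsGen n m + 1) * gainBoundGen n m k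
    + n + m + 2 * n ^ 2 + 1

/-- The bit length of all integers that the program stores is at most this polynomial. -/
noncomputable def bitPoly : Polynomial ℕ := totalBoundGen Polynomial.X Polynomial.X Polynomial.X

theorem eval_bitPoly (N : ℕ) : bitPoly.eval N = totalBoundGen N N N := by
  simp [bitPoly, totalBoundGen, gainBoundGen, gainEntryBoundGen, zBoundGen, yBoundGen, stepsGen,
    entryBoundGen, shiftBoundGen]

theorem totalBound_le {x : Inst} (h : x.Valid) :
    totalBoundGen x.n x.m x.k ≤ bitPoly.eval x.size := by
  obtain ⟨h1, h2, h3, h4, -⟩ := h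
  have hn : x.n ≤ x.size := Nat.le_mul_of_pos_right _ h2
  have hm : x.m ≤ x.size := Nat.le_mul_of_pos_left _ (by omega)
  have hk : x.k ≤ x.size := h4.trans hn
  rw [eval_bitPoly]
  unfold totalBoundGen gainBoundGen gainEntryBoundGen zBoundGen yBoundGen stepsGen
    entryBoundGen shiftBoundGen
  gcongr

theorem int_abs_le_two_pow {z : ℤ} {b W : ℕ} (h : |z| ≤ b) (hb : b ≤ W) : |z| ≤ 2 ^ W := by
  have h1 : b < 2 ^ W := hb.trans_lt Nat.lt_two_pow_self
  exact h.trans (by exact_mod_cast h1.le)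

end bound

/-! #### Partial results of nested loops -/

/-- The cells that a double loop has visited before it visits `(i, j)` once more. -/
def Visited (i j a b : ℕ) : Prop := i < a ∨ (a = i ∧ j ≤ b)

instance (i j a b : ℕ) : Decidable (Visited i j a b) := inferInstanceAs (Decidable (_ ∨ _))

theorem not_visited_init {n a b : ℕ} (ha : a < n) : ¬ Visited n 0 a b := by
  unfold Visited; omega

theorem visited_final (a b : ℕ) : Visited 0 0 a b := by unfold Visited; omega

theorem visited_row {n i a b : ℕ} (hb : b < n) : Visited (i + 1) 0 a b ↔ Visited i n a b := by
  unfold Visited; omega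

theorem visited_cell {i j a b : ℕ} :
    Visited i j a b ↔ (Visited i (j + 1) a b ∨ (a = i ∧ b = j)) := by
  unfold Visited; omega

theorem visited_ne {i j a b : ℕ} (h : ¬ (a = i ∧ b = j)) :
    Visited i j a b ↔ Visited i (j + 1) a b := by
  rw [visited_cell]; exact or_iff_left h

theorem not_visited_self {i j : ℕ} : ¬ Visited i (j + 1) i j := by unfold Visited; omega

def psum (n : ℕ) (f : ℕ → ℕ → ℤ) (i j : ℕ) : ℤ :=
  ∑ a ∈ Finset.range n, ∑ b ∈ Finset.range n, if Visited i j a b then f a b else 0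

theorem psum_init (n : ℕ) (f : ℕ → ℕ → ℤ) : psum n f n 0 = 0 :=
  Finset.sum_eq_zero fun _ ha => Finset.sum_eq_zero fun _ _ =>
    if_neg (not_visited_init (Finset.mem_range.mp ha))

theorem psum_final (n : ℕ) (f : ℕ → ℕ → ℤ) :
    psum n f 0 0 = ∑ a ∈ Finset.range n, ∑ b ∈ Finset.range n, f a b :=
  Finset.sum_congr rfl fun a _ => Finset.sum_congr rfl fun b _ => if_pos (visited_final a b)

theorem psum_row (n : ℕ) (f : ℕ → ℕ → ℤ) (i : ℕ) : psum n f (i + 1) 0 = psum n f i n :=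
  Finset.sum_congr rfl fun a _ => Finset.sum_congr rfl fun b hb => by
    simp only [visited_row (Finset.mem_range.mp hb)]

theorem psum_cell {n : ℕ} (f : ℕ → ℕ → ℤ) {i j : ℕ} (hi : i < n) (hj : j < n) :
    psum n f i j = psum n f i (j + 1) + f i j := by
  have h1 : f i j = ∑ a ∈ Finset.range n, ∑ b ∈ Finset.range n,
      if a = i ∧ b = j then f a b else 0 := by
    rw [Finset.sum_eq_single i, Finset.sum_eq_single j]
    · simp
    · intro b _ hb; simp [hb]
    · intro h; exact absurd (Finset.mem_range.mpr hj) h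
    · intro a _ ha; exact Finset.sum_eq_zero fun b _ => by simp [ha]
    · intro h; exact absurd (Finset.mem_range.mpr hi) h
  rw [h1, psum, psum, ← Finset.sum_add_distrib]
  refine Finset.sum_congr rfl fun a _ => ?_
  rw [← Finset.sum_add_distrib]
  refine Finset.sum_congr rfl fun b _ => ?_
  by_cases h : a = i ∧ b = j
  · obtain ⟨rfl, rfl⟩ := h
    simp [not_visited_self, visited_cell.mpr (Or.inr ⟨rfl, rfl⟩)]
  · simp [visited_ne h, h]

theorem abs_psum_le {n : ℕ} {f : ℕ → ℕ → ℤ} {B : ℕ} (hf : ∀ a < n, ∀ b < n, |f a b| ≤ B) (i j : ℕ) :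
    |psum n f i j| ≤ n ^ 2 * B := by
  calc |psum n f i j| ≤ ∑ a ∈ Finset.range n, ∑ b ∈ Finset.range n, (B : ℤ) := by
        refine (Finset.abs_sum_le_sum_abs _ _).trans (Finset.sum_le_sum fun _ ha =>
          (Finset.abs_sum_le_sum_abs _ _).trans (Finset.sum_le_sum fun _ hb => ?_))
        split_ifs
        · exact hf _ (Finset.mem_range.mp ha) _ (Finset.mem_range.mp hb)
        · simp
    _ = n ^ 2 * B := by simp; ring

theorem abs_sum_Ico_le {f : ℕ → ℤ} {B l n : ℕ} (hf : ∀ a < n, |f a| ≤ B) :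
    |∑ a ∈ Finset.Ico l n, f a| ≤ n * B := by
  calc |∑ a ∈ Finset.Ico l n, f a| ≤ ∑ a ∈ Finset.Ico l n, (B : ℤ) :=
        (Finset.abs_sum_le_sum_abs _ _).trans
          (Finset.sum_le_sum fun a ha => hf a (Finset.mem_Ico.mp ha).2)
    _ = ((n - l : ℕ) : ℤ) * B := by simp
    _ ≤ n * B := by gcongr; omega

/-! #### The Gram matrix -/

open PlantedRFCW.Expr in
def gramBody : Cmd := .write 2 (var 20) (var 21)
  (add (read 2 (var 20) (var 21)) (mul (read 1 (var 22) (var 20)) (read 1 (var 22) (var 21))))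

open PlantedRFCW.Expr in
def gramCmd : Cmd := forCmd 20 eN (forCmd 21 eN (forCmd 22 eM gramBody))

theorem gramCmd_spec : Spec Inst.size bitPoly
    (fun x s => x.Env s ∧ (∀ l i : ℕ, s 1 l i = x.xs l i) ∧ ∀ i j, s 2 i j = 0) gramCmd
    (fun x _ s' => ∀ i < x.n, ∀ j < x.n, s' 2 (i : ℤ) (j : ℤ) = x.gram i j) := by
  have hw : (forCmd 22 Expr.eM gramBody).writes = {22, 2} := rfl
  have hw' : gramBody.writes = {2} := rfl
  have hNle : ∀ x : Inst, x.Valid → x.n ≤ bitPoly.eval x.size ∧ x.m ≤ bitPoly.eval x.size := by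
    intro x hx
    have := totalBound_le hx
    simp only [totalBoundGen] at this
    omega
  refine Spec.mono (Spec.forCmd₂ (N := Inst.n) (M := Inst.n) (fun x _ i j s =>
      ∀ a < x.n, ∀ b < x.n, s 2 (a : ℤ) (b : ℤ) = if Visited i j a b then x.gram a b else 0)
    (fun x s h => (hNle x h.1.1).1) (fun x s h => (hNle x h.1.1).1) (fun x s h => eval_eN h.1)
    (fun x s₀ s h hf => eval_eN (h.1.of_eq (hf 0 (by rw [hw]; decide)))) ?_ ?_ ?_ ?_
    (by rw [hw]; decide) (by rw [hw]; decide) (by decide) ?_) (fun _ _ h => h) ?_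
  · intro x s h a ha b _
    rw [if_neg (not_visited_init ha)]
    exact h.2.2 a b
  · intro x s₀ i s h a ha b hb
    rw [h a ha b hb]
    simp only [visited_row hb]
  · intro x s₀ i j s z h a ha b hb
    rw [← h a ha b hb]; simp [Store.set]
  · intro x s₀ i j s z h a ha b hb
    rw [← h a ha b hb]; simp [Store.set]
  · rw [hw]
    refine Spec.mono (Spec.forCmd (N := fun y => y.1.m) (fun y s₁ l s =>
        ∀ a b : ℕ, s 2 (a : ℤ) (b : ℤ) = if a = y.2.2.1 ∧ b = y.2.2.2 then
          ∑ l' ∈ Finset.Ico l y.1.m, y.1.xs l' a * y.1.xs l' b else s₁ 2 (a : ℤ) (b : ℤ))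
      (fun y s h => (hNle _ h.1.1.1).2)
      (fun y s h => eval_eM (h.1.1.of_eq (h.2.2.2.2.2.2 0 (by decide)))) ?_ ?_
      (by rw [hw']; decide) ?_) (fun _ _ h => h) ?_
    · rintro ⟨x, s₀, i, j⟩ s ⟨-, hi, hj, h, -, -, -⟩ a b
      split_ifs with hab
      · obtain ⟨rfl, rfl⟩ := hab
        simp only at h hi hj ⊢
        rw [h a hi b hj, if_neg not_visited_self]
        simp
      · rfl
    · intro y s₀ i s z h a b
      rw [← h a b]; simp [Store.set]
    · rw [hw']
      refine Spec.write ?_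
      rintro ⟨⟨x, s₀, i, j⟩, s₁, l⟩ s ⟨⟨⟨henv, hx, -⟩, hi, hj, -, h20, h21, hf⟩, hl, h, h22, hf'⟩
      simp only at *
      have e20 : s 20 0 0 = i := by rw [hf' 20 (by decide), h20]
      have e21 : s 21 0 0 = j := by rw [hf' 21 (by decide), h21]
      have e1 : s 1 = s₀ 1 := by rw [hf' 1 (by decide), hf 1 (by decide)]
      have hval : Expr.eval s (.add (.read 2 (.var 20) (.var 21))
          (.mul (.read 1 (.var 22) (.var 20)) (.read 1 (.var 22) (.var 21))))
          = ∑ l' ∈ Finset.Ico l x.m, x.xs l' i * x.xs l' j := by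
        rw [Finset.sum_eq_sum_Ico_succ_bot hl]
        simp only [Expr.eval, Expr.eval_var, e20, e21, h22, e1, hx]
        rw [h i j, if_pos ⟨rfl, rfl⟩]
        ring
      rw [hval, Expr.eval_var, Expr.eval_var, e20, e21]
      refine ⟨int_abs_le_two_pow (b := x.m) ?_ (hNle _ henv.1).2, fun a b => ?_⟩
      · simpa using abs_sum_Ico_le (B := 1) (n := x.m) (l := l)
          (f := fun l' => x.xs l' i * x.xs l' j) (fun a _ => by
            rw [abs_mul]
            calc _ ≤ (1 : ℤ) * 1 := mul_le_mul (henv.1.2.2.2.2 a i) (henv.1.2.2.2.2 a j)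
                    (abs_nonneg _) zero_le_one
              _ = _ := by norm_num)
      · rw [Store.set_cell]
        by_cases hab : a = i ∧ b = j
        · obtain ⟨rfl, rfl⟩ := hab
          simp
        · rw [if_neg hab, if_neg hab, h a b, if_neg hab]
    · rintro ⟨x, s₀, i, j⟩ s s' ⟨-, hi, hj, h, -, -, -⟩ h' a ha b hb
      simp only at h h' ⊢
      rw [h' a b]
      by_cases hab : a = i ∧ b = j
      · obtain ⟨rfl, rfl⟩ := hab
        rw [if_pos ⟨rfl, rfl⟩, if_pos (visited_cell.mpr (Or.inr ⟨rfl, rfl⟩)), Inst.gram,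
          Finset.range_eq_Ico]
      · simp only [if_neg hab, visited_ne hab]
        exact h a ha b hb
  · intro x s s' _ h i hi j hj
    rw [h i hi j hj, if_pos (visited_final i j)]


/-! #### Bounds along the iteration -/

theorem Inst.gram_symm (x : Inst) (i j : ℕ) : x.gram i j = x.gram j i :=
  Finset.sum_congr rfl fun _ _ => mul_comm _ _

theorem Inst.abs_gram_le {x : Inst} (h : x.Valid) (i j : ℕ) : |x.gram i j| ≤ x.m := by
  rw [Inst.gram, Finset.range_eq_Ico]
  simpa using abs_sum_Ico_le (B := 1) (n := x.m) (l := 0)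
    (f := fun l' => x.xs l' i * x.xs l' j) (fun a _ => by
      rw [abs_mul]
      calc _ ≤ (1 : ℤ) * 1 := mul_le_mul (h.2.2.2.2 a i) (h.2.2.2.2 a j) (abs_nonneg _) zero_le_one
        _ = _ := by norm_num)

theorem abs_matPow_le {n E : ℕ} {M : ℕ → ℕ → ℤ} (hn : 1 ≤ n)
    (hM : ∀ i < n, ∀ j < n, |M i j| ≤ E) (p : ℕ) :
    ∀ i < n, ∀ j < n, |matPow n M p i j| ≤ ((n * E) ^ (p + 1) : ℕ) := by
  induction p with
  | zero =>
    intro i hi j hj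
    refine (hM i hi j hj).trans ?_
    have : E ≤ n * E := Nat.le_mul_of_pos_left _ hn
    simpa using (by exact_mod_cast this : (E : ℤ) ≤ n * E)
  | succ p ih =>
    intro i hi j hj
    rw [matPow, Finset.range_eq_Ico]
    refine (abs_sum_Ico_le (B := (n * E) ^ (p + 1) * E) fun l hl => ?_).trans (le_of_eq ?_)
    · rw [abs_mul]
      push_cast
      have := ih i hi l hl
      push_cast at this
      exact mul_le_mul this (hM l hl j hj) (abs_nonneg _) (by positivity)
    · push_cast; ring

section bounds

variable {x : Inst}

theorem iter_good (h : x.Valid) {t : ℕ} (ht : t ≤ sdpSteps x.n x.m) :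
    x.data.Good (t * (x.data.U * (x.k + 2))) (x.data.iter t).1 :=
  sdpData_iter_good h.2.2.1 h.2.2.2.1 h.2.1 (fun i j => x.gram_symm i j)
    (fun i j => Inst.abs_gram_le h i j) t ht

theorem abs_iter_le (h : x.Valid) {t : ℕ} (ht : t ≤ sdpSteps x.n x.m) {i j : ℕ} (hi : i < x.n)
    (hj : j < x.n) : |(x.data.iter t).1 i j| ≤ yBoundGen x.n x.m x.k := by
  refine ((iter_good h ht).2 ⟨i, hi⟩ ⟨j, hj⟩).trans ?_
  have : t * (x.data.U * (x.k + 2)) ≤ yBoundGen x.n x.m x.k := Nat.mul_le_mul_right _ ht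
  exact_mod_cast this

theorem abs_shift_le (h : x.Valid) {t : ℕ} (ht : t ≤ sdpSteps x.n x.m) {i j : ℕ} (hi : i < x.n)
    (hj : j < x.n) : |x.data.q * x.gram i j + (x.data.iter t).1 i j| ≤ shiftBoundGen x.n x.m :=
  sdpData_shift_bound (y := t * (x.data.U * (x.k + 2))) h.2.2.2.1 (by have := h.1; omega)
    (fun i j => Inst.abs_gram_le h i j) (Nat.mul_le_mul_right _ ht) (iter_good h ht).2
    ⟨i, hi⟩ ⟨j, hj⟩

theorem abs_shifted_le (h : x.Valid) {t : ℕ} (ht : t ≤ sdpSteps x.n x.m) {i j : ℕ} (hi : i < x.n)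
    (hj : j < x.n) : |x.data.shifted (x.data.iter t).1 i j| ≤ entryBoundGen x.n x.m := by
  have h1 := abs_shift_le h ht hi hj
  have h2 : |if i = j then (x.data.c : ℤ) else 0| ≤ (x.n * shiftBoundGen x.n x.m + 1 : ℕ) := by
    split_ifs
    · rw [abs_of_nonneg (by positivity)]; exact le_rfl
    · rw [abs_zero]; positivity
  refine (abs_add_le _ _).trans ?_
  unfold entryBoundGen
  push_cast at *
  exact add_le_add h1 h2

theorem abs_powM_le (h : x.Valid) {t : ℕ} (ht : t ≤ sdpSteps x.n x.m) (r : ℕ) :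
    ∀ i < x.n, ∀ j < x.n, |x.data.powM (x.data.iter t).1 r i j|
      ≤ ((x.n * entryBoundGen x.n x.m) ^ (r + 1) : ℕ) :=
  abs_matPow_le (by have := h.1; omega)
    (fun i hi j hj => by exact_mod_cast abs_shifted_le h ht hi hj) r

theorem abs_resp_iter_le (h : x.Valid) {t : ℕ} (ht : t < sdpSteps x.n x.m) {i j : ℕ} (hi : i < x.n)
    (hj : j < x.n) : |x.data.resp (x.data.iter t).1 i j| ≤ 2 * x.data.U := by
  obtain ⟨X, -, -, -, h1, -⟩ := sdpData_step h.2.2.1 h.2.2.2.1 h.2.1 (fun i j => x.gram_symm i j)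
    (fun i j => Inst.abs_gram_le h i j) (Nat.mul_le_mul_right _ ht.le) (iter_good h ht.le)
  exact h1 ⟨i, hi⟩ ⟨j, hj⟩

theorem abs_viol_le (Y : ℕ → ℕ → ℤ) (z : ℤ) (i j : ℕ) : |SubgradData.viol Y z i j| ≤ (2 : ℕ) := by
  have a1 := ipos_nonneg (Y i j - z)
  have a2 := ipos_le_one (Y i j - z)
  have a3 := ipos_nonneg (-Y i j - z)
  have a4 := ipos_le_one (-Y i j - z)
  unfold SubgradData.viol
  rw [abs_le]
  push_cast
  constructor <;> linarith

theorem abs_iter_z_le (h : x.Valid) (t : ℕ) :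
    |(x.data.iter t).2.1| ≤ t * (x.data.U * x.k * (2 * x.n ^ 2)) := by
  induction t with
  | zero => simp [SubgradData.iter]
  | succ t ih =>
    set V := ∑ i ∈ Finset.range x.data.n, ∑ j ∈ Finset.range x.data.n,
      SubgradData.viol (x.data.iter t).1 (x.data.iter t).2.1 i j with hV
    have hV2 : |V| ≤ x.n ^ 2 * 2 := by
      rw [hV, ← psum_final]
      exact_mod_cast abs_psum_le (B := 2) (fun a _ b _ => abs_viol_le _ _ a b) 0 0
    have hV0 : 0 ≤ V := Finset.sum_nonneg fun i _ => Finset.sum_nonneg fun j _ =>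
      add_nonneg (ipos_nonneg _) (ipos_nonneg _)
    have hn := h.1
    have h1 : |1 - V| ≤ 2 * x.n ^ 2 := by
      have hn' : (1 : ℤ) ≤ x.n := by exact_mod_cast (by omega : 1 ≤ x.n)
      have := (abs_le.mp hV2).2
      rw [abs_le]; constructor <;> nlinarith
    simp only [SubgradData.iter, SubgradData.newz]
    rw [← hV]
    refine (abs_sub _ _).trans ?_
    rw [abs_mul (_ * _), abs_of_nonneg (by positivity : (0 : ℤ) ≤ x.data.U * x.data.k)]
    have h2 := mul_le_mul_of_nonneg_left h1 (by positivity : (0 : ℤ) ≤ x.data.U * x.data.k)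
    have h3 : (x.data.k : ℤ) = x.k := rfl
    rw [h3] at h2 ⊢
    push_cast
    linarith

theorem abs_iter_z_le' (h : x.Valid) {t : ℕ} (ht : t ≤ sdpSteps x.n x.m) :
    |(x.data.iter t).2.1| ≤ zBoundGen x.n x.m x.k := by
  refine (abs_iter_z_le h t).trans ?_
  have : t * (x.data.U * x.k * (2 * x.n ^ 2)) ≤ zBoundGen x.n x.m x.k :=
    Nat.mul_le_mul_right _ ht
  exact_mod_cast this

theorem abs_gainEntry_le (h : x.Valid) {t : ℕ} (ht : t < sdpSteps x.n x.m) {i j : ℕ} (hi : i < x.n)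
    (hj : j < x.n) : |x.data.gainEntry (x.data.iter t).1 (x.data.iter t).2.1 i j|
      ≤ gainEntryBoundGen x.n x.m x.k := by
  have h1 := abs_shift_le h ht.le hi hj
  have h2 := abs_resp_iter_le h ht hi hj
  have h3 := abs_iter_le h ht.le hi hj
  have h4 := abs_iter_z_le' h ht.le
  set Y := (x.data.iter t).1
  set z := (x.data.iter t).2.1
  have h5 : |(Y i j - z) * ipos (Y i j - z) + (-Y i j - z) * ipos (-Y i j - z)|
      ≤ 2 * (yBoundGen x.n x.m x.k + zBoundGen x.n x.m x.k : ℕ) := by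
    have a1 := ipos_nonneg (Y i j - z)
    have a2 := ipos_le_one (Y i j - z)
    have a3 := ipos_nonneg (-Y i j - z)
    have a4 := ipos_le_one (-Y i j - z)
    refine (abs_add_le _ _).trans ?_
    rw [abs_mul, abs_mul, abs_of_nonneg a1, abs_of_nonneg a3]
    have e1 : |Y i j - z| ≤ (yBoundGen x.n x.m x.k + zBoundGen x.n x.m x.k : ℕ) := by
      refine (abs_sub _ _).trans ?_
      push_cast; exact add_le_add h3 h4
    have e2 : |-Y i j - z| ≤ (yBoundGen x.n x.m x.k + zBoundGen x.n x.m x.k : ℕ) := by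
      refine (abs_sub _ _).trans ?_
      rw [abs_neg]
      push_cast; exact add_le_add h3 h4
    have e3 := mul_le_mul e1 a2 a1 (by positivity)
    have e4 := mul_le_mul e2 a4 a3 (by positivity)
    linarith
  unfold SubgradData.gainEntry
  refine (abs_add_le _ _).trans ?_
  rw [abs_mul, abs_mul (_ * _), abs_of_nonneg (by positivity : (0 : ℤ) ≤ x.data.U * x.data.k)]
  have e5 := mul_le_mul h2 h1 (abs_nonneg _) (by positivity)
  have e6 := mul_le_mul_of_nonneg_left h5 (by positivity : (0 : ℤ) ≤ x.data.U * x.data.k)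
  have hU : (x.data.U : ℤ) = 4 * x.n ^ 5 * x.m ^ 2 := by simp [Inst.data, sdpData]
  have hk : (x.data.k : ℤ) = x.k := rfl
  refine (add_le_add e5 e6).trans (le_of_eq ?_)
  rw [hU, hk]
  unfold gainEntryBoundGen
  push_cast
  ring

theorem abs_iter_S_le (h : x.Valid) {t : ℕ} (ht : t ≤ sdpSteps x.n x.m) :
    |(x.data.iter t).2.2| ≤ t * (gainBoundGen x.n x.m x.k : ℕ) := by
  induction t with
  | zero => simp [SubgradData.iter]
  | succ t ih =>
    have h0 := ih (by omega)
    have h1 := abs_psum_le (n := x.data.n) (B := gainEntryBoundGen x.n x.m x.k)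
      (fun a ha b hb => abs_gainEntry_le (t := t) h (by omega) ha hb) 0 0
    rw [psum_final] at h1
    have h2 := abs_iter_z_le' (t := t) h (by omega)
    simp only [SubgradData.iter, SubgradData.gain]
    refine (abs_add_le _ _).trans ?_
    have h3 := abs_add_le (x.data.U * x.data.k * (x.data.iter t).2.1)
      (∑ i ∈ Finset.range x.data.n, ∑ j ∈ Finset.range x.data.n,
        x.data.gainEntry (x.data.iter t).1 (x.data.iter t).2.1 i j)
    rw [abs_mul (_ * _), abs_of_nonneg (by positivity : (0 : ℤ) ≤ x.data.U * x.data.k)] at h3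
    have h4 := mul_le_mul_of_nonneg_left h2 (by positivity : (0 : ℤ) ≤ x.data.U * x.data.k)
    have hU : (x.data.U : ℤ) = 4 * x.n ^ 5 * x.m ^ 2 := by simp [Inst.data, sdpData]
    have hk : (x.data.k : ℤ) = x.k := rfl
    have hn : (x.data.n : ℤ) = x.n := rfl
    have e : ((gainBoundGen x.n x.m x.k : ℕ) : ℤ) = x.data.U * x.data.k * (zBoundGen x.n x.m x.k : ℕ)
        + x.data.n ^ 2 * (gainEntryBoundGen x.n x.m x.k : ℕ) := by
      rw [hU, hk, hn]; unfold gainBoundGen; push_cast; ring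
    have h5 : |x.data.U * x.data.k * (x.data.iter t).2.1 +
        ∑ i ∈ Finset.range x.data.n, ∑ j ∈ Finset.range x.data.n,
        x.data.gainEntry (x.data.iter t).1 (x.data.iter t).2.1 i j|
          ≤ (gainBoundGen x.n x.m x.k : ℕ) := by
      rw [e]; linarith
    have h6 : ((t + 1 : ℕ) : ℤ) * (gainBoundGen x.n x.m x.k : ℕ)
        = t * (gainBoundGen x.n x.m x.k : ℕ) + (gainBoundGen x.n x.m x.k : ℕ) := by
      push_cast; ring
    rw [h6]
    exact add_le_add h0 h5

end bounds

theorem le_two_pow_of_le_pow {z : ℤ} {a r R W : ℕ} (h : |z| ≤ (a ^ r : ℕ)) (hr : r ≤ R)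
    (hW : a * R ≤ W) : |z| ≤ 2 ^ W := by
  have h1 : a ^ r ≤ 2 ^ W := by
    calc a ^ r ≤ (2 ^ a) ^ r := Nat.pow_le_pow_left Nat.lt_two_pow_self.le r
      _ = 2 ^ (a * r) := by rw [pow_mul]
      _ ≤ 2 ^ W := Nat.pow_le_pow_right (by norm_num) ((Nat.mul_le_mul_left _ hr).trans hW)
  exact h.trans (by exact_mod_cast h1)

theorem row_inj {n r r' i i' : ℕ} (hi : i < n) (hi' : i' < n) (h : r * n + i = r' * n + i') :
    r = r' ∧ i = i' := by
  rcases lt_trichotomy r r' with hr | hr | hr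
  · have := Nat.mul_le_mul_right n (Nat.succ_le_of_lt hr)
    rw [Nat.succ_mul] at this; omega
  · subst hr; omega
  · have := Nat.mul_le_mul_right n (Nat.succ_le_of_lt hr)
    rw [Nat.succ_mul] at this; omega

/-! #### One step of the iteration -/

/-- Before step `t` of the iteration. -/
def StepPre (y : Inst × ℕ) (s : Store) : Prop :=
  y.1.Env s ∧ y.2 < sdpSteps y.1.n y.1.m ∧
  (∀ i < y.1.n, ∀ j < y.1.n, s 2 (i : ℤ) (j : ℤ) = y.1.gram i j) ∧
  (∀ i < y.1.n, ∀ j < y.1.n, s 3 (i : ℤ) (j : ℤ) = (y.1.data.iter y.2).1 i j) ∧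
  s 8 0 0 = (y.1.data.iter y.2).2.1 ∧ s 7 0 0 = (y.1.data.iter y.2).2.2 ∧ s 9 0 0 = 0

theorem StepPre.of_eq {y : Inst × ℕ} {s s' : Store} (h : StepPre y s)
    (he : ∀ a ∈ ({0, 2, 3, 7, 8, 9} : Finset ℕ), s' a = s a) : StepPre y s' := by
  unfold StepPre at *
  rw [he 2 (by decide), he 3 (by decide), he 7 (by decide), he 8 (by decide),
    he 9 (by decide)]
  exact ⟨h.1.of_eq (he 0 (by decide)), h.2⟩

theorem size_bounds {x : Inst} (h : x.Valid) :
    x.n ≤ bitPoly.eval x.size ∧ x.m ≤ bitPoly.eval x.size ∧ x.data.p ≤ bitPoly.eval x.size ∧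
    sdpSteps x.n x.m ≤ bitPoly.eval x.size ∧
    x.n * entryBoundGen x.n x.m * (x.data.p + 3) ≤ bitPoly.eval x.size ∧
    yBoundGen x.n x.m x.k ≤ bitPoly.eval x.size ∧ zBoundGen x.n x.m x.k ≤ bitPoly.eval x.size ∧
    (sdpSteps x.n x.m + 1) * gainBoundGen x.n x.m x.k ≤ bitPoly.eval x.size ∧
    2 * x.n ^ 2 + 1 ≤ bitPoly.eval x.size := by
  have h1 := totalBound_le h
  have e1 : x.data.p = 144 * x.n ^ 11 * x.m ^ 4 := rfl
  have e2 : sdpSteps x.n x.m = stepsGen x.n x.m := rfl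
  rw [e1, e2]
  unfold totalBoundGen at h1
  refine ⟨?_, ?_, ?_, ?_, ?_, ?_, ?_, ?_, ?_⟩ <;> omega

open PlantedRFCW.Expr in
def shiftBody : Cmd := .write 4 (add (mul eP eN) (var 20)) (var 21)
  (add (add (mul eq (read 2 (var 20) (var 21))) (read 3 (var 20) (var 21)))
    (mul eC (div (const 1) (add (const 1)
      (mul (sub (var 20) (var 21)) (sub (var 20) (var 21)))))))

theorem shiftCmd_spec : Spec (fun y : Inst × ℕ => y.1.size) bitPoly StepPre
    (forCmd 20 Expr.eN (forCmd 21 Expr.eN shiftBody))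
    (fun y _ s' => ∀ i < y.1.n, ∀ j < y.1.n, s' 4 ((y.1.data.p * y.1.n + i : ℕ) : ℤ) (j : ℤ)
      = y.1.data.shifted (y.1.data.iter y.2).1 i j) := by
  have hw : shiftBody.writes = {4} := rfl
  refine Spec.mono (Spec.forCmd₂ (N := fun y => y.1.n) (M := fun y => y.1.n) (fun y _ i j s =>
      ∀ a < y.1.n, ∀ b < y.1.n, Visited i j a b →
        s 4 ((y.1.data.p * y.1.n + a : ℕ) : ℤ) (b : ℤ)
          = y.1.data.shifted (y.1.data.iter y.2).1 a b)
    (fun y s h => (size_bounds h.1.1).1) (fun y s h => (size_bounds h.1.1).1)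
    (fun y s h => eval_eN h.1)
    (fun y s₀ s h hf => eval_eN (h.1.of_eq (hf 0 (by rw [hw]; decide)))) ?_ ?_ ?_ ?_
    (by rw [hw]; decide) (by rw [hw]; decide) (by decide) ?_) (fun _ _ h => h) ?_
  · intro y s h a ha b _ hv
    exact absurd hv (not_visited_init ha)
  · intro y s₀ i s h a ha b hb hv
    exact h a ha b hb ((visited_row hb).mpr hv)
  · intro y s₀ i j s z h a ha b hb hv
    rw [Store.set_other _ (by decide)]; exact h a ha b hb hv
  · intro y s₀ i j s z h a ha b hb hv
    rw [Store.set_other _ (by decide)]; exact h a ha b hb hv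
  · rw [hw]
    refine Spec.write ?_
    rintro ⟨⟨x, t⟩, s₀, i, j⟩ s ⟨⟨henv, ht, hG, hY, -, -⟩, hi, hj, h, h20, h21, hf⟩
    simp only at *
    have henv' : x.Env s := henv.of_eq (hf 0 (by decide))
    have hδ : (1 : ℤ) / (1 + ((i : ℤ) - j) * ((i : ℤ) - j)) = if i = j then 1 else 0 := by
      split_ifs with hij
      · subst hij; simp
      · have hd : (i : ℤ) - j ≠ 0 := by omega
        have := mul_self_pos.mpr hd
        exact Int.ediv_eq_zero_of_lt (by norm_num) (by linarith)
    have hval : Expr.eval s (.add (.add (.mul .eq (.read 2 (.var 20) (.var 21)))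
        (.read 3 (.var 20) (.var 21))) (.mul .eC (.div (.const 1) (.add (.const 1)
        (.mul (.sub (.var 20) (.var 21)) (.sub (.var 20) (.var 21)))))))
        = x.data.shifted (x.data.iter t).1 i j := by
      simp only [Expr.eval, Expr.eval_var, h20, h21, eval_eq henv', eval_eC henv', hδ,
        hf 2 (by decide), hf 3 (by decide), hG i hi j hj, hY i hi j hj]
      simp only [SubgradData.shifted, Inst.data, sdpData]
      split_ifs <;> simp
    have hidx : Expr.eval s (.add (.mul .eP .eN) (.var 20)) = ((x.data.p * x.n + i : ℕ) : ℤ) := by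
      simp only [Expr.eval, Expr.eval_var, h20, eval_eP henv', eval_eN henv']
      push_cast; ring
    rw [hval, hidx, Expr.eval_var, h21]
    refine ⟨le_two_pow_of_le_pow (a := x.n * entryBoundGen x.n x.m) (r := 1) (R := x.data.p + 3) ?_
      (by omega) (size_bounds henv.1).2.2.2.2.1, fun a ha b hb hv => ?_⟩
    · exact abs_powM_le henv.1 ht.le 0 i hi j hj
    · rw [Store.set_cell]
      by_cases hab : a = i ∧ b = j
      · obtain ⟨rfl, rfl⟩ := hab
        simp
      · have : ¬ (x.data.p * x.n + a = x.data.p * x.n + i ∧ b = j) := fun h => hab ⟨by omega, h.2⟩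
        rw [if_neg this]
        exact h a ha b hb ((visited_ne hab).mp hv)
  · intro y s s' _ h i hi j hj
    exact h i hi j hj (visited_final i j)


section

variable {α : Type*} {sz : α → ℕ} {w : Polynomial ℕ} {P : α → Store → Prop} {c d : Cmd}

theorem Spec.seq_of {P₂ Q : α → Store → Prop} {R : α → Store → Store → Prop}
    (hc : Spec sz w P c R) (hd : Spec sz w P₂ d (fun x _ s' => Q x s'))
    (h : ∀ x s s', P x s → R x s s' → (∀ a ∉ c.writes, s' a = s a) → P₂ x s') :
    Spec sz w P (.seq c d) (fun x _ s' => Q x s') :=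
  hc.seq ((hd.comap fun y : α × Store => y.1).mono (fun y s hy => h y.1 y.2 s hy.1 hy.2.1 hy.2.2)
    fun _ _ _ _ h => h)

theorem Spec.write_seq {Q : α → Store → Store → Prop} {a : ℕ} {i j e : Expr}
    (h : ∀ x s, P x s → |e.eval s| ≤ 2 ^ (w.eval (sz x)))
    (hd : Spec (fun y : α × Store => sz y.1) w
      (fun y s => P y.1 y.2 ∧ s = y.2.set a (i.eval y.2) (j.eval y.2) (e.eval y.2)) d
      (fun y _ s' => Q y.1 y.2 s')) : Spec sz w P (.seq (.write a i j e) d) Q :=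
  Spec.seq (R := fun _ s s' => s' = s.set a (i.eval s) (j.eval s) (e.eval s))
    (Spec.write fun x s hx => ⟨h x s hx, rfl⟩) (hd.mono (fun _ _ hy => ⟨hy.1, hy.2.1⟩)
      fun _ _ _ _ h => h)

end

/-- The block `r` of array `4` holds the power with exponent `p - r` (plus one). -/
def BlockAt (y : Inst × ℕ) (r : ℕ) (s : Store) : Prop :=
  ∀ i < y.1.n, ∀ j < y.1.n, s 4 ((r * y.1.n + i : ℕ) : ℤ) (j : ℤ)
    = y.1.data.powM (y.1.data.iter y.2).1 (y.1.data.p - r) i j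

theorem BlockAt.of_eq {y : Inst × ℕ} {r : ℕ} {s s' : Store} (h : BlockAt y r s)
    (he : s' 4 = s 4) : BlockAt y r s' := by
  unfold BlockAt; rw [he]; exact h

open PlantedRFCW.Expr in
def powerBody : Cmd := .write 4 (add (mul (var 24) eN) (var 20)) (var 21)
  (add (mul (read 4 (add (mul (var 24) eN) (var 20)) (var 21)) (pos (sub (sub eN (const 1)) (var 22))))
    (mul (read 4 (add (mul (add (var 24) (const 1)) eN) (var 20)) (var 22))
      (read 4 (add (mul eP eN) (var 22)) (var 21))))

theorem powerCell_spec : Spec (fun y : (Inst × ℕ) × ℕ × ℕ × ℕ => y.1.1.size) bitPoly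
    (fun y s => StepPre y.1 s ∧ y.2.1 < y.1.1.data.p ∧ y.2.2.1 < y.1.1.n ∧ y.2.2.2 < y.1.1.n ∧
      s 24 0 0 = y.2.1 ∧ s 20 0 0 = y.2.2.1 ∧ s 21 0 0 = y.2.2.2 ∧
      BlockAt y.1 (y.2.1 + 1) s ∧ BlockAt y.1 y.1.1.data.p s)
    (forCmd 22 Expr.eN powerBody)
    (fun y s s' => ∀ a b : ℕ, s' 4 (a : ℤ) (b : ℤ) =
      if a = y.2.1 * y.1.1.n + y.2.2.1 ∧ b = y.2.2.2 then
        y.1.1.data.powM (y.1.1.data.iter y.1.2).1 (y.1.1.data.p - y.2.1) y.2.2.1 y.2.2.2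
      else s 4 (a : ℤ) (b : ℤ)) := by
  have hw : powerBody.writes = {4} := rfl
  refine Spec.mono (Spec.forCmd (N := fun y => y.1.1.n) (fun y s₁ l s => ∀ a b : ℕ,
      if a = y.2.1 * y.1.1.n + y.2.2.1 ∧ b = y.2.2.2 then
        (l < y.1.1.n → s 4 (a : ℤ) (b : ℤ) = ∑ l' ∈ Finset.Ico l y.1.1.n,
          y.1.1.data.powM (y.1.1.data.iter y.1.2).1 (y.1.1.data.p - (y.2.1 + 1)) y.2.2.1 l' *
            y.1.1.data.shifted (y.1.1.data.iter y.1.2).1 l' y.2.2.2)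
      else s 4 (a : ℤ) (b : ℤ) = s₁ 4 (a : ℤ) (b : ℤ))
    (fun y s h => (size_bounds h.1.1.1).1) (fun y s h => eval_eN h.1.1) ?_ ?_
    (by rw [hw]; decide) ?_) (fun _ _ h => h) ?_
  · intro y s h a b
    split_ifs
    · exact fun h => absurd h (lt_irrefl _)
    · rfl
  · intro y s₀ i s z h a b
    rw [Store.set_other _ (by decide)]; exact h a b
  · rw [hw]
    refine Spec.write ?_
    rintro ⟨⟨⟨x, t⟩, r, i, j⟩, s₁, l⟩ s ⟨⟨⟨henv, ht, -⟩, hr, hi, hj, h24, h20, h21, hB, hM⟩, hl, h,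
      h22, hf⟩
    simp only at *
    have henv' : x.Env s := henv.of_eq (hf 0 (by decide))
    have e20 : s 20 0 0 = i := by rw [hf 20 (by decide), h20]
    have e21 : s 21 0 0 = j := by rw [hf 21 (by decide), h21]
    have e24 : s 24 0 0 = r := by rw [hf 24 (by decide), h24]
    have hrow : Expr.eval s (.add (.mul (.var 24) .eN) (.var 20)) = ((r * x.n + i : ℕ) : ℤ) := by
      simp only [Expr.eval, Expr.eval_var, e24, e20, eval_eN henv']; push_cast; ring
    have hcell : ∀ r' i' j' : ℕ, r' ≠ r → i' < x.n →
        s 4 ((r' * x.n + i' : ℕ) : ℤ) (j' : ℤ) = s₁ 4 ((r' * x.n + i' : ℕ) : ℤ) (j' : ℤ) := by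
      intro r' i' j' hr' hi'
      have := h (r' * x.n + i') j'
      rwa [if_neg fun hc => hr' (row_inj hi' hi hc.1).1] at this
    have h1 : Expr.eval s (.read 4 (.add (.mul (.add (.var 24) (.const 1)) .eN) (.var 20)) (.var 22))
        = x.data.powM (x.data.iter t).1 (x.data.p - (r + 1)) i l := by
      rw [← hB i hi l hl, ← hcell (r + 1) i l (by omega) hi]
      simp only [Expr.eval, Expr.eval_var, e24, e20, h22, eval_eN henv']; push_cast; ring_nf
    have h2 : Expr.eval s (.read 4 (.add (.mul .eP .eN) (.var 22)) (.var 21))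
        = x.data.shifted (x.data.iter t).1 l j := by
      have := hM l hl j hj
      rw [Nat.sub_self] at this
      refine Eq.trans ?_ this
      rw [← hcell x.data.p l j (by omega) hl]
      simp only [Expr.eval, Expr.eval_var, e21, h22, eval_eN henv', eval_eP henv']; push_cast; ring_nf
    have hval : Expr.eval s (.add (.mul (.read 4 (.add (.mul (.var 24) .eN) (.var 20)) (.var 21))
        (.pos (.sub (.sub .eN (.const 1)) (.var 22))))
        (.mul (.read 4 (.add (.mul (.add (.var 24) (.const 1)) .eN) (.var 20)) (.var 22))
        (.read 4 (.add (.mul .eP .eN) (.var 22)) (.var 21)))) = ∑ l' ∈ Finset.Ico l x.n,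
          x.data.powM (x.data.iter t).1 (x.data.p - (r + 1)) i l' *
            x.data.shifted (x.data.iter t).1 l' j := by
      rw [Finset.sum_eq_sum_Ico_succ_bot hl]
      have h3 : Expr.eval s (.pos (.sub (.sub .eN (.const 1)) (.var 22)))
          = ipos ((x.n : ℤ) - 1 - l) := by
        rw [Expr.eval_pos]
        simp only [Expr.eval, Expr.eval_var, eval_eN henv', h22]
      have h4 : Expr.eval s (.read 4 (.add (.mul (.var 24) .eN) (.var 20)) (.var 21))
          * ipos ((x.n : ℤ) - 1 - l) = ∑ l' ∈ Finset.Ico (l + 1) x.n,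
          x.data.powM (x.data.iter t).1 (x.data.p - (r + 1)) i l' *
            x.data.shifted (x.data.iter t).1 l' j := by
        rcases Nat.lt_or_ge (l + 1) x.n with hl' | hl'
        · have := h (r * x.n + i) j
          rw [if_pos ⟨rfl, rfl⟩] at this
          rw [← this hl']
          have e : ipos ((x.n : ℤ) - 1 - l) = 1 := if_pos (by omega)
          rw [e, mul_one]
          change s 4 (Expr.eval s (.add (.mul (.var 24) .eN) (.var 20))) (Expr.eval s (.var 21)) = _
          rw [hrow, Expr.eval_var, e21]
        · have e : ipos ((x.n : ℤ) - 1 - l) = 0 := if_neg (by omega)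
          rw [e, mul_zero, Finset.Ico_eq_empty (by omega), Finset.sum_empty]
      rw [← h4, ← h3, ← h1, ← h2]
      simp only [Expr.eval]
      ring
    rw [hval, hrow, Expr.eval_var, e21]
    refine ⟨le_two_pow_of_le_pow (a := x.n * entryBoundGen x.n x.m) (r := x.data.p + 1)
      (R := x.data.p + 3) ?_ (by omega) (size_bounds henv.1).2.2.2.2.1, fun a b => ?_⟩
    · set E := x.n * entryBoundGen x.n x.m with hE
      have hEpos : 1 ≤ E := Nat.mul_pos (by have := henv.1.1; omega)
        (by unfold entryBoundGen; omega)
      have hb := abs_sum_Ico_le (l := l) (n := x.n)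
        (B := E ^ (x.data.p - (r + 1) + 1) * entryBoundGen x.n x.m)
        (f := fun l' => x.data.powM (x.data.iter t).1 (x.data.p - (r + 1)) i l' *
            x.data.shifted (x.data.iter t).1 l' j) (fun a ha => by
          rw [abs_mul]
          push_cast
          have h1 := abs_powM_le henv.1 ht.le (x.data.p - (r + 1)) i hi a ha
          push_cast at h1
          exact mul_le_mul h1 (abs_shifted_le henv.1 ht.le ha hj) (abs_nonneg _) (by positivity))
      refine hb.trans ?_
      have : x.n * (E ^ (x.data.p - (r + 1) + 1) * entryBoundGen x.n x.m) ≤ E ^ (x.data.p + 1) := by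
        calc _ = E ^ (x.data.p - (r + 1) + 1 + 1) := by rw [pow_succ _ (_ + 1), hE]; ring
          _ ≤ _ := Nat.pow_le_pow_right hEpos (by omega)
      exact_mod_cast this
    · rw [Store.set_cell]
      by_cases hab : a = r * x.n + i ∧ b = j
      · rw [if_pos hab, if_pos hab]
        exact fun _ => rfl
      · rw [if_neg hab, if_neg hab]
        have := h a b
        rwa [if_neg hab] at this
  · rintro ⟨⟨x, t⟩, r, i, j⟩ s s' ⟨⟨henv, -⟩, hr, -⟩ h a b
    simp only at *
    have := h a b
    split_ifs at this ⊢ with hab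
    · rw [this (by have := henv.1.1; omega), ← Finset.range_eq_Ico]
      have e : x.data.p - r = x.data.p - (r + 1) + 1 := by omega
      rw [e]
      rfl
    · exact this

def powerCmd : Cmd :=
  forCmd 24 Expr.eP (forCmd 20 Expr.eN (forCmd 21 Expr.eN (forCmd 22 Expr.eN powerBody)))

theorem powerCmd_spec : Spec (fun y : Inst × ℕ => y.1.size) bitPoly
    (fun y s => StepPre y s ∧ BlockAt y y.1.data.p s) powerCmd (fun y _ s' => BlockAt y 0 s') := by
  have hw : (forCmd 22 Expr.eN powerBody).writes = {22, 4} := rfl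
  have hw' : (forCmd 20 Expr.eN (forCmd 21 Expr.eN (forCmd 22 Expr.eN powerBody))).writes
    = {20, 21, 22, 4} := rfl
  refine Spec.mono (Spec.forCmd (N := fun y => y.1.data.p)
    (fun y _ r s => ∀ r', r ≤ r' → r' ≤ y.1.data.p → BlockAt y r' s)
    (fun y s h => (size_bounds h.1.1.1).2.2.1) (fun y s h => eval_eP h.1.1) ?_ ?_
    (by rw [hw']; decide) ?_) (fun _ _ h => h) (fun y s s' _ h => h 0 le_rfl (Nat.zero_le _))
  · intro y s h r' h1 h2
    obtain rfl : r' = y.1.data.p := le_antisymm h2 h1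
    exact h.2
  · intro y s₀ r s z h r' h1 h2
    exact (h r' h1 h2).of_eq (Store.set_other _ (by decide) _ _ _)
  · rw [hw']
    refine Spec.mono (Spec.forCmd₂ (N := fun y => y.1.1.n) (M := fun y => y.1.1.n) (fun y _ i j s =>
        (∀ r', y.2.2 < r' → r' ≤ y.1.1.data.p → BlockAt y.1 r' s) ∧
        ∀ a < y.1.1.n, ∀ b < y.1.1.n, Visited i j a b →
          s 4 ((y.2.2 * y.1.1.n + a : ℕ) : ℤ) (b : ℤ)
            = y.1.1.data.powM (y.1.1.data.iter y.1.2).1 (y.1.1.data.p - y.2.2) a b)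
      (fun y s h => (size_bounds h.1.1.1.1).1) (fun y s h => (size_bounds h.1.1.1.1).1)
      (fun y s h => eval_eN (h.1.1.1.of_eq (h.2.2.2.2 0 (by decide))))
      (fun y s₀ s h hf => eval_eN ((h.1.1.1.of_eq (h.2.2.2.2 0 (by decide))).of_eq
        (hf 0 (by rw [hw]; decide)))) ?_ ?_ ?_ ?_
      (by rw [hw]; decide) (by rw [hw]; decide) (by decide) ?_) (fun _ _ h => h) ?_
    · intro y s h
      exact ⟨h.2.2.1, fun a ha b _ hv => absurd hv (not_visited_init ha)⟩
    · intro y s₀ i s h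
      exact ⟨h.1, fun a ha b hb hv => h.2 a ha b hb ((visited_row hb).mpr hv)⟩
    · intro y s₀ i j s z h
      refine ⟨fun r' h1 h2 => (h.1 r' h1 h2).of_eq (Store.set_other _ (by decide) _ _ _), ?_⟩
      rw [Store.set_other _ (by decide)]; exact h.2
    · intro y s₀ i j s z h
      refine ⟨fun r' h1 h2 => (h.1 r' h1 h2).of_eq (Store.set_other _ (by decide) _ _ _), ?_⟩
      rw [Store.set_other _ (by decide)]; exact h.2
    · rw [hw]
      refine Spec.mono (powerCell_spec.comap
        fun y : ((Inst × ℕ) × Store × ℕ) × Store × ℕ × ℕ => (y.1.1, y.1.2.2, y.2.2.1, y.2.2.2)) ?_ ?_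
      · rintro ⟨⟨⟨x, t⟩, s₀, r⟩, s₁, i, j⟩ s ⟨⟨hpre, hr, hB, h24, hf⟩, hi, hj, h, h20, h21, hf'⟩
        refine ⟨hpre.1.of_eq fun a ha => ?_, hr, hi, hj, ?_, h20, h21, h.1 _ (Nat.lt_succ_self _) hr,
          h.1 _ hr le_rfl⟩
        · have : a ∉ ({24, 20, 21, 22, 4} : Finset ℕ) := by revert a; decide
          have h2 : a ∉ ({20, 21, 22, 4} : Finset ℕ) := by revert a; decide
          rw [hf' a h2, hf a this]
        · rw [hf' 24 (by decide)]; exact h24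
      · rintro ⟨⟨⟨x, t⟩, s₀, r⟩, s₁, i, j⟩ s s' ⟨⟨hpre, hr, hB, h24, hf⟩, hi, hj, h, h20, h21, hf'⟩ h'
        simp only at *
        refine ⟨fun r' h1 h2 a ha b hb => ?_, fun a ha b hb hv => ?_⟩
        · simp only at *
          rw [h', if_neg fun hc => (Nat.ne_of_gt h1) (row_inj ha hi hc.1).1]
          exact h.1 r' h1 h2 a ha b hb
        · rw [h']
          by_cases hab : a = i ∧ b = j
          · obtain ⟨rfl, rfl⟩ := hab
            simp
          · rw [if_neg fun hc => hab ⟨(row_inj ha hi hc.1).2, hc.2⟩]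
            exact h.2 a ha b hb ((visited_ne hab).mp hv)
    · rintro ⟨y, s₀, r⟩ s s' _ h r' h1 h2
      rcases Nat.eq_or_lt_of_le h1 with rfl | h3
      · exact fun i hi j hj => h.2 i hi j hj (visited_final i j)
      · exact h.1 r' h3 h2

open PlantedRFCW.Expr in
def traceBody : Cmd := .write 6 (const 0) (const 0)
  (add (mul (var 6) (pos (sub (sub eN (const 1)) (var 20)))) (read 4 (var 20) (var 20)))

theorem traceCmd_spec : Spec (fun y : Inst × ℕ => y.1.size) bitPoly
    (fun y s => StepPre y s ∧ BlockAt y 0 s) (forCmd 20 Expr.eN traceBody)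
    (fun y _ s' => s' 6 0 0 = y.1.data.trPow (y.1.data.iter y.2).1) := by
  have hw : traceBody.writes = {6} := rfl
  refine Spec.mono (Spec.forCmd (N := fun y => y.1.n) (fun y _ i s => i < y.1.n →
      s 6 0 0 = ∑ i' ∈ Finset.Ico i y.1.n,
        y.1.data.powM (y.1.data.iter y.2).1 y.1.data.p i' i')
    (fun y s h => (size_bounds h.1.1.1).1) (fun y s h => eval_eN h.1.1)
    (fun y s h hlt => absurd hlt (lt_irrefl _)) ?_ (by rw [hw]; decide) ?_) (fun _ _ h => h) ?_
  · intro y s₀ i s z h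
    rw [Store.set_other _ (by decide)]; exact h
  · rw [hw]
    refine Spec.write ?_
    rintro ⟨⟨x, t⟩, s₁, i⟩ s ⟨⟨⟨henv, ht, -⟩, hB⟩, hi, h, h20, hf⟩
    simp only at *
    have henv' : x.Env s := henv.of_eq (hf 0 (by decide))
    have hval : Expr.eval s (.add (.mul (.var 6) (.pos (.sub (.sub .eN (.const 1)) (.var 20))))
        (.read 4 (.var 20) (.var 20))) = ∑ i' ∈ Finset.Ico i x.n,
          x.data.powM (x.data.iter t).1 x.data.p i' i' := by
      rw [Finset.sum_eq_sum_Ico_succ_bot hi]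
      have h1 := hB i hi i hi
      simp only [Nat.zero_mul, Nat.zero_add, Nat.sub_zero] at h1
      have h2 : s 6 0 0 * ipos ((x.n : ℤ) - 1 - i) = ∑ i' ∈ Finset.Ico (i + 1) x.n,
          x.data.powM (x.data.iter t).1 x.data.p i' i' := by
        rcases Nat.lt_or_ge (i + 1) x.n with hl' | hl'
        · have e : ipos ((x.n : ℤ) - 1 - i) = 1 := if_pos (by omega)
          rw [e, mul_one, h hl']
        · have e : ipos ((x.n : ℤ) - 1 - i) = 0 := if_neg (by omega)
          rw [e, mul_zero, Finset.Ico_eq_empty (by omega), Finset.sum_empty]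
      rw [← h2, ← h1]
      simp only [Expr.eval, Expr.eval_var, Expr.eval_pos, eval_eN henv', h20, hf 4 (by decide)]
      ring
    rw [hval]
    refine ⟨le_two_pow_of_le_pow (a := x.n * entryBoundGen x.n x.m) (r := x.data.p + 2)
      (R := x.data.p + 3) ?_ (by omega) (size_bounds henv.1).2.2.2.2.1, fun _ => ?_⟩
    · have hb := abs_sum_Ico_le (l := i) (n := x.n)
        (f := fun i' => x.data.powM (x.data.iter t).1 x.data.p i' i') (fun a ha =>
          abs_powM_le henv.1 ht.le x.data.p a ha a ha)
      refine hb.trans ?_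
      have : x.n * (x.n * entryBoundGen x.n x.m) ^ (x.data.p + 1)
          ≤ (x.n * entryBoundGen x.n x.m) ^ (x.data.p + 2) := by
        rw [pow_succ _ (x.data.p + 1), mul_comm]
        exact Nat.mul_le_mul_left _ (Nat.le_mul_of_pos_right _ (by unfold entryBoundGen; omega))
      exact_mod_cast this
    · simp [Store.set, Expr.eval]
  · rintro ⟨x, t⟩ s s' ⟨⟨henv, -⟩, -⟩ h
    rw [h (by have := henv.1.1; omega), ← Finset.range_eq_Ico]
    rfl


/-- Within step `t`, before the dual variables are updated. -/
def UpdatePre (y : Inst × ℕ) (s : Store) : Prop :=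
  StepPre y s ∧ BlockAt y 0 s ∧ s 6 0 0 = y.1.data.trPow (y.1.data.iter y.2).1

open PlantedRFCW.Expr in
def entryE (a : ℕ) : Expr := read a (var 20) (var 21)

open PlantedRFCW.Expr in
def respE : Expr := div (mul eU (entryE 4)) (var 6)

open PlantedRFCW.Expr in
def overE : Expr := sub (entryE 3) (var 8)

open PlantedRFCW.Expr in
def underE : Expr := sub (sub (const 0) (entryE 3)) (var 8)

open PlantedRFCW.Expr in
def gainE : Expr := add (var 7) (add (mul respE (add (mul eq (entryE 2)) (entryE 3)))
  (mul (mul eU eK) (add (mul overE (pos overE)) (mul underE (pos underE)))))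

open PlantedRFCW.Expr in
def violE : Expr := add (var 9) (add (pos overE) (pos underE))

open PlantedRFCW.Expr in
def newYE : Expr := sub (entryE 3)
  (add respE (mul (mul eU eK) (sub (pos overE) (pos underE))))

open PlantedRFCW.Expr in
def updateBody : Cmd := .seq (.write 7 (const 0) (const 0) gainE)
  (.seq (.write 9 (const 0) (const 0) violE) (.write 3 (var 20) (var 21) newYE))

/-- The invariant of the update loop. -/
def UpdateInv (y : Inst × ℕ) (i j : ℕ) (s : Store) : Prop :=
  s 7 0 0 = (y.1.data.iter y.2).2.2 +
    psum y.1.n (y.1.data.gainEntry (y.1.data.iter y.2).1 (y.1.data.iter y.2).2.1) i j ∧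
  s 9 0 0 = psum y.1.n (SubgradData.viol (y.1.data.iter y.2).1 (y.1.data.iter y.2).2.1) i j ∧
  ∀ a < y.1.n, ∀ b < y.1.n, s 3 (a : ℤ) (b : ℤ) = if Visited i j a b
    then y.1.data.newY (y.1.data.iter y.2).1 (y.1.data.iter y.2).2.1 a b
    else (y.1.data.iter y.2).1 a b

theorem UpdateInv.of_eq {y : Inst × ℕ} {i j : ℕ} {s s' : Store} (h : UpdateInv y i j s)
    (h7 : s' 7 = s 7) (h9 : s' 9 = s 9) (h3 : s' 3 = s 3) : UpdateInv y i j s' := by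
  unfold UpdateInv; rw [h7, h9, h3]; exact h

theorem abs_S_add_psum_le {x : Inst} (h : x.Valid) {t : ℕ} (ht : t < sdpSteps x.n x.m) (i j : ℕ) :
    |(x.data.iter t).2.2 + psum x.n (x.data.gainEntry (x.data.iter t).1 (x.data.iter t).2.1) i j|
      ≤ 2 ^ (bitPoly.eval x.size) := by
  have h1 := abs_iter_S_le h ht.le
  have h2 := abs_psum_le (n := x.n) (B := gainEntryBoundGen x.n x.m x.k)
    (fun a ha b hb => abs_gainEntry_le h ht ha hb) i j
  have h3 : x.n ^ 2 * gainEntryBoundGen x.n x.m x.k ≤ gainBoundGen x.n x.m x.k :=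
    Nat.le_add_left _ _
  have h4 : ((x.n ^ 2 * gainEntryBoundGen x.n x.m x.k : ℕ) : ℤ) ≤ (gainBoundGen x.n x.m x.k : ℕ) := by
    exact_mod_cast h3
  refine int_abs_le_two_pow (b := (sdpSteps x.n x.m + 1) * gainBoundGen x.n x.m x.k)
    ((abs_add_le _ _).trans ((add_le_add h1 h2).trans ?_)) (size_bounds h).2.2.2.2.2.2.2.1
  have h5 : t * gainBoundGen x.n x.m x.k ≤ sdpSteps x.n x.m * gainBoundGen x.n x.m x.k :=
    Nat.mul_le_mul_right _ ht.le
  have h6 : t * gainBoundGen x.n x.m x.k + x.n ^ 2 * gainEntryBoundGen x.n x.m x.k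
      ≤ (sdpSteps x.n x.m + 1) * gainBoundGen x.n x.m x.k := by
    rw [Nat.succ_mul]; omega
  exact_mod_cast h6

theorem updateCmd_spec : Spec (fun y : Inst × ℕ => y.1.size) bitPoly UpdatePre
    (forCmd 20 Expr.eN (forCmd 21 Expr.eN updateBody)) (fun y _ s' => UpdateInv y 0 0 s') := by
  have hw : updateBody.writes = {7, 9, 3} := rfl
  refine Spec.forCmd₂ (N := fun y => y.1.n) (M := fun y => y.1.n) (fun y _ i j s => UpdateInv y i j s)
    (fun y s h => (size_bounds h.1.1.1).1) (fun y s h => (size_bounds h.1.1.1).1)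
    (fun y s h => eval_eN h.1.1)
    (fun y s₀ s h hf => eval_eN (h.1.1.of_eq (hf 0 (by rw [hw]; decide)))) ?_ ?_ ?_ ?_
    (by rw [hw]; decide) (by rw [hw]; decide) (by decide) ?_
  · rintro ⟨x, t⟩ s ⟨⟨henv, ht, hG, hY, h8, h7, h9⟩, -⟩
    refine ⟨?_, ?_, fun a ha b hb => ?_⟩
    · simp only [psum_init, h7, add_zero]
    · simp only [psum_init, h9]
    · simp only at *
      rw [if_neg (not_visited_init ha)]; exact hY a ha b hb
  · rintro y s₀ i s ⟨h1, h2, h3⟩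
    refine ⟨by rw [h1, psum_row], by rw [h2, psum_row], fun a ha b hb => ?_⟩
    rw [h3 a ha b hb]; simp only [visited_row hb]
  · intro y s₀ i j s z h
    exact h.of_eq (Store.set_other _ (by decide) _ _ _) (Store.set_other _ (by decide) _ _ _)
      (Store.set_other _ (by decide) _ _ _)
  · intro y s₀ i j s z h
    exact h.of_eq (Store.set_other _ (by decide) _ _ _) (Store.set_other _ (by decide) _ _ _)
      (Store.set_other _ (by decide) _ _ _)
  · rw [hw]
    have key : ∀ (x : Inst) (t : ℕ) (s₀ s : Store) (i j : ℕ), UpdatePre (x, t) s₀ → i < x.n →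
        j < x.n → UpdateInv (x, t) i (j + 1) s → s 20 0 0 = i → s 21 0 0 = j →
        (∀ a ∉ insert 20 (insert 21 ({7, 9, 3} : Finset ℕ)), s a = s₀ a) →
        ∀ s' : Store, (∀ a ∉ ({7, 9} : Finset ℕ), s' a = s a) →
        overE.eval s' = (x.data.iter t).1 i j - (x.data.iter t).2.1 ∧
        underE.eval s' = -(x.data.iter t).1 i j - (x.data.iter t).2.1 ∧
        respE.eval s' = x.data.resp (x.data.iter t).1 i j ∧
        (entryE 3).eval s' = (x.data.iter t).1 i j ∧ (entryE 2).eval s' = x.gram i j ∧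
        x.Env s' := by
      rintro x t s₀ s i j ⟨⟨henv, ht, hG, hY, h8, -, -⟩, hB, h6⟩ hi hj ⟨-, -, h3⟩ h20 h21 hf s' hs'
      simp only at *
      have henv' : x.Env s' := (henv.of_eq (hf 0 (by decide))).of_eq (hs' 0 (by decide))
      have h3' := h3 i hi j hj
      rw [if_neg not_visited_self] at h3'
      have h4 := hB i hi j hj
      simp only [Nat.zero_mul, Nat.zero_add, Nat.sub_zero] at h4
      have f4 : s 4 = s₀ 4 := hf 4 (by decide)
      have f6 : s 6 = s₀ 6 := hf 6 (by decide)
      have f8 : s 8 = s₀ 8 := hf 8 (by decide)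
      have f2 : s 2 = s₀ 2 := hf 2 (by decide)
      have e3 : (entryE 3).eval s' = (x.data.iter t).1 i j := by
        simp only [entryE, Expr.eval, Expr.eval_var, hs' 3 (by decide), hs' 20 (by decide),
          hs' 21 (by decide), h20, h21, h3']
      have e8 : (Expr.var 8).eval s' = (x.data.iter t).2.1 := by
        rw [Expr.eval_var, hs' 8 (by decide), f8, h8]
      refine ⟨?_, ?_, ?_, e3, ?_, henv'⟩
      · simp only [overE, Expr.eval, e3, e8]
      · simp only [underE, Expr.eval, e3, e8]; ring
      · simp only [respE, entryE, Expr.eval, Expr.eval_var, eval_eU henv', hs' 4 (by decide),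
          hs' 6 (by decide), hs' 20 (by decide), hs' 21 (by decide), h20, h21, f4, f6, h4, h6]
        rfl
      · simp only [entryE, Expr.eval, Expr.eval_var, hs' 2 (by decide), hs' 20 (by decide),
          hs' 21 (by decide), h20, h21, f2]
        exact hG i hi j hj
    have key7 : ∀ (x : Inst) (t : ℕ) (s₀ s : Store) (i j : ℕ), UpdatePre (x, t) s₀ → i < x.n →
        j < x.n → UpdateInv (x, t) i (j + 1) s → s 20 0 0 = i → s 21 0 0 = j →
        (∀ a ∉ insert 20 (insert 21 ({7, 9, 3} : Finset ℕ)), s a = s₀ a) →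
        gainE.eval s = (x.data.iter t).2.2 +
          psum x.n (x.data.gainEntry (x.data.iter t).1 (x.data.iter t).2.1) i j := by
      intro x t s₀ s i j hpre hi hj hJ h20 h21 hf
      obtain ⟨k1, k2, k3, k4, k5, k6⟩ := key x t s₀ s i j hpre hi hj hJ h20 h21 hf s fun _ _ => rfl
      rw [psum_cell _ hi hj, ← add_assoc, ← hJ.1]
      simp only [gainE, Expr.eval, Expr.eval_pos, k1, k2, k3, k4, k5, eval_eU k6, eval_eK k6,
        eval_eq k6, Expr.eval_var]
      rfl
    have key9 : ∀ (x : Inst) (t : ℕ) (s₀ s : Store) (i j : ℕ), UpdatePre (x, t) s₀ → i < x.n →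
        j < x.n → UpdateInv (x, t) i (j + 1) s → s 20 0 0 = i → s 21 0 0 = j →
        (∀ a ∉ insert 20 (insert 21 ({7, 9, 3} : Finset ℕ)), s a = s₀ a) → ∀ z,
        violE.eval (s.set 7 0 0 z) =
          psum x.n (SubgradData.viol (x.data.iter t).1 (x.data.iter t).2.1) i j := by
      intro x t s₀ s i j hpre hi hj hJ h20 h21 hf z
      obtain ⟨k1, k2, k3, k4, k5, k6⟩ := key x t s₀ s i j hpre hi hj hJ h20 h21 hf (s.set 7 0 0 z)
        fun a ha => Store.set_other _ (by rintro rfl; exact ha (by decide)) _ _ _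
      rw [psum_cell _ hi hj]
      have h9 : psum x.n (SubgradData.viol (x.data.iter t).1 (x.data.iter t).2.1) i (j + 1)
        = s.set 7 0 0 z 9 0 0 := by rw [Store.set_other _ (by decide)]; exact hJ.2.1.symm
      rw [h9]
      simp only [violE, Expr.eval, Expr.eval_pos, k1, k2, Expr.eval_var]
      rfl
    refine Spec.write_seq ?_ (Spec.write_seq ?_ (Spec.write ?_))
    · rintro ⟨⟨x, t⟩, s₀, i, j⟩ s ⟨hpre, hi, hj, hJ, h20, h21, hf⟩
      simp only at *
      rw [key7 x t s₀ s i j hpre hi hj hJ h20 h21 hf]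
      exact abs_S_add_psum_le hpre.1.1.1 hpre.1.2.1 i j
    · rintro ⟨⟨⟨x, t⟩, s₀, i, j⟩, s⟩ _ ⟨⟨hpre, hi, hj, hJ, h20, h21, hf⟩, rfl⟩
      simp only at *
      have := key9 x t s₀ s i j hpre hi hj hJ h20 h21 hf (gainE.eval s)
      have h0 : Expr.eval s (.const 0) = 0 := rfl
      rw [h0, this]
      have h2 := abs_psum_le (n := x.n) (B := 2) (fun a _ b _ => abs_viol_le (x.data.iter t).1
        (x.data.iter t).2.1 a b) i j
      have h3 := (size_bounds hpre.1.1.1).2.2.2.2.2.2.2.2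
      simp only at h3
      refine int_abs_le_two_pow (b := x.n ^ 2 * 2) (by exact_mod_cast h2) (by omega)
    · rintro ⟨⟨⟨⟨x, t⟩, s₀, i, j⟩, s⟩, s₁⟩ _ ⟨⟨⟨hpre, hi, hj, hJ, h20, h21, hf⟩, e₁⟩, rfl⟩
      simp only at *
      subst e₁
      have h0 : ∀ s, Expr.eval s (.const 0) = 0 := fun _ => rfl
      rw [h0, h0, key9 x t s₀ s i j hpre hi hj hJ h20 h21 hf,
        key7 x t s₀ s i j hpre hi hj hJ h20 h21 hf]
      set s₂ := Store.set (s.set 7 0 0 _) 9 0 0 _ with hs₂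
      have hs₂' : ∀ a ∉ ({7, 9} : Finset ℕ), s₂ a = s a := fun a ha => by
        rw [hs₂, Store.set_other _ (by rintro rfl; exact ha (by decide)),
          Store.set_other _ (by rintro rfl; exact ha (by decide))]
      obtain ⟨k1, k2, k3, k4, k5, k6⟩ := key x t s₀ s i j hpre hi hj hJ h20 h21 hf s₂ hs₂'
      have hval : newYE.eval s₂ = x.data.newY (x.data.iter t).1 (x.data.iter t).2.1 i j := by
        simp only [newYE, Expr.eval, Expr.eval_pos, k1, k2, k3, k4, eval_eU k6, eval_eK k6]
        rfl
      have e20 : (Expr.var 20).eval s₂ = i := by rw [Expr.eval_var, hs₂' 20 (by decide), h20]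
      have e21 : (Expr.var 21).eval s₂ = j := by rw [Expr.eval_var, hs₂' 21 (by decide), h21]
      rw [hval, e20, e21]
      refine ⟨int_abs_le_two_pow (abs_iter_le hpre.1.1.1 (t := t + 1) hpre.1.2.1 hi hj)
        (size_bounds hpre.1.1.1).2.2.2.2.2.1, ?_, ?_, fun a ha b hb => ?_⟩
      · rw [Store.set_other _ (by decide), hs₂, Store.set_other _ (by decide), Store.set_same]
      · rw [Store.set_other _ (by decide), hs₂, Store.set_same]
      · simp only at *
        rw [Store.set_cell, hs₂' 3 (by decide), hJ.2.2 a ha b hb]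
        by_cases hab : a = i ∧ b = j
        · obtain ⟨rfl, rfl⟩ := hab
          simp [visited_cell.mpr (Or.inr ⟨rfl, rfl⟩)]
        · rw [if_neg hab]; simp only [visited_ne hab]

/-- The state after `t` steps of the iteration. -/
def IterState (x : Inst) (t : ℕ) (s : Store) : Prop :=
  x.Env s ∧ (∀ i < x.n, ∀ j < x.n, s 2 (i : ℤ) (j : ℤ) = x.gram i j) ∧
  (∀ i < x.n, ∀ j < x.n, s 3 (i : ℤ) (j : ℤ) = (x.data.iter t).1 i j) ∧
  s 8 0 0 = (x.data.iter t).2.1 ∧ s 7 0 0 = (x.data.iter t).2.2 ∧ s 9 0 0 = 0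

open PlantedRFCW.Expr in
def finishCmd : Cmd := .seq (.write 7 (const 0) (const 0) (add (var 7) (mul (mul eU eK) (var 8))))
  (.seq (.write 8 (const 0) (const 0) (sub (var 8) (mul (mul eU eK) (sub (const 1) (var 9)))))
    (.write 9 (const 0) (const 0) (const 0)))

theorem finishCmd_spec : Spec (fun y : Inst × ℕ => y.1.size) bitPoly
    (fun y s => y.1.Env s ∧ y.2 < sdpSteps y.1.n y.1.m ∧
      (∀ i < y.1.n, ∀ j < y.1.n, s 2 (i : ℤ) (j : ℤ) = y.1.gram i j) ∧
      s 8 0 0 = (y.1.data.iter y.2).2.1 ∧ UpdateInv y 0 0 s) finishCmd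
    (fun y _ s' => IterState y.1 (y.2 + 1) s') := by
  have h0 : ∀ s, Expr.eval s (.const 0) = 0 := fun _ => rfl
  have key7 : ∀ (x : Inst) (t : ℕ) (s : Store), x.Env s → s 8 0 0 = (x.data.iter t).2.1 →
      UpdateInv (x, t) 0 0 s → Expr.eval s (.add (.var 7) (.mul (.mul .eU .eK) (.var 8)))
        = (x.data.iter (t + 1)).2.2 := by
    intro x t s henv h8 hU
    have h7 := hU.1
    simp only at h7
    simp only [Expr.eval, Expr.eval_var, h8, h7, eval_eU henv, eval_eK henv, psum_final]
    simp only [SubgradData.iter, SubgradData.gain]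
    have hk : (x.data.k : ℤ) = x.k := rfl
    have hn : x.data.n = x.n := rfl
    rw [hk, hn]; ring
  have key8 : ∀ (x : Inst) (t : ℕ) (s : Store) (z : ℤ), x.Env s → s 8 0 0 = (x.data.iter t).2.1 →
      UpdateInv (x, t) 0 0 s → Expr.eval (s.set 7 0 0 z)
        (.sub (.var 8) (.mul (.mul .eU .eK) (.sub (.const 1) (.var 9))))
        = (x.data.iter (t + 1)).2.1 := by
    intro x t s z henv h8 hU
    have h9 := hU.2.1
    have henv' : x.Env (s.set 7 0 0 z) := henv.of_eq (Store.set_other _ (by decide) _ _ _)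
    simp only at h9
    simp only [Expr.eval, Expr.eval_var, Store.set_other s (by decide : 8 ≠ 7),
      Store.set_other s (by decide : 9 ≠ 7), h8, h9, eval_eU henv', eval_eK henv', psum_final]
    rfl
  refine Spec.write_seq ?_ (Spec.write_seq ?_ (Spec.write ?_))
  · rintro ⟨x, t⟩ s ⟨henv, ht, -, h8, hU⟩
    simp only at *
    rw [key7 x t s henv h8 hU]
    refine int_abs_le_two_pow (b := (sdpSteps x.n x.m + 1) * gainBoundGen x.n x.m x.k)
      ((abs_iter_S_le henv.1 (t := t + 1) ht).trans ?_) (size_bounds henv.1).2.2.2.2.2.2.2.1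
    have : (t + 1) * gainBoundGen x.n x.m x.k
        ≤ (sdpSteps x.n x.m + 1) * gainBoundGen x.n x.m x.k := Nat.mul_le_mul_right _ (by omega)
    exact_mod_cast this
  · rintro ⟨⟨x, t⟩, s⟩ _ ⟨⟨henv, ht, -, h8, hU⟩, rfl⟩
    simp only at *
    rw [h0, key8 x t s _ henv h8 hU]
    exact int_abs_le_two_pow (abs_iter_z_le' henv.1 (t := t + 1) ht)
      (size_bounds henv.1).2.2.2.2.2.2.1
  · rintro ⟨⟨⟨x, t⟩, s⟩, s₁⟩ _ ⟨⟨⟨henv, ht, hG, h8, hU⟩, e₁⟩, rfl⟩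
    simp only at *
    subst e₁
    rw [h0, h0, h0, key8 x t s _ henv h8 hU, key7 x t s henv h8 hU]
    refine ⟨by simp, henv.of_eq ?_, fun i hi j hj => ?_, fun i hi j hj => ?_, ?_, ?_, ?_⟩
    · simp only [Store.set_other _ (by decide : 0 ≠ 7), Store.set_other _ (by decide : 0 ≠ 8),
        Store.set_other _ (by decide : 0 ≠ 9)]
    · simp only [Store.set_other _ (by decide : 2 ≠ 7), Store.set_other _ (by decide : 2 ≠ 8),
        Store.set_other _ (by decide : 2 ≠ 9)]
      exact hG i hi j hj
    · simp only [Store.set_other _ (by decide : 3 ≠ 7), Store.set_other _ (by decide : 3 ≠ 8),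
        Store.set_other _ (by decide : 3 ≠ 9)]
      rw [hU.2.2 i hi j hj, if_pos (visited_final i j)]
      rfl
    · rw [Store.set_other _ (by decide), Store.set_same]
    · rw [Store.set_other _ (by decide), Store.set_other _ (by decide), Store.set_same]
    · rw [Store.set_same]

def stepCmd : Cmd := .seq (forCmd 20 Expr.eN (forCmd 21 Expr.eN shiftBody)) (.seq powerCmd
  (.seq (forCmd 20 Expr.eN traceBody) (.seq (forCmd 20 Expr.eN (forCmd 21 Expr.eN updateBody))
    finishCmd)))

theorem stepCmd_spec : Spec (fun y : Inst × ℕ => y.1.size) bitPoly StepPre stepCmd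
    (fun y _ s' => IterState y.1 (y.2 + 1) s') := by
  have w1 : (forCmd 20 Expr.eN (forCmd 21 Expr.eN shiftBody)).writes = {20, 21, 4} := rfl
  have w2 : powerCmd.writes = {24, 20, 21, 22, 4} := rfl
  have w3 : (forCmd 20 Expr.eN traceBody).writes = {20, 6} := rfl
  have w4 : (forCmd 20 Expr.eN (forCmd 21 Expr.eN updateBody)).writes = {20, 21, 7, 9, 3} := rfl
  refine Spec.seq_of (P₂ := fun y s => StepPre y s ∧ BlockAt y y.1.data.p s) shiftCmd_spec
    (Spec.seq_of (P₂ := fun y s => StepPre y s ∧ BlockAt y 0 s) powerCmd_spec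
    (Spec.seq_of (P₂ := UpdatePre) traceCmd_spec
    (Spec.seq_of updateCmd_spec finishCmd_spec ?_) ?_) ?_) ?_
  · rintro y s s' ⟨h, -⟩ hU hf
    rw [w4] at hf
    refine ⟨h.1.of_eq (hf 0 (by decide)), h.2.1, ?_, ?_, hU⟩
    · rw [hf 2 (by decide)]; exact h.2.2.1
    · rw [hf 8 (by decide)]; exact h.2.2.2.2.1
  · rintro y s s' ⟨h, hB⟩ h6 hf
    rw [w3] at hf
    exact ⟨h.of_eq fun a ha => hf a (by revert a; decide), hB.of_eq (hf 4 (by decide)), h6⟩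
  · rintro y s s' ⟨h, -⟩ hB hf
    rw [w2] at hf
    exact ⟨h.of_eq fun a ha => hf a (by revert a; decide), hB⟩
  · rintro y s s' h hB hf
    rw [w1] at hf
    refine ⟨h.of_eq fun a ha => hf a (by revert a; decide), fun i hi j hj => ?_⟩
    rw [hB i hi j hj, Nat.sub_self]
    rfl


theorem iterCmd_spec : Spec Inst.size bitPoly (fun x s => IterState x 0 s)
    (forCmd 23 Expr.eT stepCmd) (fun x _ s' => IterState x (sdpSteps x.n x.m) s') := by
  have hw : stepCmd.writes = {20, 21, 24, 22, 4, 6, 7, 9, 3, 8} := by decide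
  refine Spec.mono (Spec.forCmd (N := fun x => sdpSteps x.n x.m)
    (fun x _ t s => IterState x (sdpSteps x.n x.m - t) s)
    (fun x s h => (size_bounds h.1.1).2.2.2.1) (fun x s h => eval_eT h.1) ?_ ?_
    (by rw [hw]; decide) ?_) (fun _ _ h => h) (fun _ _ _ _ h => h)
  · intro x s h
    rw [Nat.sub_self]; exact h
  · intro x s₀ i s z h
    unfold IterState at *
    simp only [Store.set_other _ (by decide : 2 ≠ 23), Store.set_other _ (by decide : 3 ≠ 23),
      Store.set_other _ (by decide : 8 ≠ 23), Store.set_other _ (by decide : 7 ≠ 23),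
      Store.set_other _ (by decide : 9 ≠ 23)]
    exact ⟨h.1.of_eq (Store.set_other _ (by decide) _ _ _), h.2⟩
  · refine Spec.mono (stepCmd_spec.comap fun y : Inst × Store × ℕ =>
      (y.1, sdpSteps y.1.n y.1.m - (y.2.2 + 1))) ?_ ?_
    · rintro ⟨x, s₀, t⟩ s ⟨-, ht, h, -⟩
      simp only at *
      exact ⟨h.1, by simp only; omega, h.2.1, h.2.2.1, h.2.2.2.1, h.2.2.2.2.1, h.2.2.2.2.2⟩
    · rintro ⟨x, s₀, t⟩ s s' ⟨-, ht, -⟩ h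
      simp only at *
      have : sdpSteps x.n x.m - (t + 1) + 1 = sdpSteps x.n x.m - t := by omega
      rwa [this] at h

open PlantedRFCW.Expr in
def logBody : Cmd := .seq
  (.write 10 (const 0) (const 0) (add (mul (const 2) (var 10)) (const 1)))
  (.write 11 (const 0) (const 0) (add (var 11) (pos (sub eN (var 10)))))

theorem logCmd_spec : Spec Inst.size bitPoly
    (fun x s => x.Env s ∧ s 10 0 0 = 0 ∧ s 11 0 0 = 0) (forCmd 20 Expr.eN logBody)
    (fun x _ s' => s' 11 0 0 = (Nat.log 2 x.n : ℕ)) := by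
  have hw : logBody.writes = {10, 11} := rfl
  have h0 : ∀ s, Expr.eval s (.const 0) = 0 := fun _ => rfl
  refine Spec.mono (Spec.forCmd (N := fun x => x.n) (fun x _ r s =>
      s 10 0 0 = 2 ^ (x.n - r) - 1 ∧ s 11 0 0 = (min (x.n - r) (Nat.log 2 x.n) : ℕ))
    (fun x s h => (size_bounds h.1.1).1) (fun x s h => eval_eN h.1) ?_ ?_
    (by rw [hw]; decide) ?_) (fun _ _ h => h) ?_
  · rintro x s ⟨-, h1, h2⟩
    simp [h1, h2]
  · intro x s₀ i s z h
    rw [Store.set_other _ (by decide), Store.set_other _ (by decide)]; exact h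
  · rw [hw]
    have key : ∀ (x : Inst) (r : ℕ) (s : Store), r < x.n → s 10 0 0 = 2 ^ (x.n - (r + 1)) - 1 →
        Expr.eval s (.add (.mul (.const 2) (.var 10)) (.const 1)) = 2 ^ (x.n - r) - 1 := by
      intro x r s hr h
      have e : x.n - r = x.n - (r + 1) + 1 := by omega
      rw [e, pow_succ]
      simp only [Expr.eval, Expr.eval_var, h]
      ring
    refine Spec.write_seq ?_ (Spec.write ?_)
    · rintro ⟨x, s₀, r⟩ s ⟨⟨henv, -, -⟩, hr, ⟨h10, -⟩, -, -⟩
      simp only at *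
      have h2 : (1 : ℤ) ≤ 2 ^ (x.n - r) := one_le_pow₀ (by norm_num)
      rw [key x r s hr h10, abs_of_nonneg (by omega)]
      have h1 : (2 : ℤ) ^ (x.n - r) ≤ 2 ^ (bitPoly.eval x.size) :=
        pow_le_pow_right₀ (by norm_num) (by have := (size_bounds henv.1).1; omega)
      omega
    · rintro ⟨⟨x, s₀, r⟩, s⟩ _ ⟨⟨⟨henv, -, -⟩, hr, ⟨h10, h11⟩, -, hf⟩, rfl⟩
      simp only at *
      rw [h0, key x r s hr h10]
      have henv' : x.Env (s.set 10 0 0 (2 ^ (x.n - r) - 1)) :=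
        (henv.of_eq (hf 0 (by decide))).of_eq (Store.set_other _ (by decide) _ _ _)
      have hval : Expr.eval (s.set 10 0 0 (2 ^ (x.n - r) - 1))
          (.add (.var 11) (.pos (.sub .eN (.var 10)))) = (min (x.n - r) (Nat.log 2 x.n) : ℕ) := by
        have h1 : ipos ((x.n : ℤ) - (2 ^ (x.n - r) - 1)) = if x.n - r ≤ Nat.log 2 x.n then 1 else 0 := by
          unfold ipos
          have h2 : x.n - r ≤ Nat.log 2 x.n ↔ 2 ^ (x.n - r) ≤ x.n :=
            Nat.le_log_iff_pow_le (by norm_num) (by omega)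
          have h3 : (0 < (x.n : ℤ) - (2 ^ (x.n - r) - 1)) ↔ 2 ^ (x.n - r) ≤ x.n := by
            zify; constructor <;> intro h <;> linarith
          simp only [h2, h3]
        simp only [Expr.eval, Expr.eval_var, Expr.eval_pos, eval_eN henv', Store.set_same,
          Store.set_other _ (by decide : 11 ≠ 10), h1, h11]
        split_ifs with h
        · rw [min_eq_left (by omega), min_eq_left h]; omega
        · rw [min_eq_right (by omega), min_eq_right (by omega)]; omega
      rw [hval]
      refine ⟨int_abs_le_two_pow (b := x.n) ?_ (size_bounds henv.1).1, ?_, ?_⟩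
      · rw [abs_of_nonneg (by positivity)]
        have : min (x.n - r) (Nat.log 2 x.n) ≤ x.n := (min_le_left _ _).trans (Nat.sub_le _ _)
        exact_mod_cast this
      · rw [Store.set_other _ (by decide), Store.set_same]
      · exact Store.set_same _ _ _ _ _
  · intro x s s' hx h
    rw [h.2, Nat.sub_zero, min_eq_right ((Nat.log_lt_self 2 (by have := hx.1.1.1; omega)).le)]

/-- The value that the iteration would return if the semidefinite program had value one. -/
def Inst.unit (x : Inst) : ℤ := x.data.U * (x.data.q * x.m) * sdpSteps x.n x.m

def Inst.excess (x : Inst) : ℤ := (x.data.iter (sdpSteps x.n x.m)).2.2 - x.unit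

def Inst.Rejects (x : Inst) : Prop :=
  0 < x.excess ∧ 800 * (x.k : ℤ) ^ 2 * (Nat.log 2 x.n : ℕ) * x.unit ^ 2 < x.excess ^ 2 * x.m

open PlantedRFCW.Expr in
def unitE : Expr := mul (mul eU (mul eq eM)) eT

open PlantedRFCW.Expr in
def outCmd : Cmd := .write 0 (const 0) (const 0) (mul (pos (sub (var 7) unitE))
  (pos (sub (mul (pow (sub (var 7) unitE) 2) eM)
    (mul (mul (mul (const 800) (pow eK 2)) (var 11)) (pow unitE 2)))))

theorem outCmd_spec : Spec Inst.size bitPoly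
    (fun x s => x.Env s ∧ s 7 0 0 = (x.data.iter (sdpSteps x.n x.m)).2.2 ∧
      s 11 0 0 = (Nat.log 2 x.n : ℕ)) outCmd (fun x _ s' => 0 < s' 0 0 0 ↔ x.Rejects) := by
  refine Spec.write ?_
  rintro x s ⟨henv, h7, h11⟩
  have hu : unitE.eval s = x.unit := by
    simp only [unitE, Expr.eval, eval_eU henv, eval_eq henv, eval_eM henv, eval_eT henv]
    rfl
  have hval : Expr.eval s (.mul (.pos (.sub (.var 7) unitE))
      (.pos (.sub (.mul (.pow (.sub (.var 7) unitE) 2) .eM)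
      (.mul (.mul (.mul (.const 800) (.pow .eK 2)) (.var 11)) (.pow unitE 2)))))
      = ipos x.excess * ipos (x.excess ^ 2 * x.m
        - 800 * (x.k : ℤ) ^ 2 * (Nat.log 2 x.n : ℕ) * x.unit ^ 2) := by
    simp only [Expr.eval, Expr.eval_pos, Expr.eval_pow, Expr.eval_var, hu, h7, h11, eval_eM henv,
      eval_eK henv]
    rfl
  rw [hval]
  constructor
  · refine int_abs_le_two_pow (b := 1) ?_ ((by have := henv.1.1; omega : 1 ≤ x.n).trans
      (size_bounds henv.1).1)
    rw [abs_of_nonneg (mul_nonneg (ipos_nonneg _) (ipos_nonneg _))]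
    exact_mod_cast mul_le_one₀ (ipos_le_one _) (ipos_nonneg _) (ipos_le_one _)
  · have : ∀ z : ℤ, Store.set s 0 (Expr.eval s (.const 0)) (Expr.eval s (.const 0)) z 0 0 0 = z :=
      fun z => Store.set_same _ _ _ _ _
    rw [this]
    unfold ipos Inst.Rejects
    split_ifs <;> simp_all

/-- The program that decides the test. -/
def sdpProgram : Cmd :=
  .seq gramCmd (.seq (forCmd 23 Expr.eT stepCmd) (.seq (forCmd 20 Expr.eN logBody) outCmd))

theorem sdpProgram_spec : Spec Inst.size bitPoly
    (fun x s => x.Env s ∧ (∀ l i : ℕ, s 1 l i = x.xs l i) ∧ ∀ a, 2 ≤ a → ∀ i j, s a i j = 0)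
    sdpProgram (fun x _ s' => 0 < s' 0 0 0 ↔ x.Rejects) := by
  have w1 : gramCmd.writes = {20, 21, 22, 2} := rfl
  have w2 : (forCmd 23 Expr.eT stepCmd).writes = {23, 20, 21, 24, 22, 4, 6, 7, 9, 3, 8} := by decide
  have w3 : (forCmd 20 Expr.eN logBody).writes = {20, 10, 11} := by decide
  refine Spec.seq_of (P₂ := fun x s => IterState x 0 s ∧ s 10 0 0 = 0 ∧ s 11 0 0 = 0)
    (gramCmd_spec.mono (fun x s h => ⟨h.1, h.2.1, h.2.2 2 le_rfl⟩) fun _ _ _ _ h => h)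
    (Spec.seq_of (P₂ := fun x s => x.Env s ∧ s 7 0 0 = (x.data.iter (sdpSteps x.n x.m)).2.2 ∧
      s 10 0 0 = 0 ∧ s 11 0 0 = 0) (iterCmd_spec.mono (fun x s h => h.1) fun _ _ _ _ h => h)
    (Spec.seq_of (logCmd_spec.mono (fun x s h => ⟨h.1, h.2.2⟩) fun _ _ _ _ h => h) outCmd_spec ?_)
    ?_) ?_
  · rintro x s s' h hL hf
    rw [w3] at hf
    exact ⟨h.1.of_eq (hf 0 (by decide)), by rw [hf 7 (by decide)]; exact h.2.1, hL⟩
  · rintro x s s' ⟨-, h10, h11⟩ hI hf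
    rw [w2] at hf
    exact ⟨hI.1, hI.2.2.2.2.1, by rw [hf 10 (by decide), h10], by rw [hf 11 (by decide), h11]⟩
  · rintro x s s' ⟨henv, h1, h2⟩ hG hf
    rw [w1] at hf
    have hz : ∀ a, 3 ≤ a → a < 20 → ∀ i j, s' a i j = 0 := fun a ha ha' i j => by
      rw [hf a (by simp; omega), h2 a (by omega)]
    refine ⟨⟨henv.of_eq (hf 0 (by decide)), hG, fun i _ j _ => ?_, ?_, ?_, ?_⟩, ?_, ?_⟩ <;>
    exact hz _ (by norm_num) (by norm_num) _ _

/-- The testing problem that is given by a sample. -/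
def Inst.ofSample {n m : ℕ} (k : ℕ) (x : Sample n m) : Inst where
  n := n
  m := m
  k := k
  xs l i := if h : l < m ∧ i < n then spin (x ⟨l, h.1⟩ ⟨i, h.2⟩) else 0

/-- The test that the program decides. -/
def programTest : Test := fun _ _ k x => (Inst.ofSample k x).Rejects

theorem abs_spin (b : Bool) : |spin b| = 1 := by cases b <;> simp [spin]

theorem Inst.ofSample_valid {n m k : ℕ} (x : Sample n m) (hn : 2 ≤ n) (hm : 1 ≤ m) (hk : 1 ≤ k)
    (hkn : k ≤ n) : (Inst.ofSample k x).Valid := by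
  refine ⟨hn, hm, hk, hkn, fun l i => ?_⟩
  simp only [Inst.ofSample]
  split_ifs
  · exact (abs_spin _).le
  · simp

theorem polynomialTime_programTest : PolynomialTime programTest := by
  obtain ⟨p, hp⟩ := sdpProgram_spec
  refine ⟨sdpProgram, p, fun n m k x hn hm hk hkn => ?_⟩
  have hv := Inst.ofSample_valid x hn hm hk hkn
  have hb := size_bounds hv
  have hone : (1 : ℤ) ≤ 2 ^ (bitPoly.eval (Inst.ofSample k x).size) := one_le_pow₀ (by norm_num)
  suffices h : Bounded (bitPoly.eval (Inst.ofSample k x).size) (inputStore k x) ∧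
      (Inst.ofSample k x).Env (inputStore k x) ∧
      (∀ l i : ℕ, inputStore k x 1 l i = (Inst.ofSample k x).xs l i) ∧
      ∀ a, 2 ≤ a → ∀ i j, inputStore k x a i j = 0 by
    obtain ⟨s', t, h1, h2, -, h3⟩ := hp (Inst.ofSample k x) (inputStore k x) h.1 h.2
    exact ⟨s', t, h1, h2, h3⟩
  constructor
  · intro a l i
    unfold inputStore
    have e1 : |(n : ℤ)| ≤ 2 ^ (bitPoly.eval (Inst.ofSample k x).size) :=
      int_abs_le_two_pow (b := n) (by simp) hb.1
    have e2 : |(m : ℤ)| ≤ 2 ^ (bitPoly.eval (Inst.ofSample k x).size) :=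
      int_abs_le_two_pow (b := m) (by simp) hb.2.1
    have e3 : |(k : ℤ)| ≤ 2 ^ (bitPoly.eval (Inst.ofSample k x).size) :=
      int_abs_le_two_pow (b := k) (by simp) (hkn.trans hb.1)
    have e0 : |(0 : ℤ)| ≤ 2 ^ (bitPoly.eval (Inst.ofSample k x).size) := by simp
    split_ifs
    · exact e1
    · exact e2
    · exact e3
    · exact e0
    · exact e0
    · rw [abs_spin]; exact hone
    · exact e0
    · exact e0
  · refine ⟨⟨hv, rfl, rfl, rfl⟩, fun l i => ?_, fun a ha i j => ?_⟩
    · simp [inputStore, Inst.ofSample]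
    · simp only [inputStore]
      rw [if_neg (by omega), if_neg (by omega)]

theorem threshold_low {e m k w r s D : ℝ} (he : 0 < e) (hm : 0 < m) (hk : 1 ≤ k) (hw : 0 < w)
    (hwm : 1 ≤ w * m) (hrw : r ≤ 1.178 * w) (hD : 0 < D) (h : D ≤ e * (m * (s - 1) + 3))
    (hs : s - 1 ≤ 20 * k * r) : D ^ 2 * m ≤ 800 * ((e * m * k * w) ^ 2 * m) := by
  have h1 : m * (s - 1) + 3 ≤ 26.6 * (m * k * w) := by
    have a1 : m * (s - 1) ≤ m * (20 * k * (1.178 * w)) :=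
      mul_le_mul_of_nonneg_left (hs.trans (by gcongr)) hm.le
    have a2 : 1 * (w * m) ≤ k * (w * m) := mul_le_mul_of_nonneg_right hk (by positivity)
    have a3 : 0 ≤ k * (w * m) := by positivity
    have a4 : m * (20 * k * (1.178 * w)) = 23.56 * (k * (w * m)) := by ring
    have a5 : 26.6 * (m * k * w) = 26.6 * (k * (w * m)) := by ring
    rw [a4] at a1
    rw [a5]
    linarith
  have h2 : D ≤ 26.6 * (e * m * k * w) := by
    refine h.trans ?_
    calc e * (m * (s - 1) + 3) ≤ e * (26.6 * (m * k * w)) := by gcongr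
      _ = _ := by ring
  have h3 : D ^ 2 ≤ (26.6 * (e * m * k * w)) ^ 2 := by gcongr
  have h4 := mul_le_mul_of_nonneg_right h3 hm.le
  have h5 : 0 < (e * m * k * w) ^ 2 * m := by positivity
  rw [mul_pow, mul_assoc] at h4
  linarith

theorem threshold_high {e m k w r s D : ℝ} (he : 0 < e) (hm : 0 < m) (hk : 1 ≤ k) (hw : 0 < w)
    (hwm : 1 ≤ w * m) (hwr : 0.832 * w ≤ r) (h : e * (m * (s - 1) - 2) ≤ D)
    (hs : 40 * k * r ≤ s - 1) : 0 < D ∧ 800 * ((e * m * k * w) ^ 2 * m) < D ^ 2 * m := by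
  have h1 : 30 * (m * k * w) ≤ m * (s - 1) - 2 := by
    have a1 : m * (40 * k * (0.832 * w)) ≤ m * (s - 1) :=
      mul_le_mul_of_nonneg_left (le_trans (by gcongr) hs) hm.le
    have a2 : 1 * (w * m) ≤ k * (w * m) := mul_le_mul_of_nonneg_right hk (by positivity)
    have a3 : 0 ≤ k * (w * m) := by positivity
    have a4 : m * (40 * k * (0.832 * w)) = 33.28 * (k * (w * m)) := by ring
    have a5 : 30 * (m * k * w) = 30 * (k * (w * m)) := by ring
    rw [a4] at a1
    rw [a5]
    linarith
  have h2 : 30 * (e * m * k * w) ≤ D := by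
    refine le_trans ?_ h
    calc _ = e * (30 * (m * k * w)) := by ring
      _ ≤ _ := by gcongr
  have h0 : 0 < e * m * k * w := by positivity
  have h3 : (30 * (e * m * k * w)) ^ 2 ≤ D ^ 2 := by gcongr
  have h4 := mul_le_mul_of_nonneg_right h3 hm.le
  have h5 : 0 < (e * m * k * w) ^ 2 * m := by positivity
  rw [mul_pow, mul_assoc] at h4
  exact ⟨by linarith, by linarith⟩

theorem thresholdsSDP_programTest : ThresholdsSDP 20 programTest := by
  intro n m k x hn hm hk hkn
  set I := Inst.ofSample k x with hI
  have hv : I.Valid := Inst.ofSample_valid x hn hm hk hkn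
  have hn0 : (0 : ℝ) < n := by exact_mod_cast (by omega : 0 < n)
  have hm0 : (0 : ℝ) < m := by exact_mod_cast hm
  have hk1 : (1 : ℝ) ≤ k := by exact_mod_cast hk
  have hm1 : (1 : ℝ) ≤ m := by exact_mod_cast hm
  have hG : (Matrix.of fun i j : Fin n => (I.gram i j : ℝ) / m) = empCov x := by
    ext i j
    simp only [Matrix.of_apply, empCov, Inst.gram, hI, Inst.ofSample]
    push_cast
    rw [Finset.sum_range]
    congr 1
    refine Finset.sum_congr rfl fun l _ => ?_
    simp
  set s := sdp k (empCov x) with hs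
  set T := sdpSteps n m with hT
  set S := (I.data.iter T).2.2 with hS
  have hup : (T : ℝ) * (I.data.U * (I.data.q * m) * s) ≤ S + T * (2 * (I.data.U * I.data.q)) := by
    have := sdp_le_iter (n := n) (m := m) (k := k) (G := I.gram) hk hkn hm
      (fun i j => I.gram_symm i j) (fun i j => Inst.abs_gram_le hv i j) T le_rfl
    rw [hG] at this
    exact this
  have hlo : (S : ℝ) ≤ T * (I.data.U * (I.data.q * m) * s) + T * (3 * (I.data.U * I.data.q)) := by
    have := iter_le_sdp (n := n) (m := m) (k := k) (G := I.gram) hk hkn hm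
      (fun i j => I.gram_symm i j) (fun i j => Inst.abs_gram_le hv i j)
    rw [hG] at this
    exact this
  set L := Nat.log 2 n with hL
  have hL1 : 1 ≤ L := Nat.log_pos (by norm_num) hn
  have hL1' : (1 : ℝ) ≤ L := by exact_mod_cast hL1
  have hlog1 : L * Real.log 2 ≤ Real.log n := by
    rw [← Real.log_pow]
    exact Real.log_le_log (by positivity) (by exact_mod_cast Nat.pow_log_le_self 2 (by omega))
  have hlog2 : Real.log n ≤ 2 * L * Real.log 2 := by
    calc Real.log n ≤ Real.log (2 ^ (L + 1)) :=
          Real.log_le_log hn0 (by exact_mod_cast (Nat.lt_pow_succ_log_self (by norm_num) n).le)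
      _ = (L + 1) * Real.log 2 := by rw [Real.log_pow]; push_cast; ring
      _ ≤ _ := by
        have := Real.log_pos (by norm_num : (1 : ℝ) < 2)
        nlinarith
  set w := √((L : ℝ) / m) with hw
  set r := √(Real.log n / m) with hr
  have hw0 : 0 ≤ w := Real.sqrt_nonneg _
  have hr0 : 0 ≤ r := Real.sqrt_nonneg _
  have hw2 : w ^ 2 * m = L := by rw [hw, Real.sq_sqrt (by positivity)]; field_simp
  have hr2 : r ^ 2 * m = Real.log n := by
    rw [hr, Real.sq_sqrt (div_nonneg (Real.log_natCast_nonneg n) hm0.le)]; field_simp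
  have hwm : 1 ≤ w * m := by
    have : 1 ≤ (w * m) ^ 2 := by
      rw [mul_pow, sq (m : ℝ), ← mul_assoc, hw2]; nlinarith
    nlinarith [mul_nonneg hw0 hm0.le]
  have hrw : r ≤ 1.178 * w := by
    have : r ^ 2 ≤ (1.178 * w) ^ 2 := by
      have h1 : r ^ 2 * m ≤ (1.178 * w) ^ 2 * m := by
        rw [hr2, mul_pow, mul_assoc, hw2]
        nlinarith [Real.log_two_lt_d9]
      exact le_of_mul_le_mul_right h1 hm0
    exact abs_le_of_sq_le_sq' this (by positivity) |>.2
  have hwr : 0.832 * w ≤ r := by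
    have : (0.832 * w) ^ 2 ≤ r ^ 2 := by
      have h1 : (0.832 * w) ^ 2 * m ≤ r ^ 2 * m := by
        rw [hr2, mul_pow, mul_assoc, hw2]
        nlinarith [Real.log_two_gt_d9]
      exact le_of_mul_le_mul_right h1 hm0
    exact abs_le_of_sq_le_sq' this hr0 |>.2
  set e : ℝ := I.data.U * I.data.q * T with he
  have he0 : 0 < e := by
    have hn' : 0 < n := by omega
    have h1 : 0 < I.data.U := by
      simp only [Inst.data, sdpData, hI, Inst.ofSample]; positivity
    have h2 : 0 < I.data.q := by
      simp only [Inst.data, sdpData, hI, Inst.ofSample]; positivity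
    have h3 : 0 < T := by simp only [hT, sdpSteps]; positivity
    rw [he]; positivity
  have hunit : (I.unit : ℝ) = e * m := by
    simp only [Inst.unit]; push_cast
    have h1 : (I.m : ℝ) = m := rfl
    have h2 : (sdpSteps I.n I.m : ℝ) = T := rfl
    rw [h1, h2, he]; ring
  have hexc : (I.excess : ℝ) = S - e * m := by
    rw [← hunit]; simp only [Inst.excess]; push_cast; rfl
  have hD1 : (I.excess : ℝ) ≤ e * (m * (s - 1) + 3) := by
    rw [hexc, he]; linarith
  have hD2 : e * (m * (s - 1) - 2) ≤ I.excess := by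
    rw [hexc, he]; linarith
  have hrej : I.Rejects ↔ 0 < (I.excess : ℝ) ∧
      800 * ((e * m * k * w) ^ 2 * m) < (I.excess : ℝ) ^ 2 * m := by
    have h1 : (800 * (k : ℝ) ^ 2 * L * (I.unit : ℝ) ^ 2) = 800 * ((e * m * k * w) ^ 2 * m) := by
      rw [hunit, ← hw2]; ring
    rw [← h1]
    have h2 : (I.Rejects ↔ 0 < I.excess ∧ 800 * (k : ℤ) ^ 2 * (L : ℕ) * I.unit ^ 2
      < I.excess ^ 2 * m) := Iff.rfl
    rw [h2]
    exact_mod_cast Iff.rfl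
  have hthr : ∀ C, threshold C n m k = 1 + C * k * r := fun _ => rfl
  have hw1 : 0 < w := by rw [hw]; positivity
  constructor
  · intro hle hψ
    obtain ⟨h1, h2⟩ := hrej.mp hψ
    exact (threshold_low he0 hm0 hk1 hw1 hwm hrw h1 hD1 (by rw [hthr] at hle; linarith)).not_gt h2
  · intro hle
    exact hrej.mpr (threshold_high he0 hm0 hk1 hw1 hwm hwr hD2 (by rw [hthr] at hle; linarith))


/-! ### Averages over independent spins in a fixed field -/

/-- The probability of a spin in the field `h`. -/
noncomputable def siteProb (h : ℝ) (b : Bool) : ℝ := Real.exp (h * spin b) / (2 * Real.cosh h)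

theorem siteProb_pos (h : ℝ) (b : Bool) : 0 < siteProb h b :=
  div_pos (Real.exp_pos _) (mul_pos two_pos (Real.cosh_pos _))

theorem siteProb_true (h : ℝ) : siteProb h true = (1 + Real.tanh h) / 2 := by
  have := (Real.cosh_pos h).ne'
  simp only [siteProb, spin, if_true, Int.cast_one, mul_one]
  rw [Real.tanh_eq_sinh_div_cosh, ← Real.cosh_add_sinh]
  field_simp

theorem siteProb_false (h : ℝ) : siteProb h false = (1 - Real.tanh h) / 2 := by
  have := (Real.cosh_pos h).ne'
  simp only [siteProb, spin, Bool.false_eq_true, if_false, Int.cast_neg, Int.cast_one, mul_neg,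
    mul_one]
  rw [Real.tanh_eq_sinh_div_cosh, ← Real.cosh_sub_sinh]
  field_simp

variable {n : ℕ}

/-- The average over independent spins in the field `h`. -/
noncomputable def avg (h : Fin n → ℝ) (F : Config n → ℝ) : ℝ :=
  ∑ σ, (∏ i, siteProb (h i) (σ i)) * F σ

/-- The total spin of `S`. -/
def mag (S : Finset (Fin n)) (σ : Config n) : ℝ := ∑ i ∈ S, (spin (σ i) : ℝ)

section avg

variable (h : Fin n → ℝ) {F G : Config n → ℝ}

theorem avg_add (F G : Config n → ℝ) : avg h (fun σ => F σ + G σ) = avg h F + avg h G := by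
  simp only [avg, mul_add, Finset.sum_add_distrib]

theorem avg_sub (F G : Config n → ℝ) : avg h (fun σ => F σ - G σ) = avg h F - avg h G := by
  simp only [avg, mul_sub, Finset.sum_sub_distrib]

theorem avg_const_mul (c : ℝ) (F : Config n → ℝ) : avg h (fun σ => c * F σ) = c * avg h F := by
  simp only [avg, Finset.mul_sum]
  exact Finset.sum_congr rfl fun _ _ => by ring

theorem avg_sum {ι : Type*} (s : Finset ι) (F : ι → Config n → ℝ) :
    avg h (fun σ => ∑ a ∈ s, F a σ) = ∑ a ∈ s, avg h (F a) := by
  simp only [avg, Finset.mul_sum]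
  exact Finset.sum_comm

theorem avg_mono (hFG : ∀ σ, F σ ≤ G σ) : avg h F ≤ avg h G :=
  Finset.sum_le_sum fun σ _ => mul_le_mul_of_nonneg_left (hFG σ)
    (Finset.prod_nonneg fun _ _ => (siteProb_pos _ _).le)

theorem avg_const (c : ℝ) : avg h (fun _ => c) = c := by
  have h1 : ∀ i, ∑ b : Bool, siteProb (h i) b = 1 := fun _ => by
    rw [Fintype.sum_bool, siteProb_true, siteProb_false]; ring
  have h2 := Finset.prod_univ_sum (fun _ : Fin n => (Finset.univ : Finset Bool))
    (fun i b => siteProb (h i) b)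
  rw [Finset.prod_congr rfl fun i _ => h1 i, Finset.prod_const_one, Fintype.piFinset_univ] at h2
  rw [avg, ← Finset.sum_mul, ← h2, one_mul]

/-- Averaging over the spin at `j` first. -/
theorem avg_update (j : Fin n) (F : Config n → ℝ) :
    avg h F = avg h fun σ => siteProb (h j) true * F (Function.update σ j true)
      + siteProb (h j) false * F (Function.update σ j false) := by
  have hp : siteProb (h j) true + siteProb (h j) false = 1 := by
    rw [siteProb_true, siteProb_false]; ring
  have hinv : Function.Involutive fun σ : Config n => Function.update σ j (!σ j) := by
    intro σ; simp
  have hflip : ∀ G : Config n → ℝ, ∑ σ, G σ = ∑ σ, G (Function.update σ j (!σ j)) := fun G =>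
    (Equiv.sum_comp hinv.toPerm G).symm
  have hprod : ∀ σ : Config n, ∏ i, siteProb (h i) (σ i)
      = siteProb (h j) (σ j) * ∏ i ∈ Finset.univ.erase j, siteProb (h i) (σ i) := fun σ =>
    (Finset.mul_prod_erase _ _ (Finset.mem_univ j)).symm
  have hrest : ∀ (σ : Config n) b, ∏ i ∈ Finset.univ.erase j,
      siteProb (h i) (Function.update σ j b i)
      = ∏ i ∈ Finset.univ.erase j, siteProb (h i) (σ i) := fun σ b =>
    Finset.prod_congr rfl fun i hi => by rw [Function.update_of_ne (Finset.ne_of_mem_erase hi)]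
  have key : ∀ G : Config n → ℝ, 2 * ∑ σ, G σ = ∑ σ, (G σ + G (Function.update σ j (!σ j))) := by
    intro G; rw [Finset.sum_add_distrib, ← hflip]; ring
  suffices 2 * avg h F = 2 * avg h fun σ => siteProb (h j) true * F (Function.update σ j true)
      + siteProb (h j) false * F (Function.update σ j false) by linarith
  rw [avg, avg, key, key]
  refine Finset.sum_congr rfl fun σ _ => ?_
  simp only [hprod, hrest, Function.update_self, Function.update_idem]
  set r := ∏ i ∈ Finset.univ.erase j, siteProb (h i) (σ i)
  rcases hb : σ j
  · have : Function.update σ j false = σ := by rw [← hb, Function.update_eq_self]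
    simp only [this, Bool.not_false]
    linear_combination (-r * (siteProb (h j) true * F (Function.update σ j true)
      + siteProb (h j) false * F σ)) * hp
  · have : Function.update σ j true = σ := by rw [← hb, Function.update_eq_self]
    simp only [this, Bool.not_true]
    linear_combination (-r * (siteProb (h j) true * F σ
      + siteProb (h j) false * F (Function.update σ j false))) * hp

theorem avg_mag_insert {S : Finset (Fin n)} {j : Fin n} (hj : j ∉ S) (f : ℝ → ℝ) :
    avg h (fun σ => f (mag (insert j S) σ)) = (1 + Real.tanh (h j)) / 2 * avg h (fun σ => f (mag S σ + 1))
      + (1 - Real.tanh (h j)) / 2 * avg h (fun σ => f (mag S σ - 1)) := by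
  have h1 : ∀ (σ : Config n) b, mag (insert j S) (Function.update σ j b) = mag S σ + (spin b : ℝ) := by
    intro σ b
    rw [mag, Finset.sum_insert hj, Function.update_self, add_comm, mag]
    congr 1
    refine Finset.sum_congr rfl fun i hi => ?_
    rw [Function.update_of_ne (by rintro rfl; exact hj hi)]
  rw [avg_update h j]
  simp only [h1]
  rw [avg_add, avg_const_mul, avg_const_mul, siteProb_true, siteProb_false]
  simp [spin, sub_eq_add_neg]

theorem mag_empty : mag (∅ : Finset (Fin n)) = fun _ => 0 := by
  funext σ; simp [mag]

theorem avg_mag (S : Finset (Fin n)) : avg h (mag S) = ∑ i ∈ S, Real.tanh (h i) := by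
  induction S using Finset.induction_on with
  | empty => rw [mag_empty, avg_const]; simp
  | insert j S hj ih =>
    have := avg_mag_insert h hj fun x => x
    simp only [avg_add, avg_sub, avg_const] at this
    rw [Finset.sum_insert hj, ← ih]
    linarith

theorem avg_mag_sq (S : Finset (Fin n)) : avg h (fun σ => mag S σ ^ 2)
    = (∑ i ∈ S, Real.tanh (h i)) ^ 2 + ∑ i ∈ S, (1 - Real.tanh (h i) ^ 2) := by
  induction S using Finset.induction_on with
  | empty => simp [mag_empty, avg_const]
  | insert j S hj ih =>
    rw [avg_mag_insert h hj fun x => x ^ 2, Finset.sum_insert hj, Finset.sum_insert hj]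
    have e1 : ∀ σ, (mag S σ + 1) ^ 2 = mag S σ ^ 2 + 2 * mag S σ + 1 := fun σ => by ring
    have e2 : ∀ σ, (mag S σ - 1) ^ 2 = mag S σ ^ 2 - 2 * mag S σ + 1 := fun σ => by ring
    simp only [e1, e2, avg_add, avg_sub, avg_const, avg_const_mul, ih]
    rw [avg_mag]
    ring

/-- The variance of a quadratic function of the total spin. -/
theorem le_variance_mag (S : Finset (Fin n)) : ∀ c : ℝ,
    2 * ((∑ i ∈ S, (1 - Real.tanh (h i) ^ 2)) ^ 2 - ∑ i ∈ S, (1 - Real.tanh (h i) ^ 2) ^ 2)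
      ≤ avg h (fun σ => (mag S σ ^ 2 + c * mag S σ) ^ 2)
        - avg h (fun σ => mag S σ ^ 2 + c * mag S σ) ^ 2 := by
  have hexp : ∀ (S : Finset (Fin n)) (c : ℝ), avg h (fun σ => (mag S σ ^ 2 + c * mag S σ) ^ 2)
        - avg h (fun σ => mag S σ ^ 2 + c * mag S σ) ^ 2
      = avg h (fun σ => mag S σ ^ 4) + 2 * c * avg h (fun σ => mag S σ ^ 3)
        + c ^ 2 * avg h (fun σ => mag S σ ^ 2)
        - (avg h (fun σ => mag S σ ^ 2) + c * avg h (fun σ => mag S σ)) ^ 2 := by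
    intro S c
    have e : ∀ σ, (mag S σ ^ 2 + c * mag S σ) ^ 2
        = mag S σ ^ 4 + 2 * c * mag S σ ^ 3 + c ^ 2 * mag S σ ^ 2 := fun σ => by ring
    simp only [e, avg_add, avg_const_mul]
  induction S using Finset.induction_on with
  | empty => intro c; simp [mag_empty, avg_const]
  | insert j S hj ih =>
    intro c
    have hs := ih (c + 2 * Real.tanh (h j))
    rw [hexp] at hs ⊢
    have e1 : ∀ σ, (mag S σ + 1) ^ 2 = mag S σ ^ 2 + 2 * mag S σ + 1 := fun σ => by ring
    have e2 : ∀ σ, (mag S σ - 1) ^ 2 = mag S σ ^ 2 - 2 * mag S σ + 1 := fun σ => by ring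
    have e3 : ∀ σ, (mag S σ + 1) ^ 3 = mag S σ ^ 3 + 3 * mag S σ ^ 2 + 3 * mag S σ + 1 :=
      fun σ => by ring
    have e4 : ∀ σ, (mag S σ - 1) ^ 3 = mag S σ ^ 3 - 3 * mag S σ ^ 2 + 3 * mag S σ - 1 :=
      fun σ => by ring
    have e5 : ∀ σ, (mag S σ + 1) ^ 4 = mag S σ ^ 4 + 4 * mag S σ ^ 3 + 6 * mag S σ ^ 2
      + 4 * mag S σ + 1 := fun σ => by ring
    have e6 : ∀ σ, (mag S σ - 1) ^ 4 = mag S σ ^ 4 - 4 * mag S σ ^ 3 + 6 * mag S σ ^ 2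
      - 4 * mag S σ + 1 := fun σ => by ring
    rw [avg_mag_insert h hj fun x => x, avg_mag_insert h hj fun x => x ^ 2,
      avg_mag_insert h hj fun x => x ^ 3, avg_mag_insert h hj fun x => x ^ 4,
      Finset.sum_insert hj, Finset.sum_insert hj]
    have hv := avg_mag_sq h S
    rw [← avg_mag h S] at hv
    simp only [e1, e2, e3, e4, e5, e6, avg_add, avg_sub, avg_const, avg_const_mul]
    have hm : avg h (fun σ => mag S σ) = avg h (mag S) := rfl
    rw [hm] at hs ⊢
    set a1 := avg h (mag S)
    set a2 := avg h (fun σ => mag S σ ^ 2)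
    set a3 := avg h (fun σ => mag S σ ^ 3)
    set a4 := avg h (fun σ => mag S σ ^ 4)
    set m := Real.tanh (h j)
    set Q := ∑ i ∈ S, (1 - Real.tanh (h i) ^ 2)
    have hm1 : 0 ≤ 1 - m ^ 2 := by
      have := Real.abs_tanh_lt_one (h j)
      have := (sq_lt_one_iff_abs_lt_one _).mpr this
      linarith
    have h3 := mul_nonneg hm1 (sq_nonneg (2 * a1 + c))
    clear_value a1 a2 a3 a4 m Q
    subst hv
    linarith

/-- The log-Laplace transform of the total spin. -/
noncomputable def logLaplace (S : Finset (Fin n)) (h : Fin n → ℝ) (u : ℝ) : ℝ :=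
  ∑ i ∈ S, (Real.log (Real.cosh (h i + u)) - Real.log (Real.cosh (h i)))

theorem avg_exp_mag (S : Finset (Fin n)) (u : ℝ) :
    avg h (fun σ => Real.exp (u * mag S σ)) = Real.exp (logLaplace S h u) := by
  induction S using Finset.induction_on with
  | empty => simp [mag_empty, avg_const, logLaplace]
  | insert j S hj ih =>
    rw [avg_mag_insert h hj fun x => Real.exp (u * x)]
    have e1 : ∀ σ, Real.exp (u * (mag S σ + 1)) = Real.exp u * Real.exp (u * mag S σ) := fun σ => by
      rw [← Real.exp_add]; ring_nf
    have e2 : ∀ σ, Real.exp (u * (mag S σ - 1)) = Real.exp (-u) * Real.exp (u * mag S σ) :=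
      fun σ => by rw [← Real.exp_add]; ring_nf
    simp only [e1, e2, avg_const_mul, ih]
    have e3 : logLaplace (insert j S) h u
        = Real.log (Real.cosh (h j + u)) - Real.log (Real.cosh (h j)) + logLaplace S h u :=
      Finset.sum_insert hj
    rw [e3, Real.exp_add, Real.exp_sub, Real.exp_log (Real.cosh_pos _),
      Real.exp_log (Real.cosh_pos _), Real.cosh_add, Real.tanh_eq_sinh_div_cosh,
      ← Real.cosh_add_sinh u, ← Real.cosh_sub_sinh u]
    have := (Real.cosh_pos (h j)).ne'
    field_simp
    ring

end avg

/-! ### Gibbs averages -/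

/-- The normalised square of the total spin. -/
noncomputable def energy (S : Finset (Fin n)) (σ : Config n) : ℝ := mag S σ ^ 2 / S.card

theorem energy_nonneg (S : Finset (Fin n)) (σ : Config n) : 0 ≤ energy S σ := by
  unfold energy; positivity

noncomputable def partition (θ : ℝ) (S : Finset (Fin n)) (h : Fin n → ℝ) : ℝ :=
  avg h fun σ => Real.exp (θ / 2 * energy S σ)

noncomputable def gibbsMean (θ : ℝ) (S : Finset (Fin n)) (h : Fin n → ℝ) (F : Config n → ℝ) : ℝ :=
  ∑ σ, gibbs θ S h σ * F σ

section gibbs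

variable {θ : ℝ} {S : Finset (Fin n)} {h : Fin n → ℝ}

theorem weight_eq (σ : Config n) : weight θ S h σ
    = (∏ i, (2 * Real.cosh (h i))) * ((∏ i, siteProb (h i) (σ i))
      * Real.exp (θ / 2 * energy S σ)) := by
  rw [weight, add_comm, Real.exp_add, Real.exp_sum, ← mul_assoc, ← Finset.prod_mul_distrib]
  congr 1
  · refine Finset.prod_congr rfl fun i _ => ?_
    have := (Real.cosh_pos (h i)).ne'
    rw [siteProb]; field_simp
  · congr 1
    rw [energy, mag]
    ring

theorem gibbsMean_eq (F : Config n → ℝ) : gibbsMean θ S h F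
    = avg h (fun σ => F σ * Real.exp (θ / 2 * energy S σ)) / partition θ S h := by
  have h0 : (∏ i, (2 * Real.cosh (h i))) ≠ 0 :=
    Finset.prod_ne_zero_iff.mpr fun i _ => (mul_pos two_pos (Real.cosh_pos _)).ne'
  have h1 : ∑ σ, weight θ S h σ = (∏ i, (2 * Real.cosh (h i))) * partition θ S h := by
    simp only [weight_eq, ← Finset.mul_sum, partition, avg]
  simp only [gibbsMean, gibbs, h1, div_mul_eq_mul_div, ← Finset.sum_div]
  rw [← mul_div_mul_left _ (partition θ S h) h0]
  congr 1
  rw [avg, Finset.mul_sum]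
  refine Finset.sum_congr rfl fun σ _ => ?_
  rw [weight_eq]; ring_nf

theorem one_le_partition (hθ : 0 ≤ θ) : 1 ≤ partition θ S h := by
  rw [← avg_const h 1]
  exact avg_mono h fun σ => Real.one_le_exp (mul_nonneg (by positivity) (energy_nonneg S σ))

theorem log_partition_le (hθ : 0 ≤ θ) :
    Real.log (partition θ S h) ≤ θ / 2 * gibbsMean θ S h (energy S) := by
  have hZ : 0 < partition θ S h := zero_lt_one.trans_le (one_le_partition hθ)
  rw [gibbsMean_eq, ← mul_div_assoc, le_div_iff₀ hZ, ← avg_const_mul]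
  have h1 : avg h (fun σ => Real.log (partition θ S h) * Real.exp (θ / 2 * energy S σ)
      + (Real.exp (θ / 2 * energy S σ) - partition θ S h))
      ≤ avg h (fun σ => θ / 2 * (energy S σ * Real.exp (θ / 2 * energy S σ))) := by
    refine avg_mono h fun σ => ?_
    set y := θ / 2 * energy S σ
    have h2 := Real.add_one_le_exp (Real.log (partition θ S h) - y)
    rw [Real.exp_sub, Real.exp_log hZ, le_div_iff₀ (Real.exp_pos y)] at h2
    have h3 : θ / 2 * (energy S σ * Real.exp y) = y * Real.exp y := by rw [← mul_assoc]
    rw [h3]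
    linarith
  rw [avg_add, avg_sub, avg_const, avg_const_mul] at h1
  have : avg h (fun σ => Real.exp (θ / 2 * energy S σ)) = partition θ S h := rfl
  rw [this] at h1
  linarith

theorem le_log_partition (hθ : 0 < θ) (hS : S.Nonempty) (u : ℝ) :
    logLaplace S h u - S.card * (u ^ 2 / (2 * θ)) ≤ Real.log (partition θ S h) := by
  have hk : (0 : ℝ) < S.card := by exact_mod_cast hS.card_pos
  rw [Real.le_log_iff_exp_le (zero_lt_one.trans_le (one_le_partition hθ.le)), sub_eq_add_neg,
    Real.exp_add, ← avg_exp_mag, mul_comm, ← avg_const_mul]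
  refine avg_mono h fun σ => ?_
  rw [← Real.exp_add, Real.exp_le_exp, energy]
  have : θ / 2 * (mag S σ ^ 2 / S.card) - (-(S.card * (u ^ 2 / (2 * θ))) + u * mag S σ)
      = (θ * mag S σ - S.card * u) ^ 2 / (2 * θ * S.card) := by
    field_simp; ring
  have h2 : 0 ≤ (θ * mag S σ - S.card * u) ^ 2 / (2 * θ * S.card) := by positivity
  linarith

theorem le_gibbsMean_energy (hθ : 0 ≤ θ) : avg h (energy S) + θ / 2 *
    ((avg h (fun σ => energy S σ ^ 2) - avg h (energy S) ^ 2) / partition θ S h)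
      ≤ gibbsMean θ S h (energy S) := by
  have hZ : 0 < partition θ S h := zero_lt_one.trans_le (one_le_partition hθ)
  rw [gibbsMean_eq, le_div_iff₀ hZ, add_mul, mul_assoc, div_mul_cancel₀ _ hZ.ne']
  set w := avg h (energy S) with hw
  have hw0 : 0 ≤ w := by
    rw [hw, ← avg_const h 0]
    exact avg_mono h fun σ => energy_nonneg S σ
  have hexp : ∀ a b : ℝ, 0 ≤ b → b ≤ a → a - b ≤ Real.exp a - Real.exp b := by
    intro a b hb hab
    have h1 := Real.add_one_le_exp (a - b)
    have h2 := Real.one_le_exp hb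
    have h3 : Real.exp a = Real.exp b * Real.exp (a - b) := by rw [← Real.exp_add]; ring_nf
    rw [h3]; nlinarith
  have h1 : avg h (fun σ => θ / 2 * (energy S σ ^ 2 - 2 * w * energy S σ + w ^ 2))
      ≤ avg h (fun σ => energy S σ * Real.exp (θ / 2 * energy S σ)
        - Real.exp (θ / 2 * w) * energy S σ - w * Real.exp (θ / 2 * energy S σ)
        + w * Real.exp (θ / 2 * w)) := by
    refine avg_mono h fun σ => ?_
    have hx := energy_nonneg S σ
    set x := energy S σ
    have ht : 0 ≤ θ / 2 := by positivity
    rcases le_total w x with hwx | hwx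
    · have := hexp _ _ (mul_nonneg ht hw0) (mul_le_mul_of_nonneg_left hwx ht)
      nlinarith [mul_le_mul_of_nonneg_left this (sub_nonneg.mpr hwx)]
    · have := hexp _ _ (mul_nonneg ht hx) (mul_le_mul_of_nonneg_left hwx ht)
      nlinarith [mul_le_mul_of_nonneg_left this (sub_nonneg.mpr hwx)]
  simp only [avg_const_mul, avg_add, avg_sub, avg_const] at h1
  have h2 : avg h (fun σ => energy S σ) = w := rfl
  have h3 : avg h (fun σ => Real.exp (θ / 2 * energy S σ)) = partition θ S h := rfl
  rw [h2, h3] at h1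
  linarith

/-- Chernoff bounds for the values of the total spin between `-N` and `N`. -/
theorem avg_small_mag_le (hS : S.Nonempty) (N : ℕ) :
    avg h (fun σ => if |mag S σ| ≤ N then Real.exp (θ / 2 * energy S σ) else 0)
      ≤ ∑ y ∈ Finset.Icc (-(N : ℤ)) N, Real.exp (logLaplace S h (θ * y / S.card)
        - S.card * ((θ * y / S.card) ^ 2 / (2 * θ))) := by
  have hk : (0 : ℝ) < S.card := by exact_mod_cast hS.card_pos
  have h1 : ∀ y : ℤ, Real.exp (logLaplace S h (θ * y / S.card)
        - S.card * ((θ * y / S.card) ^ 2 / (2 * θ)))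
      = avg h (fun σ => Real.exp (-(θ * y ^ 2 / (2 * S.card))) *
        Real.exp (θ * y / S.card * mag S σ)) := by
    intro y
    rw [avg_const_mul, avg_exp_mag, ← Real.exp_add]
    congr 1
    rcases eq_or_ne θ 0 with rfl | hθ
    · simp
    · field_simp; ring
  simp only [h1]
  rw [← avg_sum]
  refine avg_mono h fun σ => ?_
  split_ifs with hσ
  · set y : ℤ := ∑ i ∈ S, spin (σ i) with hy
    have hmag : mag S σ = y := by rw [hy, mag]; push_cast; rfl
    have hmem : y ∈ Finset.Icc (-(N : ℤ)) N := by
      rw [hmag, abs_le] at hσ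
      rw [Finset.mem_Icc]
      exact ⟨by exact_mod_cast hσ.1, by exact_mod_cast hσ.2⟩
    refine le_trans (le_of_eq ?_) (Finset.single_le_sum (f := fun y : ℤ =>
      Real.exp (-(θ * y ^ 2 / (2 * S.card))) * Real.exp (θ * y / S.card * mag S σ))
      (fun _ _ => by positivity) hmem)
    rw [← Real.exp_add, energy, hmag]
    congr 1
    field_simp; ring
  · exact Finset.sum_nonneg fun _ _ => by positivity

end gibbs


/-! ### Independent fields -/

/-- The law of `n` independent fields. -/
noncomputable abbrev fieldLaw (n : ℕ) (μ : Measure ℝ) : Measure (Fin n → ℝ) :=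
  Measure.pi fun _ : Fin n => μ

/-- The sum of `f (h i)` over the sites of `S`. -/
noncomputable def siteSum {n : ℕ} (f : ℝ → ℝ) (S : Finset (Fin n)) (h : Fin n → ℝ) : ℝ := ∑ i ∈ S, f (h i)

theorem integrable_of_abs_le {α : Type*} [MeasurableSpace α] {μ : Measure α} [IsFiniteMeasure μ]
    {f : α → ℝ} (hf : Measurable f) {B : ℝ} (hB : ∀ x, |f x| ≤ B) : Integrable f μ :=
  Integrable.of_bound hf.aestronglyMeasurable B (Eventually.of_forall hB)

section sums

variable {n : ℕ} {μ : Measure ℝ} [IsProbabilityMeasure μ] {f : ℝ → ℝ} {B : ℝ}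

theorem measurable_siteSum (hf : Measurable f) (S : Finset (Fin n)) : Measurable (siteSum f S) :=
  Finset.measurable_fun_sum _ fun i _ => hf.comp (measurable_pi_apply i)

theorem abs_siteSum_le (hB : ∀ x, |f x| ≤ B) (S : Finset (Fin n)) (h : Fin n → ℝ) :
    |siteSum f S h| ≤ S.card * B := by
  refine (Finset.abs_sum_le_sum_abs _ _).trans ((Finset.sum_le_sum fun i _ => hB (h i)).trans ?_)
  rw [Finset.sum_const, nsmul_eq_mul]

theorem abs_siteSum_pow_le (hB : ∀ x, |f x| ≤ B) (S : Finset (Fin n)) (p : ℕ) (h : Fin n → ℝ) :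
    |siteSum f S h ^ p| ≤ (S.card * B) ^ p := by
  rw [abs_pow]
  exact pow_le_pow_left₀ (abs_nonneg _) (abs_siteSum_le hB S h) p

theorem integrable_siteSum_pow (hf : Measurable f) (hB : ∀ x, |f x| ≤ B) (S : Finset (Fin n))
    (p : ℕ) : Integrable (fun h => siteSum f S h ^ p) (fieldLaw n μ) :=
  integrable_of_abs_le ((measurable_siteSum hf S).pow_const p) (abs_siteSum_pow_le hB S p)

theorem integral_siteSum (hf : Measurable f) (hB : ∀ x, |f x| ≤ B) (S : Finset (Fin n)) :
    ∫ h, siteSum f S h ∂(fieldLaw n μ) = S.card * ∫ x, f x ∂μ := by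
  simp only [siteSum]
  rw [integral_finsetSum _ fun i _ => integrable_comp_eval (μ := fun _ : Fin n => μ) (i := i)
      (integrable_of_abs_le hf hB),
    Finset.sum_congr rfl fun i _ => integral_comp_eval (μ := fun _ : Fin n => μ) (i := i)
      hf.aestronglyMeasurable]
  simp

theorem integral_pow_mul_siteSum_pow (hf : Measurable f) {S : Finset (Fin n)} {j : Fin n}
    (hj : j ∉ S) (p q : ℕ) :
    ∫ h, f (h j) ^ p * siteSum f S h ^ q ∂(fieldLaw n μ)
      = (∫ x, f x ^ p ∂μ) * ∫ h, siteSum f S h ^ q ∂(fieldLaw n μ) := by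
  have h1 : ProbabilityTheory.iIndepFun (fun (i : Fin n) (h : Fin n → ℝ) => f (h i)) (fieldLaw n μ) :=
    ProbabilityTheory.iIndepFun_pi (μ := fun _ : Fin n => μ) (X := fun _ => f)
      fun _ => hf.aemeasurable
  have h2 := (h1.indepFun_finsetSum_of_notMem (fun i => hf.comp (measurable_pi_apply i)) hj).symm
  have h3 := h2.comp (φ := fun x => x ^ p) (ψ := fun x => x ^ q) (measurable_id.pow_const p)
    (measurable_id.pow_const q)
  have h4 := h3.integral_fun_mul_eq_mul_integral
    (((hf.comp (measurable_pi_apply j)).pow_const p).aestronglyMeasurable)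
    ((Measurable.pow_const (by
      have := measurable_siteSum hf S
      convert this using 1
      funext h; simp [siteSum]) q).aestronglyMeasurable)
  simp only [Function.comp_apply, Finset.sum_apply] at h4
  rw [show (fun h => f (h j) ^ p * siteSum f S h ^ q)
    = fun h => f (h j) ^ p * (∑ i ∈ S, f (h i)) ^ q from rfl, h4]
  congr 1
  exact integral_comp_eval (μ := fun _ : Fin n => μ) (i := j) (f := fun x => f x ^ p)
    (hf.pow_const p).aestronglyMeasurable

theorem siteSum_insert {S : Finset (Fin n)} {j : Fin n} (hj : j ∉ S) (h : Fin n → ℝ) :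
    siteSum f (insert j S) h = f (h j) + siteSum f S h := Finset.sum_insert hj

theorem integrable_pow_mul_siteSum_pow (hf : Measurable f) (hB : ∀ x, |f x| ≤ B)
    (S : Finset (Fin n)) (j : Fin n) (p q : ℕ) :
    Integrable (fun h => f (h j) ^ p * siteSum f S h ^ q) (fieldLaw n μ) := by
  refine integrable_of_abs_le (B := B ^ p * (S.card * B) ^ q)
    (((hf.comp (measurable_pi_apply j)).pow_const p).mul
    ((measurable_siteSum hf S).pow_const q)) fun h => ?_
  rw [abs_mul, abs_pow]
  exact mul_le_mul (pow_le_pow_left₀ (abs_nonneg _) (hB _) p) (abs_siteSum_pow_le hB S q h)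
    (abs_nonneg _) (pow_nonneg ((abs_nonneg _).trans (hB 0)) p)

theorem integral_siteSum_insert_pow (hf : Measurable f) (hB : ∀ x, |f x| ≤ B)
    {S : Finset (Fin n)} {j : Fin n} (hj : j ∉ S) (p : ℕ) :
    ∫ h, siteSum f (insert j S) h ^ p ∂(fieldLaw n μ) = ∑ q ∈ Finset.range (p + 1),
      (∫ x, f x ^ q ∂μ) * (∫ h, siteSum f S h ^ (p - q) ∂(fieldLaw n μ)) * p.choose q := by
  have e : ∀ h : Fin n → ℝ, siteSum f (insert j S) h ^ p = ∑ q ∈ Finset.range (p + 1),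
      f (h j) ^ q * siteSum f S h ^ (p - q) * p.choose q := fun h => by
    rw [siteSum_insert hj, add_pow]
  simp only [e]
  rw [integral_finsetSum _ fun q _ =>
    (integrable_pow_mul_siteSum_pow (μ := μ) hf hB S j q (p - q)).mul_const _]
  refine Finset.sum_congr rfl fun q _ => ?_
  rw [integral_mul_const, integral_pow_mul_siteSum_pow hf hj]

theorem integral_siteSum_sq (hf : Measurable f) (hB : ∀ x, |f x| ≤ B) (h0 : ∫ x, f x ∂μ = 0)
    (S : Finset (Fin n)) :
    ∫ h, siteSum f S h ^ 2 ∂(fieldLaw n μ) = S.card * ∫ x, f x ^ 2 ∂μ := by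
  induction S using Finset.induction_on with
  | empty => simp [siteSum]
  | insert j S hj ih =>
    rw [integral_siteSum_insert_pow hf hB hj]
    simp only [Finset.sum_range_succ, Finset.sum_range_zero, Finset.card_insert_of_notMem hj,
      Nat.sub_zero, ih, pow_one, h0, pow_zero, integral_const, probReal_univ, smul_eq_mul]
    norm_num
    ring

theorem integral_siteSum_pow_four_le (hf : Measurable f) (hB : ∀ x, |f x| ≤ B)
    (h0 : ∫ x, f x ∂μ = 0) (S : Finset (Fin n)) :
    ∫ h, siteSum f S h ^ 4 ∂(fieldLaw n μ) ≤ 3 * S.card ^ 2 * B ^ 4 := by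
  have hB0 : 0 ≤ B := (abs_nonneg _).trans (hB 0)
  have hpow : ∀ p, ∫ x, f x ^ p ∂μ ≤ B ^ p := fun p => by
    calc ∫ x, f x ^ p ∂μ ≤ ∫ _, B ^ p ∂μ := by
          refine integral_mono (integrable_of_abs_le (B := B ^ p) (hf.pow_const p) fun x => ?_)
            (integrable_const _) fun x => ?_
          · rw [abs_pow]; exact pow_le_pow_left₀ (abs_nonneg _) (hB x) p
          · refine (le_abs_self _).trans ?_
            rw [abs_pow]; exact pow_le_pow_left₀ (abs_nonneg _) (hB x) p
      _ = B ^ p := by simp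
  induction S using Finset.induction_on with
  | empty => simp [siteSum]
  | insert j S hj ih =>
    have h1 : ∫ h, siteSum f S h ∂(fieldLaw n μ) = 0 := by
      rw [integral_siteSum hf hB, h0, mul_zero]
    rw [integral_siteSum_insert_pow hf hB hj]
    simp only [Finset.sum_range_succ, Finset.sum_range_zero, Finset.card_insert_of_notMem hj,
      Nat.sub_zero, Nat.reduceSub, Nat.sub_self, integral_siteSum_sq hf hB h0, h1, pow_one, h0,
      pow_zero, integral_const, probReal_univ, smul_eq_mul,
      (by decide : Nat.choose 4 2 = 6), (by decide : Nat.choose 4 4 = 1),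
      (by decide : Nat.choose 4 0 = 1)]
    have h2 := hpow 2
    have h3 : 0 ≤ ∫ x, f x ^ 2 ∂μ := integral_nonneg fun x => sq_nonneg _
    have h4 : (∫ x, f x ^ 2 ∂μ) * ((S.card : ℝ) * ∫ x, f x ^ 2 ∂μ) ≤ B ^ 2 * (S.card * B ^ 2) := by
      gcongr
    have h5 := hpow 4
    have h6 : 0 ≤ B ^ 4 := by positivity
    have h7 : 3 * ((S.card : ℝ) + 1) ^ 2 * B ^ 4 = 3 * S.card ^ 2 * B ^ 4
        + 6 * (B ^ 2 * (S.card * B ^ 2)) + 3 * B ^ 4 := by ring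
    push_cast
    rw [h7]
    linarith

theorem integral_abs_le_sqrt {α : Type*} [MeasurableSpace α] {ν : Measure α}
    [IsProbabilityMeasure ν] {g : α → ℝ} (hg : Measurable g) {B : ℝ} (hB : ∀ x, |g x| ≤ B) :
    ∫ x, |g x| ∂ν ≤ √(∫ x, g x ^ 2 ∂ν) := by
  set V := ∫ x, g x ^ 2 ∂ν with hV
  have hI1 : Integrable (fun x => |g x|) ν := (integrable_of_abs_le hg hB).abs
  have hI2 : Integrable (fun x => g x ^ 2) ν := integrable_of_abs_le (B := B ^ 2)
    (hg.pow_const 2) fun x => by rw [abs_pow]; exact pow_le_pow_left₀ (abs_nonneg _) (hB x) 2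
  refine Real.le_sqrt_of_sq_le ?_
  set m := ∫ x, |g x| ∂ν with hm
  have h1 : ∫ x, (2 * m * |g x| - m ^ 2) ∂ν ≤ V :=
    integral_mono ((hI1.const_mul (2 * m)).sub (integrable_const (m ^ 2))) hI2 fun x => by
      have := sq_nonneg (|g x| - m)
      rw [sub_sq, sq_abs] at this
      show 2 * m * |g x| - m ^ 2 ≤ g x ^ 2
      linarith
  rw [integral_sub (hI1.const_mul (2 * m)) (integrable_const (m ^ 2)), integral_const_mul] at h1
  simp only [integral_const, probReal_univ, smul_eq_mul, one_mul] at h1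
  rw [← hm] at h1
  nlinarith

end sums

/-! ### The law of one observation -/

section law

variable {n : ℕ} {μ : Measure ℝ} [IsProbabilityMeasure μ] {θ : ℝ} {S : Finset (Fin n)}

theorem weight_pos (h : Fin n → ℝ) (σ : Config n) : 0 < weight θ S h σ := Real.exp_pos _

theorem sum_weight_pos (h : Fin n → ℝ) : 0 < ∑ σ, weight θ S h σ :=
  Finset.sum_pos (fun σ _ => weight_pos h σ) Finset.univ_nonempty

theorem continuous_gibbs (σ : Config n) : Continuous fun h => gibbs θ S h σ := by
  have h1 : ∀ σ : Config n, Continuous fun h => weight θ S h σ := fun σ => by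
    unfold weight; fun_prop
  exact (h1 σ).div (continuous_finsetSum _ fun σ _ => h1 σ) fun h => (sum_weight_pos h).ne'

theorem gibbs_nonneg (h : Fin n → ℝ) (σ : Config n) : 0 ≤ gibbs θ S h σ :=
  div_nonneg (weight_pos h σ).le (sum_weight_pos h).le

theorem sum_gibbs (h : Fin n → ℝ) : ∑ σ, gibbs θ S h σ = 1 := by
  simp only [gibbs, ← Finset.sum_div]
  exact div_self (sum_weight_pos h).ne'

theorem gibbs_le_one (h : Fin n → ℝ) (σ : Config n) : gibbs θ S h σ ≤ 1 := by
  rw [← sum_gibbs (θ := θ) (S := S) h]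
  exact Finset.single_le_sum (fun σ _ => gibbs_nonneg h σ) (Finset.mem_univ σ)

theorem integrable_gibbs (σ : Config n) : Integrable (fun h => gibbs θ S h σ) (fieldLaw n μ) :=
  integrable_of_abs_le (continuous_gibbs σ).measurable fun h => by
    rw [abs_of_nonneg (gibbs_nonneg h σ)]; exact gibbs_le_one h σ

theorem continuous_gibbsMean (F : Config n → ℝ) : Continuous fun h => gibbsMean θ S h F :=
  continuous_finsetSum _ fun σ _ => (continuous_gibbs σ).mul continuous_const

theorem abs_gibbsMean_le {F : Config n → ℝ} {B : ℝ} (hF : ∀ σ, |F σ| ≤ B) (h : Fin n → ℝ) :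
    |gibbsMean θ S h F| ≤ B := by
  calc |gibbsMean θ S h F| ≤ ∑ σ, gibbs θ S h σ * B :=
        (Finset.abs_sum_le_sum_abs _ _).trans (Finset.sum_le_sum fun σ _ => by
          rw [abs_mul, abs_of_nonneg (gibbs_nonneg h σ)]
          exact mul_le_mul_of_nonneg_left (hF σ) (gibbs_nonneg h σ))
    _ = B := by rw [← Finset.sum_mul, sum_gibbs, one_mul]

theorem integrable_gibbsMean {F : Config n → ℝ} {B : ℝ} (hF : ∀ σ, |F σ| ≤ B) :
    Integrable (fun h => gibbsMean θ S h F) (fieldLaw n μ) :=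
  integrable_of_abs_le (continuous_gibbsMean F).measurable (abs_gibbsMean_le hF)

instance isProbabilityMeasure_configLaw : IsProbabilityMeasure (configLaw μ θ S) := by
  constructor
  have h1 : configLaw μ θ S Set.univ
      = ∑ σ : Config n, ENNReal.ofReal (∫ h, gibbs θ S h σ ∂(fieldLaw n μ)) := by
    simp [configLaw]
  rw [h1, ← ENNReal.ofReal_sum_of_nonneg fun σ _ => integral_nonneg fun h => gibbs_nonneg h σ,
    ← integral_finsetSum _ fun σ _ => integrable_gibbs σ]
  simp [sum_gibbs]

theorem integral_configLaw (F : Config n → ℝ) :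
    ∫ σ, F σ ∂(configLaw μ θ S) = ∫ h, gibbsMean θ S h F ∂(fieldLaw n μ) := by
  rw [configLaw, integral_finsetSum_measure fun σ _ => by
    exact (integrable_dirac (by simp)).smul_measure ENNReal.ofReal_ne_top]
  simp only [gibbsMean]
  rw [integral_finsetSum _ fun σ _ => (integrable_gibbs σ).mul_const _]
  refine Finset.sum_congr rfl fun σ _ => ?_
  rw [integral_smul_measure, integral_dirac, integral_mul_const, smul_eq_mul,
    ENNReal.toReal_ofReal (integral_nonneg fun h => gibbs_nonneg h σ)]

instance isProbabilityMeasure_altLaw (m : ℕ) : IsProbabilityMeasure (altLaw m μ θ S) := by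
  unfold altLaw; infer_instance

/-- Hoeffding's inequality for the sum of `F` over the sample. -/
theorem altLaw_sum_ge_le {F : Config n → ℝ} {a b : ℝ} (hF : ∀ σ, F σ ∈ Set.Icc a b) (hab : a < b)
    {m : ℕ} {ε : ℝ} (hε : 0 ≤ ε) :
    (altLaw m μ θ S).real {x | m * (ε + ∫ σ, F σ ∂(configLaw μ θ S)) ≤ ∑ l, F (x l)}
      ≤ Real.exp (-(2 * m * ε ^ 2 / (b - a) ^ 2)) := by
  set ν := configLaw μ θ S
  set c := ∫ σ, F σ ∂ν with hc
  have hFm : Measurable F := Measurable.of_discrete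
  have h1 : ProbabilityTheory.iIndepFun (fun (l : Fin m) (x : Sample n m) => F (x l) - c)
      (altLaw m μ θ S) :=
    ProbabilityTheory.iIndepFun_pi (μ := fun _ : Fin m => ν) (X := fun _ σ => F σ - c)
      fun _ => (hFm.sub_const c).aemeasurable
  have h2 : ∀ l : Fin m, ProbabilityTheory.HasSubgaussianMGF (fun x : Sample n m => F (x l) - c)
      ((‖b - a‖₊ / 2) ^ 2) (altLaw m μ θ S) := fun l => by
    have h3 := ProbabilityTheory.hasSubgaussianMGF_of_mem_Icc (μ := altLaw m μ θ S)
      (X := fun x : Sample n m => F (x l)) (a := a) (b := b)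
      (hFm.comp (measurable_pi_apply l)).aemeasurable (Eventually.of_forall fun x => hF (x l))
    have h4 : ∫ x : Sample n m, F (x l) ∂(altLaw m μ θ S) = c :=
      integral_comp_eval (μ := fun _ : Fin m => ν) (i := l) hFm.aestronglyMeasurable
    rwa [h4] at h3
  have h3 := ProbabilityTheory.HasSubgaussianMGF.measure_sum_ge_le_of_iIndepFun h1
    (s := Finset.univ) (fun l _ => h2 l) (ε := m * ε) (by positivity)
  have h4 : {x : Sample n m | m * (ε + c) ≤ ∑ l, F (x l)}
      = {x : Sample n m | m * ε ≤ ∑ l, (F (x l) - c)} := by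
    ext x
    simp only [Set.mem_ofPred_eq, Finset.sum_sub_distrib, Finset.sum_const, Finset.card_univ,
      Fintype.card_fin, nsmul_eq_mul]
    constructor <;> intro h <;> linarith
  rw [h4]
  refine h3.trans (le_of_eq ?_)
  congr 1
  rcases Nat.eq_zero_or_pos m with rfl | hm
  · simp
  have hm' : (0 : ℝ) < m := by exact_mod_cast hm
  have hba : b - a ≠ 0 := by linarith
  simp only [Finset.sum_const, Finset.card_univ, Fintype.card_fin]
  push_cast
  rw [Real.norm_eq_abs, div_pow, sq_abs]
  field_simp
  ring

theorem altLaw_sum_le_le {F : Config n → ℝ} {a b : ℝ} (hF : ∀ σ, F σ ∈ Set.Icc a b) (hab : a < b)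
    {m : ℕ} {ε : ℝ} (hε : 0 ≤ ε) :
    (altLaw m μ θ S).real {x | ∑ l, F (x l) ≤ m * (∫ σ, F σ ∂(configLaw μ θ S) - ε)}
      ≤ Real.exp (-(2 * m * ε ^ 2 / (b - a) ^ 2)) := by
  have h1 := altLaw_sum_ge_le (μ := μ) (θ := θ) (S := S) (F := fun σ => -F σ) (a := -b) (b := -a)
    (fun σ => ⟨neg_le_neg (hF σ).2, neg_le_neg (hF σ).1⟩) (by linarith) (m := m) hε
  rw [integral_neg] at h1
  refine (le_of_eq ?_).trans (h1.trans (le_of_eq ?_))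
  · congr 1
    ext x
    simp only [Set.mem_ofPred_eq, Finset.sum_neg_distrib]
    constructor <;> intro h <;> linarith
  · ring_nf

end law


/-! ### From the mean energy to the power of the tests -/

theorem empCov_diag {n m : ℕ} (hm : 1 ≤ m) (x : Sample n m) (i : Fin n) : empCov x i i = 1 := by
  have h1 : ∀ b : Bool, (spin b : ℝ) * (spin b : ℝ) = 1 := fun b => by cases b <;> simp [spin]
  have hm0 : (m : ℝ) ≠ 0 := by positivity
  simp [empCov, h1, hm0]

theorem sdp_empCov_le {n m k : ℕ} (hm : 1 ≤ m) (hk : 1 ≤ k) (hkn : k ≤ n) (x : Sample n m) {δ : ℝ}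
    (hδ : 0 ≤ δ) (h : ∀ i j, i ≠ j → |∑ l, (spin (x l i) : ℝ) * spin (x l j)| ≤ m * δ) :
    sdp k (empCov x) ≤ 1 + k * δ := by
  have hm0 : (0 : ℝ) < m := by exact_mod_cast hm
  have hoff : ∀ i j, i ≠ j → |empCov x i j| ≤ δ := fun i j hij => by
    rw [empCov, abs_div, abs_of_pos hm0, div_le_iff₀ hm0, mul_comm]; exact h i j hij
  refine sdp_le hk hkn fun X hX htr habs => ?_
  rw [trace_mul_eq_sum _ _ (isSymm_of_isHermitian hX.1)]
  have h1 : ∀ i j, empCov x i j * X i j ≤ (if i = j then X i j else 0) + δ * |X i j| := by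
    intro i j
    by_cases hij : i = j
    · subst hij
      rw [if_pos rfl, empCov_diag hm, one_mul]
      have := mul_nonneg hδ (abs_nonneg (X i i))
      linarith
    · rw [if_neg hij, zero_add]
      refine (le_abs_self _).trans ?_
      rw [abs_mul]
      exact mul_le_mul_of_nonneg_right (hoff i j hij) (abs_nonneg _)
  calc ∑ i, ∑ j, empCov x i j * X i j
      ≤ ∑ i, ∑ j, ((if i = j then X i j else 0) + δ * |X i j|) :=
        Finset.sum_le_sum fun i _ => Finset.sum_le_sum fun j _ => h1 i j
    _ = X.trace + δ * ∑ i, ∑ j, |X i j| := by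
        simp [Finset.sum_add_distrib, Finset.mul_sum, Matrix.trace]
    _ ≤ 1 + k * δ := by rw [htr]; nlinarith

theorem mean_energy_le_sdp {n m : ℕ} (S : Finset (Fin n)) (hS : S.Nonempty) (x : Sample n m) :
    (∑ l, energy S (x l)) / m ≤ sdp S.card (empCov x) := by
  have hk : (0 : ℝ) < S.card := by exact_mod_cast hS.card_pos
  set c := (√(S.card : ℝ))⁻¹ with hc
  have hc2 : c ^ 2 * S.card = 1 := by
    rw [hc, inv_pow, Real.sq_sqrt hk.le]; field_simp
  refine le_trans (le_of_eq ?_) (quadForm_le_sdp (empCov x) (v := fun i => if i ∈ S then c else 0) ?_ ?_)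
  · have h1 : ∀ i j, (if i ∈ S then c else 0) * empCov x i j * (if j ∈ S then c else 0)
        = ∑ l, c ^ 2 / m * ((if i ∈ S then (spin (x l i) : ℝ) else 0)
          * (if j ∈ S then (spin (x l j) : ℝ) else 0)) := by
      intro i j
      rw [← Finset.mul_sum]
      split_ifs <;> simp [empCov]; ring
    simp only [h1]
    rw [Finset.sum_congr rfl fun i _ => Finset.sum_comm, Finset.sum_comm, Finset.sum_div]
    refine Finset.sum_congr rfl fun l _ => ?_
    simp only [← Finset.mul_sum]
    rw [← Finset.sum_mul, Finset.sum_ite_mem, Finset.univ_inter, energy, mag,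
      eq_div_of_mul_eq hk.ne' hc2]
    ring
  · simp only [ite_pow, ne_eq, OfNat.ofNat_ne_zero, not_false_eq_true, zero_pow]
    rw [Finset.sum_ite_mem, Finset.univ_inter, Finset.sum_const, nsmul_eq_mul, mul_comm, hc2]
  · have : {i | (if i ∈ S then c else 0) ≠ 0} ⊆ (S : Set (Fin n)) := by
      intro i hi
      by_contra h
      exact hi (if_neg h)
    exact (Set.ncard_le_ncard this S.finite_toSet).trans (Set.ncard_coe_finset S).le

theorem avg_spin_mul_spin {n : ℕ} (h : Fin n → ℝ) {i j : Fin n} (hij : i ≠ j) :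
    avg h (fun σ => (spin (σ i) : ℝ) * spin (σ j)) = Real.tanh (h i) * Real.tanh (h j) := by
  have h1 := avg_mag h {j}
  rw [Finset.sum_singleton] at h1
  rw [avg_update h i]
  simp only [Function.update_self, Function.update_of_ne hij.symm]
  rw [siteProb_true, siteProb_false]
  have e : ∀ σ : Config n, (1 + Real.tanh (h i)) / 2 * (((spin true : ℤ) : ℝ) * spin (σ j))
      + (1 - Real.tanh (h i)) / 2 * (((spin false : ℤ) : ℝ) * spin (σ j))
      = Real.tanh (h i) * mag {j} σ := fun σ => by
    rcases hb : σ j <;> simp [mag, spin, hb] <;> ring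
  simp only [e]
  rw [avg_const_mul, h1]

theorem tanh_eq_div (x : ℝ) : Real.tanh x = Real.sinh x / Real.cosh x :=
  Real.tanh_eq_sinh_div_cosh x

theorem measurable_tanh : Measurable Real.tanh := by
  have : Real.tanh = fun x => Real.sinh x / Real.cosh x := funext tanh_eq_div
  rw [this]
  exact Real.measurable_sinh.div Real.measurable_cosh

theorem abs_tanh_le (x : ℝ) : |Real.tanh x| ≤ 1 := (Real.abs_tanh_lt_one x).le

theorem integral_eq_zero_of_odd {μ : Measure ℝ} (hμ : μ.map (fun h => -h) = μ) {f : ℝ → ℝ}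
    (hodd : ∀ x, f (-x) = -f x) : ∫ x, f x ∂μ = 0 := by
  have h1 : ∫ x, f x ∂μ = ∫ x, f (-x) ∂μ := by
    conv_lhs => rw [← hμ]
    exact integral_map_equiv (MeasurableEquiv.neg ℝ) f
  simp only [hodd, integral_neg] at h1
  linarith

section

variable {μ : Measure ℝ} [IsProbabilityMeasure μ]

theorem integral_spin_mul_spin_null (hμ : μ.map (fun h => -h) = μ) {n : ℕ} {i j : Fin n}
    (hij : i ≠ j) : ∫ σ, (spin (σ i) : ℝ) * spin (σ j) ∂(configLaw μ 0 (∅ : Finset (Fin n))) = 0 := by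
  have h0 : ∫ x, Real.tanh x ∂μ = 0 := integral_eq_zero_of_odd hμ Real.tanh_neg
  rw [integral_configLaw]
  have h1 : ∀ h : Fin n → ℝ, gibbsMean 0 ∅ h (fun σ => (spin (σ i) : ℝ) * spin (σ j))
      = Real.tanh (h i) ^ 1 * siteSum Real.tanh {j} h ^ 1 := fun h => by
    rw [gibbsMean_eq, partition]
    simp only [zero_div, zero_mul, Real.exp_zero, mul_one]
    rw [avg_const, avg_spin_mul_spin h hij]
    simp [siteSum]
  simp only [h1]
  rw [integral_pow_mul_siteSum_pow measurable_tanh (by simpa using hij)]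
  simp [h0]

theorem spin_mul_mem (b b' : Bool) : (spin b : ℝ) * spin b' ∈ Set.Icc (-1 : ℝ) 1 := by
  cases b <;> cases b' <;> simp [spin]

theorem energy_mem {n : ℕ} (S : Finset (Fin n)) (σ : Config n) :
    energy S σ ∈ Set.Icc (0 : ℝ) S.card := by
  refine ⟨energy_nonneg S σ, ?_⟩
  rcases S.eq_empty_or_nonempty with rfl | hS
  · simp [energy]
  have hk : (0 : ℝ) < S.card := by exact_mod_cast hS.card_pos
  have h1 : |mag S σ| ≤ S.card := by
    refine (Finset.abs_sum_le_sum_abs _ _).trans ?_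
    have h2 : ∀ i ∈ S, |(spin (σ i) : ℝ)| ≤ 1 := fun i _ => by
      cases σ i <;> simp [spin]
    exact (Finset.sum_le_sum h2).trans (by simp)
  rw [energy, div_le_iff₀ hk, ← sq, ← sq_abs]
  exact pow_le_pow_left₀ (abs_nonneg _) h1 2

instance isProbabilityMeasure_nullLaw (n m : ℕ) : IsProbabilityMeasure (nullLaw n m μ) := by
  unfold nullLaw; infer_instance

theorem nullLaw_reject_le (hμ : μ.map (fun h => -h) = μ) {ψ : Test} {C : ℝ} (hC : 4 ≤ C) {n m k : ℕ}
    (hn : 2 ≤ n) (hm : 1 ≤ m) (hk : 1 ≤ k) (hkn : k ≤ n)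
    (hψ : ∀ x : Sample n m, sdp k (empCov x) < threshold C n m k → ¬ ψ n m k x) :
    (nullLaw n m μ).real {x | ψ n m k x} ≤ 2 / n := by
  have hn0 : (0 : ℝ) < n := by exact_mod_cast (by omega : 0 < n)
  have hm0 : (0 : ℝ) < m := by exact_mod_cast hm
  have hk0 : (0 : ℝ) < k := by exact_mod_cast hk
  have hlog : 0 < Real.log n := Real.log_pos (by exact_mod_cast (by omega : 1 < n))
  set r := √(Real.log n / m) with hr
  have hr0 : 0 < r := Real.sqrt_pos.mpr (div_pos hlog hm0)
  have hr2 : m * r ^ 2 = Real.log n := by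
    rw [hr, Real.sq_sqrt (div_nonneg hlog.le hm0.le)]; field_simp
  set δ := (C - 1) * r with hδ
  have hδ0 : 0 ≤ δ := mul_nonneg (by linarith) hr0.le
  set E : Fin n → Fin n → Set (Sample n m) := fun i j =>
    if i = j then ∅ else {x | m * δ ≤ |∑ l, (spin (x l i) : ℝ) * spin (x l j)|} with hE
  have hsub : {x | ψ n m k x} ⊆ ⋃ i ∈ (Finset.univ : Finset (Fin n)),
      ⋃ j ∈ (Finset.univ : Finset (Fin n)), E i j := by
    intro x hx
    by_contra hcon
    simp only [Set.mem_iUnion, not_exists] at hcon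
    refine hψ x (lt_of_le_of_lt (sdp_empCov_le hm hk hkn x hδ0 fun i j hij => ?_) ?_) hx
    · have := hcon i (Finset.mem_univ i) j (Finset.mem_univ j)
      rw [hE] at this
      simp only [if_neg hij, Set.mem_ofPred_eq, not_le] at this
      exact this.le
    · rw [threshold, hδ, ← hr]
      have := mul_pos hk0 hr0
      nlinarith
  have hone : ∀ i j, (nullLaw n m μ).real (E i j) ≤ 2 * Real.exp (-(3 * Real.log n)) := by
    intro i j
    by_cases hij : i = j
    · simp only [hE, if_pos hij, measureReal_empty]; positivity
    · simp only [hE, if_neg hij]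
      have h0 := integral_spin_mul_spin_null (μ := μ) hμ hij
      have h1 := altLaw_sum_ge_le (μ := μ) (θ := 0) (S := (∅ : Finset (Fin n)))
        (F := fun σ => (spin (σ i) : ℝ) * spin (σ j)) (fun σ => spin_mul_mem _ _)
        (by norm_num) (m := m) hδ0
      have h2 := altLaw_sum_le_le (μ := μ) (θ := 0) (S := (∅ : Finset (Fin n)))
        (F := fun σ => (spin (σ i) : ℝ) * spin (σ j)) (fun σ => spin_mul_mem _ _)
        (by norm_num) (m := m) hδ0
      rw [h0] at h1 h2
      have h3 : Real.exp (-(2 * m * δ ^ 2 / (1 - -1) ^ 2)) ≤ Real.exp (-(3 * Real.log n)) := by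
        rw [Real.exp_le_exp, neg_le_neg_iff, hδ]
        have : 2 * m * ((C - 1) * r) ^ 2 / (1 - -1) ^ 2 = (C - 1) ^ 2 / 2 * (m * r ^ 2) := by ring
        rw [this, hr2]
        nlinarith [sq_nonneg (C - 4)]
      have h4 : {x : Sample n m | m * δ ≤ |∑ l, (spin (x l i) : ℝ) * spin (x l j)|}
          ⊆ {x | m * (δ + 0) ≤ ∑ l, (spin (x l i) : ℝ) * spin (x l j)}
            ∪ {x | ∑ l, (spin (x l i) : ℝ) * spin (x l j) ≤ m * (0 - δ)} := by
        intro x hx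
        rcases le_abs.mp (show m * δ ≤ |∑ l, (spin (x l i) : ℝ) * spin (x l j)| from hx) with h | h
        · left; simpa using h
        · right
          simp only [Set.mem_ofPred_eq, zero_sub, mul_neg]
          linarith
      calc _ ≤ _ := measureReal_mono h4
        _ ≤ _ := measureReal_union_le _ _
        _ ≤ _ := add_le_add (h1.trans h3) (h2.trans h3)
        _ = _ := by ring
  calc (nullLaw n m μ).real {x | ψ n m k x}
      ≤ ∑ i : Fin n, ∑ j : Fin n, (nullLaw n m μ).real (E i j) :=
        (measureReal_mono hsub (measure_ne_top _ _)).trans ((measureReal_biUnion_finset_le _ _).trans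
          (Finset.sum_le_sum fun i _ => measureReal_biUnion_finset_le _ _))
    _ ≤ ∑ i : Fin n, ∑ j : Fin n, 2 * Real.exp (-(3 * Real.log n)) :=
        Finset.sum_le_sum fun i _ => Finset.sum_le_sum fun j _ => hone i j
    _ = 2 / n := by
        have : Real.exp (-(3 * Real.log n)) = ((n : ℝ) ^ 3)⁻¹ := by
          rw [Real.exp_neg, ← Real.exp_log (pow_pos hn0 3), Real.log_pow]; norm_num
        rw [this]
        simp only [Finset.sum_const, Finset.card_univ, Fintype.card_fin, nsmul_eq_mul]
        field_simp

theorem altLaw_accept_le {θ : ℝ} {ψ : Test} {C : ℝ} {n m : ℕ} (hn : 2 ≤ n)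
    (hm : 1 ≤ m) {S : Finset (Fin n)} (hS : S.Nonempty)
    (hψ : ∀ x : Sample n m, threshold (2 * C) n m S.card ≤ sdp S.card (empCov x) → ψ n m S.card x)
    (hE : (2 * C + 1) * S.card * √(Real.log n / m) ≤ ∫ σ, energy S σ ∂(configLaw μ θ S) - 1) :
    (altLaw m μ θ S).real {x | ¬ ψ n m S.card x} ≤ 1 / n := by
  have hn1 : (1 : ℝ) ≤ n := by exact_mod_cast (by omega : 1 ≤ n)
  have hm0 : (0 : ℝ) < m := by exact_mod_cast hm
  have hk0 : (0 : ℝ) < S.card := by exact_mod_cast hS.card_pos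
  have hlog : 0 < Real.log n := Real.log_pos (by exact_mod_cast (by omega : 1 < n))
  set r := √(Real.log n / m) with hr
  have hr0 : 0 < r := Real.sqrt_pos.mpr (div_pos hlog hm0)
  have hr2 : m * r ^ 2 = Real.log n := by
    rw [hr, Real.sq_sqrt (div_nonneg hlog.le hm0.le)]; field_simp
  have h1 := altLaw_sum_le_le (μ := μ) (θ := θ) (S := S) (F := energy S) (energy_mem S) hk0
    (m := m) (ε := S.card * r) (by positivity)
  refine (measureReal_mono fun x hx => ?_).trans (h1.trans ?_)
  · have h2 : sdp S.card (empCov x) < threshold (2 * C) n m S.card := by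
      by_contra hcon
      exact hx (hψ x (not_lt.mp hcon))
    have h3 := mean_energy_le_sdp S hS x
    rw [div_le_iff₀ hm0] at h3
    rw [threshold, ← hr] at h2
    simp only [Set.mem_ofPred_eq]
    refine h3.trans ?_
    rw [mul_comm]
    exact mul_le_mul_of_nonneg_left (by linarith) hm0.le
  · have e : 2 * m * (S.card * r) ^ 2 / ((S.card : ℝ) - 0) ^ 2 = 2 * Real.log n := by
      rw [← hr2, sub_zero]; field_simp
    rw [e, Real.exp_neg, one_div]
    refine inv_anti₀ (by linarith) ?_
    calc (n : ℝ) = Real.exp (Real.log n) := (Real.exp_log (by linarith)).symm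
      _ ≤ _ := Real.exp_le_exp.mpr (by linarith)

/-- A test that thresholds the semidefinite program detects the planted set as soon as the mean
energy is large enough. -/
theorem detectsAtRate_of_energy (hμ : μ.map (fun h => -h) = μ) {θ : ℝ} {ψ : Test} {C : ℝ}
    (hC : 4 ≤ C)
    (hψ₀ : ∀ (n m k : ℕ) (x : Sample n m), 2 ≤ n → 1 ≤ m → 1 ≤ k → k ≤ n →
      sdp k (empCov x) < threshold C n m k → ¬ ψ n m k x)
    (hψ₁ : ∀ (n m k : ℕ) (x : Sample n m), 2 ≤ n → 1 ≤ m → 1 ≤ k → k ≤ n →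
      threshold (2 * C) n m k ≤ sdp k (empCov x) → ψ n m k x)
    {r : ℕ → ℝ} (hr : ∀ k, 1 ≤ k → 0 < r k) {c : ℝ} (hc : 0 < c)
    (hE : ∀ᶠ k : ℕ in atTop, ∀ (n : ℕ) (S : Finset (Fin n)), S.card = k →
      c * k / √(r k) ≤ ∫ σ, energy S σ ∂(configLaw μ θ S) - 1) :
    DetectsAtRate μ θ ψ r := by
  refine ⟨((2 * C + 1) / c) ^ 2, by positivity, fun k m hk hkn hm => ?_⟩
  have hlim : Tendsto (fun n : ℕ => ENNReal.ofReal (3 / n)) atTop (𝓝 0) := by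
    have h1 : Tendsto (fun n : ℕ => (3 : ℝ) / n) atTop (𝓝 0) := tendsto_const_div_atTop_nhds_zero_nat 3
    simpa using ENNReal.tendsto_ofReal h1
  refine tendsto_of_tendsto_of_tendsto_of_le_of_le' tendsto_const_nhds hlim
    (Eventually.of_forall fun _ => zero_le) ?_
  filter_upwards [hkn, hm, hk.eventually hE, hk.eventually_ge_atTop 1, eventually_ge_atTop 2]
    with n hkn hm hE hk hn
  have hn0 : (0 : ℝ) < n := by exact_mod_cast (by omega : 0 < n)
  have hlog : 0 < Real.log n := Real.log_pos (by exact_mod_cast (by omega : 1 < n))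
  have hrk := hr _ hk
  have hm0 : (0 : ℝ) < m n := lt_of_lt_of_le (by positivity) hm
  have hm1 : 1 ≤ m n := by exact_mod_cast hm0
  have h0 : nullLaw n (m n) μ {x | ψ n (m n) (k n) x} ≤ ENNReal.ofReal (2 / n) := by
    have := nullLaw_reject_le hμ hC hn hm1 hk hkn fun x => hψ₀ n (m n) (k n) x hn hm1 hk hkn
    rw [measureReal_def] at this
    have hfin : nullLaw n (m n) μ {x | ψ n (m n) (k n) x} ≠ ⊤ := by
      unfold nullLaw; exact measure_ne_top _ _
    rw [← ENNReal.ofReal_toReal hfin]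
    exact ENNReal.ofReal_le_ofReal this
  have h1 : ⨆ S : {S : Finset (Fin n) // S.card = k n},
      altLaw (m n) μ θ S.1 {x | ¬ ψ n (m n) (k n) x} ≤ ENNReal.ofReal (1 / n) := by
    refine iSup_le ?_
    rintro ⟨S, hS⟩
    have hE' := hE n S hS
    change altLaw (m n) μ θ S {x | ¬ ψ n (m n) (k n) x} ≤ _
    rw [← hS] at hE' hrk hm hk hkn ⊢
    have hSn : S.Nonempty := Finset.card_pos.mp (by omega)
    have := altLaw_accept_le (μ := μ) (θ := θ) (ψ := ψ) (C := C) hn hm1 hSn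
      (fun x => hψ₁ n (m n) S.card x hn hm1 hk hkn) (le_trans ?_ hE')
    · rw [measureReal_def] at this
      rw [← ENNReal.ofReal_toReal (measure_ne_top (altLaw (m n) μ θ S) _)]
      exact ENNReal.ofReal_le_ofReal this
    · have h2 : Real.log n / m n ≤ (c / (2 * C + 1)) ^ 2 / r S.card := by
        rw [div_le_div_iff₀ hm0 hrk]
        have h3 : (c / (2 * C + 1)) ^ 2 * (((2 * C + 1) / c) ^ 2) = 1 := by
          rw [← mul_pow, div_mul_div_cancel₀ (by linarith), div_self hc.ne', one_pow]
        calc Real.log n * r S.card = (c / (2 * C + 1)) ^ 2 *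
              (((2 * C + 1) / c) ^ 2 * r S.card * Real.log n) := by
              linear_combination -(Real.log n * r S.card) * h3
          _ ≤ _ := by gcongr
      calc (2 * C + 1) * S.card * √(Real.log n / m n)
          ≤ (2 * C + 1) * S.card * (c / (2 * C + 1) / √(r S.card)) := by
            refine mul_le_mul_of_nonneg_left ?_ (by positivity)
            refine (Real.sqrt_le_sqrt h2).trans (le_of_eq ?_)
            rw [Real.sqrt_div (sq_nonneg _), Real.sqrt_sq (by positivity)]
        _ = c * S.card / √(r S.card) := by
            have : 2 * C + 1 ≠ 0 := by linarith
            field_simp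
  calc _ ≤ ENNReal.ofReal (2 / n) + ENNReal.ofReal (1 / n) := add_le_add h0 h1
    _ = ENNReal.ofReal (3 / n) := by
      rw [← ENNReal.ofReal_add (by positivity) (by positivity)]
      congr 1; ring

end


/-! ### Increments of the logarithm of the hyperbolic cosine -/

noncomputable def lcDiff (u h : ℝ) : ℝ := Real.log (Real.cosh (h + u)) - Real.log (Real.cosh h)

theorem log_cosh_add_sub_le (h d : ℝ) :
    Real.log (Real.cosh (h + d)) - Real.log (Real.cosh h) ≤ |d| := by
  have h1 : Real.cosh (h + d) ≤ Real.exp |d| * Real.cosh h := by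
    rw [Real.cosh_add, ← Real.cosh_add_sinh |d|, Real.cosh_abs]
    have h2 : Real.sinh h * Real.sinh d ≤ Real.cosh h * Real.sinh |d| := by
      refine (le_abs_self _).trans ?_
      rw [abs_mul, Real.abs_sinh d]
      refine mul_le_mul_of_nonneg_right ?_ (Real.sinh_nonneg_iff.mpr (abs_nonneg d))
      rw [Real.abs_sinh, ← Real.cosh_abs h]
      exact (Real.sinh_lt_cosh _).le
    linarith
  rw [sub_le_iff_le_add]
  calc Real.log (Real.cosh (h + d)) ≤ Real.log (Real.exp |d| * Real.cosh h) :=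
        Real.log_le_log (Real.cosh_pos _) h1
    _ = _ := by rw [Real.log_mul (Real.exp_pos _).ne' (Real.cosh_pos _).ne', Real.log_exp]

theorem abs_log_cosh_sub_le (a b : ℝ) :
    |Real.log (Real.cosh a) - Real.log (Real.cosh b)| ≤ |a - b| := by
  rw [abs_le]
  have h1 := log_cosh_add_sub_le b (a - b)
  have h2 := log_cosh_add_sub_le a (b - a)
  rw [add_sub_cancel] at h1 h2
  rw [abs_sub_comm b a] at h2
  constructor <;> linarith

theorem continuous_log_cosh : Continuous fun x : ℝ => Real.log (Real.cosh x) :=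
  Real.continuous_cosh.log fun x => (Real.cosh_pos x).ne'

theorem measurable_lcDiff (u : ℝ) : Measurable (lcDiff u) := by
  have : Continuous (lcDiff u) :=
    (continuous_log_cosh.comp (continuous_id.add continuous_const)).sub continuous_log_cosh
  exact this.measurable

theorem abs_lcDiff_sub_le (u w h : ℝ) : |lcDiff u h - lcDiff w h| ≤ |u - w| := by
  have := abs_log_cosh_sub_le (h + u) (h + w)
  simp only [lcDiff, sub_sub_sub_cancel_right]
  rwa [add_sub_add_left_eq_sub] at this

theorem lcDiff_zero (h : ℝ) : lcDiff 0 h = 0 := by simp [lcDiff]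

theorem abs_lcDiff_le (u h : ℝ) : |lcDiff u h| ≤ |u| := by
  simpa [lcDiff_zero] using abs_lcDiff_sub_le u 0 h

theorem lcDiff_neg (u h : ℝ) : lcDiff u (-h) = lcDiff (-u) h := by
  rw [lcDiff, lcDiff, Real.cosh_neg, ← Real.cosh_neg (h + -u)]
  ring_nf

theorem lcDiff_add_lcDiff_neg (u h : ℝ) :
    lcDiff u h + lcDiff (-u) h = Real.log (1 + Real.sinh u ^ 2 / Real.cosh h ^ 2) := by
  have hc := Real.cosh_pos h
  have h1 : Real.cosh (h + u) * Real.cosh (h + -u) = Real.cosh h ^ 2 + Real.sinh u ^ 2 := by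
    rw [Real.cosh_add, Real.cosh_add, Real.cosh_neg, Real.sinh_neg]
    have a := Real.cosh_sq h
    have b := Real.cosh_sq u
    linear_combination Real.cosh h ^ 2 * b + Real.sinh u ^ 2 * a
  have h2 : (1 : ℝ) + Real.sinh u ^ 2 / Real.cosh h ^ 2
      = Real.cosh (h + u) * Real.cosh (h + -u) / (Real.cosh h * Real.cosh h) := by
    rw [h1]; field_simp
  rw [h2, Real.log_div (mul_pos (Real.cosh_pos _) (Real.cosh_pos _)).ne' (mul_pos hc hc).ne',
    Real.log_mul (Real.cosh_pos _).ne' (Real.cosh_pos _).ne', Real.log_mul hc.ne' hc.ne']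
  simp only [lcDiff]; ring

theorem one_sub_tanh_sq (h : ℝ) : 1 - Real.tanh h ^ 2 = 1 / Real.cosh h ^ 2 := by
  have := (Real.cosh_pos h).ne'
  rw [tanh_eq_div, div_pow]
  field_simp
  linarith [Real.cosh_sq h]

/-! ### The free energy -/

noncomputable def meanLcDiff (μ : Measure ℝ) (u : ℝ) : ℝ := ∫ h, lcDiff u h ∂μ

theorem meanLcDiff_neg {μ : Measure ℝ} (hμ : μ.map (fun h => -h) = μ) (u : ℝ) :
    meanLcDiff μ (-u) = meanLcDiff μ u := by
  have h1 : ∫ x, lcDiff u x ∂μ = ∫ x, lcDiff u (-x) ∂μ := by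
    conv_lhs => rw [← hμ]
    exact integral_map_equiv (MeasurableEquiv.neg ℝ) _
  rw [meanLcDiff, meanLcDiff, h1]
  simp only [lcDiff_neg]

section

variable {μ : Measure ℝ} [IsProbabilityMeasure μ] {θ : ℝ}

theorem integrable_lcDiff (u : ℝ) : Integrable (lcDiff u) μ :=
  integrable_of_abs_le (measurable_lcDiff u) (abs_lcDiff_le u)

theorem freeEnergy_zero_sub (hint : Integrable (fun h : ℝ => h) μ) (x : ℝ) :
    freeEnergy μ θ 0 - freeEnergy μ θ x = meanLcDiff μ (√θ * x) - x ^ 2 / 2 := by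
  have h1 : Integrable (fun h => Real.log (Real.cosh h)) μ := by
    refine hint.abs.mono continuous_log_cosh.aestronglyMeasurable (Eventually.of_forall fun h => ?_)
    have := abs_log_cosh_sub_le h 0
    simp only [Real.cosh_zero, Real.log_one, sub_zero] at this
    simpa using this
  have h2 : Integrable (fun h => Real.log (Real.cosh (√θ * x + h))) μ := by
    have := h1.add (integrable_lcDiff (μ := μ) (√θ * x))
    refine this.congr (Eventually.of_forall fun h => ?_)
    simp only [Pi.add_apply, lcDiff]
    rw [add_comm h]; ring
  have h3 : meanLcDiff μ (√θ * x)
      = ∫ h, Real.log (Real.cosh (√θ * x + h)) ∂μ - ∫ h, Real.log (Real.cosh h) ∂μ := by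
    rw [← integral_sub h2 h1]
    exact integral_congr_ae (Eventually.of_forall fun h => by simp only [lcDiff]; rw [add_comm h])
  simp only [freeEnergy, mul_zero, zero_add]
  rw [h3]; ring

theorem measurable_sech_sq : Measurable fun h : ℝ => 1 / Real.cosh h ^ 2 :=
  measurable_const.div (Real.measurable_cosh.pow_const 2)

theorem sech_sq_mem (h : ℝ) : 0 < 1 / Real.cosh h ^ 2 ∧ 1 / Real.cosh h ^ 2 ≤ 1 := by
  refine ⟨by have := Real.cosh_pos h; positivity, ?_⟩
  rw [← one_sub_tanh_sq]
  linarith [sq_nonneg (Real.tanh h)]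

theorem abs_sech_sq_le (h : ℝ) : |1 / Real.cosh h ^ 2| ≤ 1 := by
  rw [abs_of_pos (sech_sq_mem h).1]; exact (sech_sq_mem h).2

theorem meanSechSq_pos : 0 < meanSechSq μ := by
  have h1 : Integrable (fun h : ℝ => 1 / Real.cosh h ^ 2) μ :=
    integrable_of_abs_le measurable_sech_sq abs_sech_sq_le
  refine (integral_pos_iff_support_of_nonneg (fun h => (sech_sq_mem h).1.le) h1).mpr ?_
  have : Function.support (fun h : ℝ => 1 / Real.cosh h ^ 2) = Set.univ :=
    Set.eq_univ_of_forall fun h => (sech_sq_mem h).1.ne'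
  rw [this, measure_univ]
  exact one_pos

theorem meanSechSq_le_one : meanSechSq μ ≤ 1 := by
  calc meanSechSq μ ≤ ∫ _, (1 : ℝ) ∂μ := integral_mono
        (integrable_of_abs_le measurable_sech_sq abs_sech_sq_le) (integrable_const _)
        fun h => (sech_sq_mem h).2
    _ = 1 := by simp

theorem integral_tanh_sq : ∫ h, Real.tanh h ^ 2 ∂μ = 1 - meanSechSq μ := by
  have h1 : ∀ h, Real.tanh h ^ 2 = 1 - 1 / Real.cosh h ^ 2 := fun h => by
    rw [← one_sub_tanh_sq]; ring
  simp only [h1]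
  rw [integral_sub (integrable_const _)
    (integrable_of_abs_le measurable_sech_sq abs_sech_sq_le)]
  simp [meanSechSq]

/-- A lower bound for the mean of the logarithmic Laplace transform of a spin. -/
theorem le_meanLcDiff (hμ : μ.map (fun h => -h) = μ) (u : ℝ) :
    (meanSechSq μ * Real.sinh u ^ 2 - (Real.sinh u ^ 2) ^ 2 / 2) / 2 ≤ meanLcDiff μ u := by
  set w := Real.sinh u ^ 2
  have hw : 0 ≤ w := sq_nonneg _
  have h1 : 2 * meanLcDiff μ u = ∫ h, (lcDiff u h + lcDiff (-u) h) ∂μ := by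
    rw [integral_add (integrable_lcDiff u) (integrable_lcDiff (-u))]
    have := meanLcDiff_neg hμ u
    simp only [meanLcDiff] at *
    linarith
  have h2 : ∫ h, (1 / Real.cosh h ^ 2 * w - w ^ 2 / 2) ∂μ ≤ ∫ h, (lcDiff u h + lcDiff (-u) h) ∂μ := by
    refine integral_mono (((integrable_of_abs_le measurable_sech_sq abs_sech_sq_le).mul_const w).sub
      (integrable_const (w ^ 2 / 2))) ((integrable_lcDiff u).add (integrable_lcDiff (-u)))
      fun h => ?_
    show 1 / Real.cosh h ^ 2 * w - w ^ 2 / 2 ≤ lcDiff u h + lcDiff (-u) h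
    rw [lcDiff_add_lcDiff_neg]
    obtain ⟨h3, h4⟩ := sech_sq_mem h
    have h5 : w / Real.cosh h ^ 2 = 1 / Real.cosh h ^ 2 * w := by ring
    change _ ≤ Real.log (1 + w / Real.cosh h ^ 2)
    rw [h5]
    set y := 1 / Real.cosh h ^ 2 * w
    have hy : 0 ≤ y := mul_nonneg h3.le hw
    have hyw : y ≤ w := by nlinarith
    have h6 := Real.one_sub_inv_le_log_of_pos (by linarith : 0 < 1 + y)
    have h7 := Real.le_log_one_add_of_nonneg hy
    refine le_trans ?_ h7
    rw [le_div_iff₀ (by linarith)]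
    nlinarith [mul_nonneg hy hy, mul_nonneg hy hw, mul_nonneg (mul_nonneg hy hw) hy, mul_self_nonneg (w - y), mul_nonneg hy (mul_nonneg hw hw)]
  rw [integral_sub ((integrable_of_abs_le measurable_sech_sq abs_sech_sq_le).mul_const w)
    (integrable_const (w ^ 2 / 2)), integral_mul_const] at h2
  simp only [integral_const, probReal_univ, smul_eq_mul, one_mul] at h2
  change meanSechSq μ * w - w ^ 2 / 2 ≤ _ at h2
  linarith

theorem sq_le_sinh_sq (u : ℝ) : u ^ 2 ≤ Real.sinh u ^ 2 := by
  rw [← sq_abs u, ← sq_abs (Real.sinh u), Real.abs_sinh]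
  exact pow_le_pow_left₀ (abs_nonneg _) (Real.self_le_sinh_iff.mpr (abs_nonneg u)) 2

/-- At low temperature the free energy is not minimal at zero. -/
theorem exists_meanLcDiff_gt (hμ : μ.map (fun h => -h) = μ) (hint : Integrable (fun h : ℝ => h) μ)
    (hθ : 0 < θ) (h : 1 < θ * meanSechSq μ ∨ (θ * meanSechSq μ = 1 ∧ ¬ ZeroIsGlobalMin μ θ)) :
    ∃ u, 0 < meanLcDiff μ u - u ^ 2 / (2 * θ) := by
  rcases h with h | ⟨-, h⟩
  · set q := meanSechSq μ
    have hgap : 0 < q - 1 / θ := by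
      rw [sub_pos, div_lt_iff₀ hθ]; linarith
    set w := q - 1 / θ with hw
    obtain ⟨u, hu⟩ := Real.sinh_surjective (√w)
    have hu2 : Real.sinh u ^ 2 = w := by rw [hu, Real.sq_sqrt hgap.le]
    refine ⟨u, ?_⟩
    have h1 := le_meanLcDiff hμ u
    have h2 := sq_le_sinh_sq u
    rw [hu2] at h1 h2
    have h3 : u ^ 2 / (2 * θ) ≤ w / (2 * θ) := by gcongr
    have h4 : w / (2 * θ) = (1 / θ) * w / 2 := by field_simp
    have h5 : q = w + 1 / θ := by rw [hw]; ring
    change (q * w - w ^ 2 / 2) / 2 ≤ _ at h1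
    rw [h5] at h1
    nlinarith [mul_pos hgap hgap]
  · simp only [ZeroIsGlobalMin, not_forall, not_le] at h
    obtain ⟨x, hx⟩ := h
    refine ⟨√θ * x, ?_⟩
    have h1 := freeEnergy_zero_sub (θ := θ) hint x
    have h2 : (√θ * x) ^ 2 / (2 * θ) = x ^ 2 / 2 := by
      rw [mul_pow, Real.sq_sqrt hθ.le]; field_simp
    rw [h2]; linarith

theorem meanLcDiff_le_of_zeroIsGlobalMin (hint : Integrable (fun h : ℝ => h) μ) (hθ : 0 < θ)
    (h : ZeroIsGlobalMin μ θ) (u : ℝ) : meanLcDiff μ u ≤ u ^ 2 / (2 * θ) := by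
  have h1 := freeEnergy_zero_sub (θ := θ) hint (u / √θ)
  have h2 := h (u / √θ)
  have h3 : √θ ≠ 0 := (Real.sqrt_pos.mpr hθ).ne'
  rw [mul_div_cancel₀ _ h3, div_pow, Real.sq_sqrt hθ.le] at h1
  have : u ^ 2 / θ / 2 = u ^ 2 / (2 * θ) := by field_simp
  linarith

/-! ### Lower bounds for the mean energy -/

variable {n : ℕ} {S : Finset (Fin n)}

theorem logLaplace_eq_siteSum (h : Fin n → ℝ) (u : ℝ) : logLaplace S h u = siteSum (lcDiff u) S h :=
  rfl

theorem abs_energy_le (σ : Config n) : |energy S σ| ≤ S.card := by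
  rw [abs_of_nonneg (energy_nonneg S σ)]; exact (energy_mem S σ).2

theorem le_mean_energy (hθ : 0 < θ) (hS : S.Nonempty) (u : ℝ) :
    2 / θ * (S.card * (meanLcDiff μ u - u ^ 2 / (2 * θ)))
      ≤ ∫ σ, energy S σ ∂(configLaw μ θ S) := by
  rw [integral_configLaw]
  have hI : Integrable (fun h => siteSum (lcDiff u) S h) (fieldLaw n μ) :=
    integrable_of_abs_le (measurable_siteSum (measurable_lcDiff u) S)
      (abs_siteSum_le (abs_lcDiff_le u) S)
  have h1 : ∫ h, 2 / θ * (siteSum (lcDiff u) S h - S.card * (u ^ 2 / (2 * θ))) ∂(fieldLaw n μ)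
      ≤ ∫ h, gibbsMean θ S h (energy S) ∂(fieldLaw n μ) := by
    refine integral_mono ((hI.sub (integrable_const _)).const_mul _)
      (integrable_gibbsMean abs_energy_le) fun h => ?_
    have h1 := le_log_partition (h := h) hθ hS u
    have h2 := log_partition_le (S := S) (h := h) hθ.le
    rw [logLaplace_eq_siteSum] at h1
    have h3 := mul_le_mul_of_nonneg_left (h1.trans h2) (by positivity : 0 ≤ 2 / θ)
    have h4 : 2 / θ * (θ / 2 * gibbsMean θ S h (energy S)) = gibbsMean θ S h (energy S) := by
      field_simp
    rwa [h4] at h3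
  rw [integral_const_mul, integral_sub hI (integrable_const _),
    integral_siteSum (measurable_lcDiff u) (abs_lcDiff_le u)] at h1
  simp only [integral_const, probReal_univ, smul_eq_mul, one_mul] at h1
  rw [mul_sub]
  exact h1

theorem mean_energy_low_temperature (hμ : μ.map (fun h => -h) = μ)
    (hint : Integrable (fun h : ℝ => h) μ) (hθ : 0 < θ)
    (h : 1 < θ * meanSechSq μ ∨ (θ * meanSechSq μ = 1 ∧ ¬ ZeroIsGlobalMin μ θ)) :
    ∃ c, 0 < c ∧ ∀ᶠ k : ℕ in atTop, ∀ (n : ℕ) (S : Finset (Fin n)), S.card = k →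
      c * k / √((fun _ => 1 : ℕ → ℝ) k) ≤ ∫ σ, energy S σ ∂(configLaw μ θ S) - 1 := by
  obtain ⟨u, hu⟩ := exists_meanLcDiff_gt hμ hint hθ h
  set d := meanLcDiff μ u - u ^ 2 / (2 * θ) with hd
  refine ⟨d / θ, by positivity, ?_⟩
  filter_upwards [eventually_ge_atTop 1, (tendsto_natCast_atTop_atTop (R := ℝ)).eventually_ge_atTop
    (θ / d)] with k hk hk2 n S hS
  have h1 := le_mean_energy (μ := μ) (S := S) hθ (Finset.card_pos.mp (by omega)) u
  rw [hS, ← hd] at h1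
  rw [Real.sqrt_one, div_one]
  have h2 : 1 ≤ d / θ * k := by
    rw [div_le_iff₀ hu] at hk2
    rw [div_mul_eq_mul_div, le_div_iff₀ hθ]; linarith
  have h3 : 2 / θ * (k * d) = 2 * (d / θ * k) := by ring
  linarith

end


/-! ### A bound at all temperatures -/

section

variable {n : ℕ} {μ : Measure ℝ} [IsProbabilityMeasure μ] {θ : ℝ} {S : Finset (Fin n)}

theorem continuous_partition : Continuous fun h => partition θ S h := by
  have h1 : ∀ b, Continuous fun x => siteProb x b := fun b => by
    unfold siteProb
    exact (Real.continuous_exp.comp (continuous_id.mul continuous_const)).div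
      (continuous_const.mul Real.continuous_cosh) fun x =>
      (mul_pos two_pos (Real.cosh_pos x)).ne'
  unfold partition avg
  exact continuous_finsetSum _ fun σ _ => (continuous_finsetProd _ fun i _ =>
    (h1 (σ i)).comp (continuous_apply i)).mul continuous_const

theorem abs_log_partition_le (hθ : 0 ≤ θ) (h : Fin n → ℝ) :
    |Real.log (partition θ S h)| ≤ θ / 2 * S.card := by
  rw [abs_of_nonneg (Real.log_nonneg (one_le_partition hθ))]
  refine (log_partition_le hθ).trans (mul_le_mul_of_nonneg_left ?_ (by positivity))
  exact (le_abs_self _).trans (abs_gibbsMean_le abs_energy_le h)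

theorem integrable_log_partition (hθ : 0 ≤ θ) :
    Integrable (fun h => Real.log (partition θ S h)) (fieldLaw n μ) :=
  integrable_of_abs_le (continuous_partition.log fun _ =>
    (zero_lt_one.trans_le (one_le_partition hθ)).ne').measurable (abs_log_partition_le hθ)

theorem avg_energy (h : Fin n → ℝ) : avg h (energy S)
    = (siteSum Real.tanh S h ^ 2 + siteSum (fun x => 1 / Real.cosh x ^ 2) S h) / S.card := by
  have e : energy S = fun σ => (S.card : ℝ)⁻¹ * mag S σ ^ 2 := funext fun σ => by
    rw [energy]; ring
  rw [e, avg_const_mul, avg_mag_sq]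
  simp only [one_sub_tanh_sq, siteSum]
  ring

theorem le_avg_energy_variance (hS : S.Nonempty) (h : Fin n → ℝ) :
    2 * (siteSum (fun x => 1 / Real.cosh x ^ 2) S h / S.card) ^ 2 - 2 / S.card
      ≤ avg h (fun σ => energy S σ ^ 2) - avg h (energy S) ^ 2 := by
  have hk : (0 : ℝ) < S.card := by exact_mod_cast hS.card_pos
  have h1 := le_variance_mag h S 0
  simp only [zero_mul, add_zero, one_sub_tanh_sq] at h1
  have e1 : energy S = fun σ => (S.card : ℝ)⁻¹ * mag S σ ^ 2 := funext fun σ => by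
    rw [energy]; ring
  have e2 : (fun σ => energy S σ ^ 2) = fun σ => ((S.card : ℝ)⁻¹) ^ 2 * (mag S σ ^ 2) ^ 2 :=
    funext fun σ => by rw [energy]; ring
  have h2 : (∑ i ∈ S, (1 / Real.cosh (h i) ^ 2) ^ 2 : ℝ) ≤ (S.card : ℝ) := by
    calc _ ≤ ∑ i ∈ S, (1 : ℝ) := Finset.sum_le_sum fun i _ => by
          have := sech_sq_mem (h i)
          nlinarith
      _ = _ := by simp
  have h3 : avg h (fun σ => energy S σ ^ 2) - avg h (energy S) ^ 2 = ((S.card : ℝ)⁻¹) ^ 2 *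
      (avg h (fun σ => (mag S σ ^ 2) ^ 2) - avg h (fun σ => mag S σ ^ 2) ^ 2) := by
    rw [e2, e1, avg_const_mul, avg_const_mul]; ring
  rw [h3]
  refine le_trans ?_ (mul_le_mul_of_nonneg_left h1 (by positivity))
  simp only [siteSum]
  set Q := ∑ i ∈ S, 1 / Real.cosh (h i) ^ 2
  have h4 : ((S.card : ℝ)⁻¹) ^ 2 * (2 * (Q ^ 2 - S.card)) = 2 * (Q / S.card) ^ 2 - 2 / S.card := by
    field_simp
  rw [← h4]
  gcongr

theorem mean_energy_gt_one (hμ : μ.map (fun h => -h) = μ) (hθ : 0 < θ) :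
    ∃ c, 0 < c ∧ ∀ᶠ k : ℕ in atTop, ∀ (n : ℕ) (S : Finset (Fin n)), S.card = k →
      c ≤ ∫ σ, energy S σ ∂(configLaw μ θ S) - 1 := by
  set q := meanSechSq μ with hq
  have hq0 : 0 < q := meanSechSq_pos
  set B := θ / q ^ 2 with hB
  have hB0 : 0 < B := by positivity
  set c := θ / 2 * (Real.exp (-B) * q ^ 2) with hc
  have hc0 : 0 < c := by positivity
  refine ⟨min 1 c, lt_min one_pos hc0, ?_⟩
  filter_upwards [eventually_ge_atTop 1, (tendsto_natCast_atTop_atTop (R := ℝ)).eventually_ge_atTop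
    (2 / (Real.exp (-B) * q ^ 2))] with k hk hk2 n S hS
  subst hS
  have hSn : S.Nonempty := Finset.card_pos.mp (by omega)
  have hk0 : (0 : ℝ) < S.card := by exact_mod_cast hSn.card_pos
  rw [integral_configLaw]
  have hIlog := integrable_log_partition (μ := μ) (S := S) hθ.le
  set Lm := ∫ h, Real.log (partition θ S h) ∂(fieldLaw n μ) with hLm
  have hIE := integrable_gibbsMean (μ := μ) (θ := θ) (S := S) (abs_energy_le (S := S))
  rcases le_total θ Lm with hcase | hcase
  · have h1 : ∫ h, Real.log (partition θ S h) ∂(fieldLaw n μ)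
        ≤ ∫ h, θ / 2 * gibbsMean θ S h (energy S) ∂(fieldLaw n μ) :=
      integral_mono hIlog (hIE.const_mul _) fun h => log_partition_le hθ.le
    rw [integral_const_mul, ← hLm] at h1
    refine (min_le_left _ _).trans ?_
    set A := ∫ h, gibbsMean θ S h (energy S) ∂(fieldLaw n μ)
    have : θ / 2 * 2 ≤ θ / 2 * A := by linarith
    have := le_of_mul_le_mul_left this (by positivity)
    linarith
  · refine (min_le_right _ _).trans ?_
    set v : ℝ → ℝ := fun x => 1 / Real.cosh x ^ 2 with hv
    have hvm : Measurable v := measurable_sech_sq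
    have hvb : ∀ x, |v x| ≤ 1 := abs_sech_sq_le
    have hIv : Integrable (siteSum v S) (fieldLaw n μ) :=
      integrable_of_abs_le (measurable_siteSum hvm S) (abs_siteSum_le hvb S)
    have hIt := integrable_siteSum_pow (μ := μ) measurable_tanh abs_tanh_le S 2
    have hpt : ∀ h : Fin n → ℝ, (siteSum Real.tanh S h ^ 2 + siteSum v S h) / S.card
        + θ / 2 * (Real.exp (-B) * (2 * (1 + B) * (2 * q * (siteSum v S h / S.card) - q ^ 2)
          - 2 * Real.log (partition θ S h)) - 2 / S.card) ≤ gibbsMean θ S h (energy S) := by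
      intro h
      refine le_trans ?_ (le_gibbsMean_energy hθ.le)
      refine add_le_add (avg_energy h).ge (mul_le_mul_of_nonneg_left ?_ (by positivity))
      have hZ := one_le_partition (S := S) (h := h) hθ.le
      have hlog := Real.log_nonneg hZ
      have h1 := le_avg_energy_variance hSn h
      change 2 * (siteSum v S h / S.card) ^ 2 - 2 / S.card ≤ _ at h1
      have hq1 : |siteSum v S h / S.card| ≤ 1 := by
        rw [abs_div, abs_of_pos hk0, div_le_one hk0]
        simpa using abs_siteSum_le hvb S h
      set Z := partition θ S h
      set L := Real.log Z with hL
      set x := siteSum v S h / S.card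
      have hx2 : x ^ 2 ≤ 1 := by rw [← sq_abs]; exact pow_le_one₀ (abs_nonneg _) hq1
      have hZ0 : 0 < Z := by linarith
      have h2 : 1 / Z = Real.exp (-L) := by rw [Real.exp_neg, hL, Real.exp_log hZ0, one_div]
      have h3 : Real.exp (-B) * (1 + B - L) ≤ Real.exp (-L) := by
        have h4 : Real.exp (-L) = Real.exp (-B) * Real.exp (B - L) := by
          rw [← Real.exp_add]; ring_nf
        rw [h4]
        exact mul_le_mul_of_nonneg_left (by linarith [Real.add_one_le_exp (B - L)])
          (Real.exp_pos _).le
      have h5 : 2 * x ^ 2 / Z - 2 / S.card ≤ (2 * x ^ 2 - 2 / S.card) / Z := by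
        rw [sub_div]
        have : 2 / (S.card : ℝ) / Z ≤ 2 / S.card := div_le_self (by positivity) hZ
        linarith
      refine le_trans ?_ (h5.trans (div_le_div_of_nonneg_right h1 hZ0.le))
      have h6 : 2 * x ^ 2 / Z = 2 * x ^ 2 * Real.exp (-L) := by rw [← h2]; ring
      rw [h6]
      have h7 := mul_le_mul_of_nonneg_left h3 (by positivity : 0 ≤ 2 * x ^ 2)
      have h8 : (1 + B) * (2 * q * x - q ^ 2) ≤ (1 + B) * x ^ 2 :=
        mul_le_mul_of_nonneg_left (by nlinarith [sq_nonneg (x - q)]) (by positivity)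
      have h9 : x ^ 2 * L ≤ L := by nlinarith
      have h10 := mul_le_mul_of_nonneg_left (by linarith : 2 * (1 + B) * (2 * q * x - q ^ 2) - 2 * L
        ≤ 2 * ((1 + B) * x ^ 2) - 2 * (x ^ 2 * L)) (Real.exp_pos (-B)).le
      linarith
    have hI1 : Integrable (fun h => (siteSum Real.tanh S h ^ 2 + siteSum v S h) / S.card)
      (fieldLaw n μ) := (hIt.add hIv).div_const _
    have hI2 : Integrable (fun h => 2 * (1 + B) * (2 * q * (siteSum v S h / S.card) - q ^ 2))
      (fieldLaw n μ) := (((hIv.div_const _).const_mul _).sub (integrable_const _)).const_mul _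
    have hI3 : Integrable (fun h => 2 * Real.log (partition θ S h)) (fieldLaw n μ) :=
      hIlog.const_mul _
    have hI4 : Integrable (fun h => Real.exp (-B) * (2 * (1 + B) *
      (2 * q * (siteSum v S h / S.card) - q ^ 2) - 2 * Real.log (partition θ S h))) (fieldLaw n μ) :=
      (hI2.sub hI3).const_mul _
    have hI5 : Integrable (fun h => Real.exp (-B) * (2 * (1 + B) *
      (2 * q * (siteSum v S h / S.card) - q ^ 2) - 2 * Real.log (partition θ S h)) - 2 / S.card)
      (fieldLaw n μ) := hI4.sub (integrable_const _)
    have hI6 : Integrable (fun h => θ / 2 * (Real.exp (-B) * (2 * (1 + B) *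
      (2 * q * (siteSum v S h / S.card) - q ^ 2) - 2 * Real.log (partition θ S h)) - 2 / S.card))
      (fieldLaw n μ) := hI5.const_mul _
    have h1 := integral_mono (hI1.add hI6) hIE hpt
    simp only [Pi.add_apply] at h1
    have hmean : ∫ h, siteSum v S h ∂(fieldLaw n μ) = S.card * q := integral_siteSum hvm hvb S
    have hmt : ∫ h, siteSum Real.tanh S h ^ 2 ∂(fieldLaw n μ) = S.card * (1 - q) := by
      rw [integral_siteSum_sq measurable_tanh abs_tanh_le
        (integral_eq_zero_of_odd hμ Real.tanh_neg), integral_tanh_sq]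
    have e1 : ∫ h, (siteSum Real.tanh S h ^ 2 + siteSum v S h) / S.card ∂(fieldLaw n μ) = 1 := by
      rw [integral_div, integral_add hIt hIv, hmt, hmean]
      field_simp; ring
    have e2 : ∫ h, 2 * (1 + B) * (2 * q * (siteSum v S h / S.card) - q ^ 2) ∂(fieldLaw n μ)
        = 2 * (1 + B) * q ^ 2 := by
      rw [integral_const_mul, integral_sub ((hIv.div_const _).const_mul _) (integrable_const _),
        integral_const_mul, integral_div, hmean]
      simp only [integral_const, probReal_univ, smul_eq_mul, one_mul]
      field_simp; ring
    have e3 : ∫ h, Real.exp (-B) * (2 * (1 + B) *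
        (2 * q * (siteSum v S h / S.card) - q ^ 2) - 2 * Real.log (partition θ S h)) ∂(fieldLaw n μ)
        = Real.exp (-B) * (2 * (1 + B) * q ^ 2 - 2 * Lm) := by
      rw [integral_const_mul, integral_sub hI2 hI3, e2, integral_const_mul]
    have e4 : ∫ h, ((siteSum Real.tanh S h ^ 2 + siteSum v S h) / S.card
        + θ / 2 * (Real.exp (-B) * (2 * (1 + B) * (2 * q * (siteSum v S h / S.card) - q ^ 2)
          - 2 * Real.log (partition θ S h)) - 2 / S.card)) ∂(fieldLaw n μ)
        = 1 + θ / 2 * (Real.exp (-B) * (2 * (1 + B) * q ^ 2 - 2 * Lm) - 2 / S.card) := by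
      rw [integral_add hI1 hI6, e1, integral_const_mul,
        integral_sub hI4 (integrable_const (2 / (S.card : ℝ))), e3]
      simp only [integral_const, probReal_univ, smul_eq_mul, one_mul]
    have h2 : 1 + θ / 2 * (Real.exp (-B) * (2 * (1 + B) * q ^ 2 - 2 * Lm) - 2 / S.card)
        ≤ ∫ h, gibbsMean θ S h (energy S) ∂(fieldLaw n μ) := e4 ▸ h1
    have h3 : B * q ^ 2 = θ := by rw [hB]; field_simp
    have h4 : 2 / (S.card : ℝ) ≤ Real.exp (-B) * q ^ 2 := by
      rw [div_le_iff₀ (by positivity)] at hk2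
      rw [div_le_iff₀ hk0]; linarith
    have h5 : Real.exp (-B) * (2 * q ^ 2) ≤ Real.exp (-B) * (2 * (1 + B) * q ^ 2 - 2 * Lm) :=
      mul_le_mul_of_nonneg_left (by nlinarith) (Real.exp_pos _).le
    have h6 : θ / 2 * (Real.exp (-B) * q ^ 2)
        ≤ θ / 2 * (Real.exp (-B) * (2 * (1 + B) * q ^ 2 - 2 * Lm) - 2 / S.card) :=
      mul_le_mul_of_nonneg_left (by linarith) (by positivity)
    linarith

end


/-! ### Sums of centered functions of the fields -/

section

variable {n : ℕ} {μ : Measure ℝ} [IsProbabilityMeasure μ] {f : ℝ → ℝ} {B : ℝ}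

theorem siteSum_sub (f g : ℝ → ℝ) (S : Finset (Fin n)) (h : Fin n → ℝ) :
    siteSum (fun x => f x - g x) S h = siteSum f S h - siteSum g S h :=
  Finset.sum_sub_distrib _ _

theorem integral_sq_le_of_abs_le (hf : Measurable f) (hB : ∀ x, |f x| ≤ B) :
    ∫ x, f x ^ 2 ∂μ ≤ B ^ 2 := by
  have hb : ∀ x, f x ^ 2 ≤ B ^ 2 := fun x => by
    rw [← sq_abs]; exact pow_le_pow_left₀ (abs_nonneg _) (hB x) 2
  calc ∫ x, f x ^ 2 ∂μ ≤ ∫ _, B ^ 2 ∂μ := integral_mono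
        (integrable_of_abs_le (B := B ^ 2) (hf.pow_const 2) fun x => by
          rw [abs_of_nonneg (sq_nonneg _)]; exact hb x) (integrable_const _) hb
    _ = B ^ 2 := by simp

theorem integral_abs_siteSum_le (hf : Measurable f) (hB : ∀ x, |f x| ≤ B) (h0 : ∫ x, f x ∂μ = 0)
    (S : Finset (Fin n)) : ∫ h, |siteSum f S h| ∂(fieldLaw n μ) ≤ √S.card * B := by
  refine (integral_abs_le_sqrt (measurable_siteSum hf S) (abs_siteSum_le hB S)).trans ?_
  have hB0 : 0 ≤ B := (abs_nonneg _).trans (hB 0)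
  rw [integral_siteSum_sq hf hB h0, Real.sqrt_mul (Nat.cast_nonneg _)]
  refine mul_le_mul_of_nonneg_left ?_ (Real.sqrt_nonneg _)
  rw [← Real.sqrt_sq hB0]
  exact Real.sqrt_le_sqrt (integral_sq_le_of_abs_le hf hB)

/-- A sum of independent centered bounded variables is of the order of its standard deviation. -/
theorem le_integral_abs_siteSum (hf : Measurable f) (hB : ∀ x, |f x| ≤ B) (hB0 : 0 < B)
    (h0 : ∫ x, f x ∂μ = 0) {κ : ℝ} (hκ : 0 < κ) (hV : κ * B ^ 2 ≤ ∫ x, f x ^ 2 ∂μ)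
    {S : Finset (Fin n)} (hS : S.Nonempty) :
    κ ^ 2 / 4 * (√S.card * B) ≤ ∫ h, |siteSum f S h| ∂(fieldLaw n μ) := by
  have hκ1 : κ ≤ 1 := by
    have := hV.trans (integral_sq_le_of_abs_le hf hB)
    exact le_of_mul_le_mul_right (by linarith : κ * B ^ 2 ≤ 1 * B ^ 2) (by positivity)
  have hk : (0 : ℝ) < S.card := by exact_mod_cast hS.card_pos
  set r := √(S.card : ℝ) with hr
  have hr0 : 0 < r := Real.sqrt_pos.mpr hk
  have hr2 : r ^ 2 = S.card := Real.sq_sqrt hk.le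
  set b := r * B / κ with hb
  have hb0 : 0 < b := by positivity
  have h2 := integral_siteSum_sq hf hB h0 S
  have h4 := integral_siteSum_pow_four_le hf hB h0 S
  have hI2 := integrable_siteSum_pow (μ := μ) hf hB S 2
  have hI4 := integrable_siteSum_pow (μ := μ) hf hB S 4
  have hI1 : Integrable (siteSum f S) (fieldLaw n μ) :=
    integrable_of_abs_le (measurable_siteSum hf S) (abs_siteSum_le hB S)
  have hpt : ∀ h : Fin n → ℝ, 1 / b * siteSum f S h ^ 2 - 1 / (4 * b ^ 3) * siteSum f S h ^ 4
      ≤ |siteSum f S h| := fun h => by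
    set X := siteSum f S h
    set y := |X| / b with hy
    have hy0 : 0 ≤ y := by positivity
    have hX : |X| = b * y := by rw [hy]; field_simp
    have e2 : X ^ 2 = (b * y) ^ 2 := by rw [← hX, sq_abs]
    have e4 : X ^ 4 = (b * y) ^ 4 := by
      rw [show X ^ 4 = (X ^ 2) ^ 2 by ring, e2]; ring
    rw [e2, e4, hX]
    have e5 : 1 / b * (b * y) ^ 2 - 1 / (4 * b ^ 3) * (b * y) ^ 4 = b * (y ^ 2 - y ^ 4 / 4) := by
      field_simp
    rw [e5]
    refine mul_le_mul_of_nonneg_left ?_ hb0.le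
    have h5 : y - 1 ≤ y ^ 3 / 4 := by
      nlinarith [mul_nonneg hy0 (sq_nonneg (y - 1)), sq_nonneg (y - 1)]
    nlinarith
  have h6 := integral_mono ((hI2.const_mul (1 / b)).sub (hI4.const_mul (1 / (4 * b ^ 3)))) hI1.abs hpt
  simp only [Pi.sub_apply] at h6
  rw [integral_sub (hI2.const_mul (1 / b)) (hI4.const_mul (1 / (4 * b ^ 3))), integral_const_mul,
    integral_const_mul, h2] at h6
  refine le_trans ?_ h6
  have h7 : 1 / b * (S.card * (κ * B ^ 2)) - 1 / (4 * b ^ 3) * (3 * S.card ^ 2 * B ^ 4)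
      ≤ 1 / b * (S.card * ∫ x, f x ^ 2 ∂μ)
        - 1 / (4 * b ^ 3) * ∫ h, siteSum f S h ^ 4 ∂(fieldLaw n μ) := by
    refine sub_le_sub ?_ (mul_le_mul_of_nonneg_left h4 (by positivity))
    exact mul_le_mul_of_nonneg_left (mul_le_mul_of_nonneg_left hV hk.le) (by positivity)
  refine le_trans ?_ h7
  have h8 : 1 / b * (S.card * (κ * B ^ 2)) - 1 / (4 * b ^ 3) * (3 * S.card ^ 2 * B ^ 4)
      = (κ ^ 2 - 3 / 4 * κ ^ 3) * (r * B) := by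
    rw [← hr2, hb]; field_simp
  rw [h8]
  refine mul_le_mul_of_nonneg_right ?_ (by positivity)
  nlinarith [mul_pos hκ hκ]

end

section

variable {n : ℕ} {μ : Measure ℝ} {S : Finset (Fin n)}

noncomputable def centeredLcDiff (μ : Measure ℝ) (u h : ℝ) : ℝ := lcDiff u h - meanLcDiff μ u

theorem measurable_centeredLcDiff (u : ℝ) : Measurable (centeredLcDiff μ u) :=
  (measurable_lcDiff u).sub_const _

theorem centeredLcDiff_zero (h : ℝ) : centeredLcDiff μ 0 h = 0 := by
  simp [centeredLcDiff, meanLcDiff, lcDiff_zero]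

theorem siteSum_centeredLcDiff (u : ℝ) (h : Fin n → ℝ) : siteSum (centeredLcDiff μ u) S h
    = siteSum (lcDiff u) S h - S.card * meanLcDiff μ u := by
  have := siteSum_sub (lcDiff u) (fun _ => meanLcDiff μ u) S h
  simp only [siteSum, Finset.sum_const, nsmul_eq_mul] at *
  exact this

/-- The total variation of the centered logarithmic Laplace transform on a grid. -/
noncomputable def gridVariation (μ : Measure ℝ) (S : Finset (Fin n)) (δ : ℝ) (N : ℕ)
    (h : Fin n → ℝ) : ℝ := ∑ j ∈ Finset.range N,
  |siteSum (fun x => centeredLcDiff μ (δ * (j + 1)) x - centeredLcDiff μ (δ * j) x) S h|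

theorem abs_siteSum_le_gridVariation (δ : ℝ) {N m : ℕ} (hm : m ≤ N) (h : Fin n → ℝ) :
    |siteSum (centeredLcDiff μ (δ * m)) S h| ≤ gridVariation μ S δ N h := by
  have h1 := Finset.sum_range_sub (fun j : ℕ => siteSum (centeredLcDiff μ (δ * j)) S h) m
  have h2 : siteSum (centeredLcDiff μ (δ * (0 : ℕ))) S h = 0 := by
    simp [siteSum, centeredLcDiff_zero]
  rw [h2, sub_zero] at h1
  rw [← h1]
  refine (Finset.abs_sum_le_sum_abs _ _).trans ?_
  refine le_trans (Finset.sum_le_sum_of_subset_of_nonneg (Finset.range_mono hm)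
    fun _ _ _ => abs_nonneg _) (le_of_eq (Finset.sum_congr rfl fun j _ => ?_))
  rw [siteSum_sub]
  push_cast
  rfl

theorem gridVariation_nonneg (δ : ℝ) (N : ℕ) (h : Fin n → ℝ) : 0 ≤ gridVariation μ S δ N h :=
  Finset.sum_nonneg fun _ _ => abs_nonneg _

end

section

variable {n : ℕ} {μ : Measure ℝ} [IsProbabilityMeasure μ] {θ : ℝ} {S : Finset (Fin n)}

theorem integral_centeredLcDiff (u : ℝ) : ∫ h, centeredLcDiff μ u h ∂μ = 0 := by
  simp only [centeredLcDiff]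
  rw [integral_sub (integrable_lcDiff u) (integrable_const _)]
  simp [meanLcDiff]

theorem abs_centeredLcDiff_sub_le (u w h : ℝ) :
    |centeredLcDiff μ u h - centeredLcDiff μ w h| ≤ 2 * |u - w| := by
  have h1 : |meanLcDiff μ u - meanLcDiff μ w| ≤ |u - w| := by
    rw [meanLcDiff, meanLcDiff, ← integral_sub (integrable_lcDiff u) (integrable_lcDiff w)]
    refine abs_integral_le_integral_abs.trans ?_
    calc _ ≤ ∫ _, |u - w| ∂μ := integral_mono
          ((integrable_lcDiff u).sub (integrable_lcDiff w)).abs (integrable_const _)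
          fun h => abs_lcDiff_sub_le u w h
      _ = _ := by simp
  have h2 := abs_lcDiff_sub_le u w h
  have e : centeredLcDiff μ u h - centeredLcDiff μ w h
      = (lcDiff u h - lcDiff w h) - (meanLcDiff μ u - meanLcDiff μ w) := by
    simp only [centeredLcDiff]; ring
  rw [e]
  linarith [abs_sub (lcDiff u h - lcDiff w h) (meanLcDiff μ u - meanLcDiff μ w)]

theorem abs_centeredLcDiff_le (u h : ℝ) : |centeredLcDiff μ u h| ≤ 2 * |u| := by
  simpa [centeredLcDiff_zero] using abs_centeredLcDiff_sub_le (μ := μ) u 0 h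

theorem abs_increment_le (δ : ℝ) (j : ℕ) (x : ℝ) :
    |centeredLcDiff μ (δ * (j + 1)) x - centeredLcDiff μ (δ * j) x| ≤ 2 * |δ| := by
  have := abs_centeredLcDiff_sub_le (μ := μ) (δ * (j + 1)) (δ * j) x
  rwa [show δ * ((j : ℝ) + 1) - δ * j = δ by ring] at this

theorem integrable_abs_increment (δ : ℝ) (j : ℕ) : Integrable (fun h => |siteSum (fun x =>
    centeredLcDiff μ (δ * (j + 1)) x - centeredLcDiff μ (δ * j) x) S h|) (fieldLaw n μ) :=
  (integrable_of_abs_le (measurable_siteSum ((measurable_centeredLcDiff _).sub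
    (measurable_centeredLcDiff _)) S) (abs_siteSum_le (abs_increment_le δ j) S)).abs

theorem integrable_gridVariation (δ : ℝ) (N : ℕ) :
    Integrable (gridVariation μ S δ N) (fieldLaw n μ) :=
  integrable_finsetSum _ fun j _ => integrable_abs_increment δ j

theorem integral_gridVariation_le (δ : ℝ) (N : ℕ) :
    ∫ h, gridVariation μ S δ N h ∂(fieldLaw n μ) ≤ N * (√S.card * (2 * |δ|)) := by
  simp only [gridVariation]
  rw [integral_finsetSum _ fun j _ => integrable_abs_increment δ j]
  calc _ ≤ ∑ j ∈ Finset.range N, √S.card * (2 * |δ|) := by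
        refine Finset.sum_le_sum fun j _ => integral_abs_siteSum_le
          ((measurable_centeredLcDiff _).sub (measurable_centeredLcDiff _)) (abs_increment_le δ j) ?_ S
        have hI : ∀ u, Integrable (centeredLcDiff μ u) μ := fun u =>
          integrable_of_abs_le (measurable_centeredLcDiff u) (abs_centeredLcDiff_le u)
        simp only [Pi.sub_apply]
        rw [integral_sub (hI _) (hI _), integral_centeredLcDiff, integral_centeredLcDiff, sub_zero]
    _ = _ := by rw [Finset.sum_const, Finset.card_range, nsmul_eq_mul]

/-! ### Small magnetizations -/

theorem avg_small_mag_le_exp_gridVariation (hint : Integrable (fun h : ℝ => h) μ) (hθ : 0 < θ)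
    (hmin : ZeroIsGlobalMin μ θ) (hS : S.Nonempty) (N : ℕ) (h : Fin n → ℝ) :
    avg h (fun σ => if |mag S σ| ≤ N then Real.exp (θ / 2 * energy S σ) else 0)
      ≤ (2 * N + 1) * Real.exp (gridVariation μ S (θ / S.card) N h
        + gridVariation μ S (-(θ / S.card)) N h) := by
  refine (avg_small_mag_le hS N).trans ?_
  have hk : (0 : ℝ) < S.card := by exact_mod_cast hS.card_pos
  have h1 : ∀ y ∈ Finset.Icc (-(N : ℤ)) N, Real.exp (logLaplace S h (θ * y / S.card)
        - S.card * ((θ * y / S.card) ^ 2 / (2 * θ))) ≤ Real.exp (gridVariation μ S (θ / S.card) N h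
        + gridVariation μ S (-(θ / S.card)) N h) := by
    intro y hy
    refine Real.exp_le_exp.mpr ?_
    rw [Finset.mem_Icc] at hy
    have h2 := mul_le_mul_of_nonneg_left
      (meanLcDiff_le_of_zeroIsGlobalMin hint hθ hmin (θ * y / S.card)) hk.le
    have h3 := siteSum_centeredLcDiff (μ := μ) (S := S) (θ * y / S.card) h
    rw [← logLaplace_eq_siteSum] at h3
    have h4 : |siteSum (centeredLcDiff μ (θ * y / S.card)) S h|
        ≤ gridVariation μ S (θ / S.card) N h + gridVariation μ S (-(θ / S.card)) N h := by
      have p1 := gridVariation_nonneg (μ := μ) (S := S) (θ / S.card) N h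
      have p2 := gridVariation_nonneg (μ := μ) (S := S) (-(θ / S.card)) N h
      have p3 : y.natAbs ≤ N := by omega
      have p4 := abs_siteSum_le_gridVariation (μ := μ) (S := S) (θ / S.card) p3 h
      have p5 := abs_siteSum_le_gridVariation (μ := μ) (S := S) (-(θ / S.card)) p3 h
      rcases le_total 0 y with hy0 | hy0
      · have e : θ * y / S.card = θ / S.card * (y.natAbs : ℝ) := by
          rw [Nat.cast_natAbs, abs_of_nonneg hy0]; ring
        rw [e]; linarith
      · have e : θ * y / S.card = -(θ / S.card) * (y.natAbs : ℝ) := by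
          rw [Nat.cast_natAbs, abs_of_nonpos hy0]; push_cast; ring
        rw [e]; linarith
    linarith [le_abs_self (siteSum (centeredLcDiff μ (θ * y / S.card)) S h)]
  refine (Finset.sum_le_card_nsmul _ _ _ h1).trans (le_of_eq ?_)
  rw [nsmul_eq_mul, Int.card_Icc]
  congr 1
  have : ((N : ℤ) + 1 - -(N : ℤ)).toNat = 2 * N + 1 := by omega
  rw [this]; push_cast; ring

theorem le_gibbsMean_energy_of_small_mag (hθ : 0 ≤ θ) (hS : S.Nonempty) (N : ℕ) (h : Fin n → ℝ) :
    (N : ℝ) ^ 2 / S.card * (1 - avg h (fun σ => if |mag S σ| ≤ N then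
      Real.exp (θ / 2 * energy S σ) else 0) / partition θ S h) ≤ gibbsMean θ S h (energy S) := by
  have hk : (0 : ℝ) < S.card := by exact_mod_cast hS.card_pos
  have hZ : 0 < partition θ S h := zero_lt_one.trans_le (one_le_partition hθ)
  rw [gibbsMean_eq, one_sub_div hZ.ne', ← mul_div_assoc]
  refine div_le_div_of_nonneg_right ?_ hZ.le
  rw [partition, ← avg_sub, ← avg_const_mul]
  refine avg_mono h fun σ => ?_
  split_ifs with hc
  · rw [sub_self, mul_zero]
    exact mul_nonneg (energy_nonneg S σ) (Real.exp_pos _).le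
  · rw [sub_zero]
    refine mul_le_mul_of_nonneg_right ?_ (Real.exp_pos _).le
    rw [energy]
    refine div_le_div_of_nonneg_right ?_ hk.le
    rw [← sq_abs (mag S σ)]
    exact pow_le_pow_left₀ (Nat.cast_nonneg _) (not_le.mp hc).le 2

/-- A truncation of `1 - exp (-d)` from below. -/
theorem div_sub_sq_div_le {d l M p : ℝ} (hM : 1 ≤ M) (hdl : d ≤ |l|) (hp : p ≤ 1)
    (hpd : p ≤ Real.exp (-d)) : d / M - l ^ 2 / M ^ 2 ≤ 1 - p := by
  have hM0 : 0 < M := by linarith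
  have hl : 0 ≤ l ^ 2 / M ^ 2 := by positivity
  rcases le_total d 0 with hd | hd
  · have := div_nonpos_of_nonpos_of_nonneg hd hM0.le
    linarith
  · have h1 : d ^ 2 / M ^ 2 ≤ l ^ 2 / M ^ 2 := by
      rw [← sq_abs l]; gcongr
    have h2 : Real.exp (-d) ≤ 1 / (1 + d) := by
      rw [Real.exp_neg, ← one_div]
      exact one_div_le_one_div_of_le (by linarith) (by linarith [Real.add_one_le_exp d])
    have h3 : d / M - d ^ 2 / M ^ 2 ≤ 1 - 1 / (1 + d) := by
      have e : 1 - 1 / (1 + d) = d / (1 + d) := by field_simp; ring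
      have e2 : d / M - d ^ 2 / M ^ 2 = d * (M - d) / M ^ 2 := by field_simp
      rw [e, e2, div_le_div_iff₀ (by positivity) (by linarith), mul_assoc]
      refine mul_le_mul_of_nonneg_left ?_ hd
      nlinarith [sq_nonneg (M - d)]
    linarith

theorem le_abs_lcDiff_sub_lcDiff_neg {u : ℝ} (hu : 0 ≤ u) (hu1 : u ≤ 1) (h : ℝ) :
    u / 2 * |Real.tanh h| ≤ |lcDiff u h - lcDiff (-u) h| := by
  have key : ∀ h, 0 ≤ h → u / 2 * Real.tanh h ≤ lcDiff u h - lcDiff (-u) h := by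
    intro h hh
    have hc := Real.cosh_pos h
    have hcu := Real.cosh_pos u
    have hsu := Real.self_le_sinh_iff.mpr hu
    have hs := Real.sinh_nonneg_iff.mpr hh
    have hcu2 : Real.cosh u ≤ 2 := by
      have h1 : Real.cosh u ≤ Real.cosh 1 := by
        rw [Real.cosh_le_cosh, abs_of_nonneg hu, abs_one]; exact hu1
      have h2 := Real.cosh_sq 1
      have h3 := Real.cosh_add_sinh 1
      have h4 := Real.exp_one_lt_d9
      have h5 : Real.cosh 1 - Real.sinh 1 ≤ 1 := by
        rw [Real.cosh_sub_sinh]; exact Real.exp_le_one_iff.mpr (by norm_num)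
      linarith
    have e : lcDiff u h - lcDiff (-u) h
        = Real.log (Real.cosh (h + u) / Real.cosh (h + -u)) := by
      rw [Real.log_div (Real.cosh_pos _).ne' (Real.cosh_pos _).ne']
      simp only [lcDiff]; ring
    have hp := Real.cosh_pos (h + u)
    have hm := Real.cosh_pos (h + -u)
    rw [e]
    refine le_trans ?_ (Real.one_sub_inv_le_log_of_pos (div_pos hp hm))
    have e2 : 1 - (Real.cosh (h + u) / Real.cosh (h + -u))⁻¹
        = 2 * (Real.sinh h * Real.sinh u) / Real.cosh (h + u) := by
      rw [inv_div, one_sub_div hp.ne', Real.cosh_add, Real.cosh_add, Real.cosh_neg, Real.sinh_neg]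
      ring
    rw [e2, tanh_eq_div, div_mul_div_comm, div_le_div_iff₀ (by positivity) hp, Real.cosh_add]
    have h1 : Real.sinh h * Real.sinh u ≤ Real.cosh h * Real.cosh u :=
      mul_le_mul (Real.sinh_lt_cosh h).le (Real.sinh_lt_cosh u).le (by linarith) hc.le
    have h2 : u * Real.sinh h * (Real.cosh h * Real.cosh u + Real.sinh h * Real.sinh u)
        ≤ u * Real.sinh h * (2 * (Real.cosh h * 2)) := by
      refine mul_le_mul_of_nonneg_left ?_ (by positivity)
      nlinarith
    have h3 : u * Real.sinh h * (2 * (Real.cosh h * 2))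
        ≤ Real.sinh u * Real.sinh h * (2 * (Real.cosh h * 2)) := by gcongr
    linarith
  rcases le_total 0 h with hh | hh
  · rw [abs_of_nonneg (tanh_eq_div h ▸ div_nonneg (Real.sinh_nonneg_iff.mpr hh) (Real.cosh_pos h).le)]
    exact (key h hh).trans (le_abs_self _)
  · have h1 := key (-h) (by linarith)
    rw [lcDiff_neg, lcDiff_neg, neg_neg, Real.tanh_neg] at h1
    have h2 : Real.tanh h ≤ 0 := by
      rw [tanh_eq_div]
      exact div_nonpos_of_nonpos_of_nonneg (Real.sinh_nonpos_iff.mpr hh) (Real.cosh_pos h).le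
    rw [abs_of_nonpos h2, abs_sub_comm]
    exact h1.trans (le_abs_self _)

/-- The mean energy is bounded below through the fluctuations of the field at one point `u`. -/
theorem le_mean_energy_of_fluctuation (hμ : μ.map (fun h => -h) = μ)
    (hint : Integrable (fun h : ℝ => h) μ) (hθ : 0 < θ) (hmin : ZeroIsGlobalMin μ θ)
    (hκ : meanSechSq μ < 1) (hS : S.Nonempty) {u : ℝ} (hu : 0 < u) (hu1 : u ≤ 1) (N : ℕ) {M : ℝ}
    (hM : 1 ≤ M) {d : ℝ} (hd : d = S.card * (u ^ 2 / (2 * θ) - meanLcDiff μ u)) :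
    (N : ℝ) ^ 2 / S.card *
      (((1 - meanSechSq μ) ^ 2 / 1024 * (√S.card * u) - d - Real.log (2 * N + 1)
        - N * (√S.card * (4 * (θ / S.card)))) / M - (4 * (S.card * (2 * u) ^ 2) + 2 * d ^ 2) / M ^ 2)
      ≤ ∫ σ, energy S σ ∂(configLaw μ θ S) := by
  have hk : (0 : ℝ) < S.card := by exact_mod_cast hS.card_pos
  set A : (Fin n → ℝ) → ℝ := siteSum (centeredLcDiff μ u) S with hA
  set A' : (Fin n → ℝ) → ℝ := siteSum (centeredLcDiff μ (-u)) S with hA'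
  set J : (Fin n → ℝ) → ℝ := fun h => gridVariation μ S (θ / S.card) N h
        + gridVariation μ S (-(θ / S.card)) N h with hJ
  set ψ : ℝ → ℝ := fun x => lcDiff u x - lcDiff (-u) x with hψ
  set lN := Real.log (2 * N + 1) with hlN
  have hsym := meanLcDiff_neg hμ u
  have hAA : ∀ h, A h - A' h = siteSum ψ S h := fun h => by
    rw [hA, hA', siteSum_centeredLcDiff, siteSum_centeredLcDiff, hsym, hψ, siteSum_sub]; ring
  have hψm : Measurable ψ := (measurable_lcDiff u).sub (measurable_lcDiff (-u))
  have hψb : ∀ x, |ψ x| ≤ 2 * u := fun x => by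
    have := abs_lcDiff_sub_le u (-u) x
    rw [sub_neg_eq_add, ← two_mul, abs_of_pos (by linarith : 0 < 2 * u)] at this
    exact this
  have hψ0 : ∫ x, ψ x ∂μ = 0 := by
    rw [hψ, integral_sub (integrable_lcDiff u) (integrable_lcDiff (-u))]
    simp only [meanLcDiff] at hsym
    linarith
  have hbound : ∀ v, |v| = u → ∀ x, |centeredLcDiff μ v x| ≤ 2 * u := fun v hv x =>
    hv ▸ abs_centeredLcDiff_le v x
  have hb1 := hbound u (abs_of_pos hu)
  have hb2 := hbound (-u) (by rw [abs_neg, abs_of_pos hu])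
  have hIA : Integrable A (fieldLaw n μ) := integrable_of_abs_le
    (measurable_siteSum (measurable_centeredLcDiff u) S) (abs_siteSum_le hb1 S)
  have hIA' : Integrable A' (fieldLaw n μ) := integrable_of_abs_le
    (measurable_siteSum (measurable_centeredLcDiff (-u)) S) (abs_siteSum_le hb2 S)
  have hIψ : Integrable (siteSum ψ S) (fieldLaw n μ) := integrable_of_abs_le
    (measurable_siteSum hψm S) (abs_siteSum_le hψb S)
  have hIJ : Integrable J (fieldLaw n μ) :=
    (integrable_gridVariation _ N).add (integrable_gridVariation _ N)
  have hIA2 : Integrable (fun h => A h ^ 2) (fieldLaw n μ) :=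
    integrable_siteSum_pow (measurable_centeredLcDiff u) hb1 S 2
  have hIA2' : Integrable (fun h => A' h ^ 2) (fieldLaw n μ) :=
    integrable_siteSum_pow (measurable_centeredLcDiff (-u)) hb2 S 2
  have zA : ∫ h, A h ∂(fieldLaw n μ) = 0 := by
    rw [hA, integral_siteSum (measurable_centeredLcDiff u) hb1, integral_centeredLcDiff, mul_zero]
  have zA' : ∫ h, A' h ∂(fieldLaw n μ) = 0 := by
    rw [hA', integral_siteSum (measurable_centeredLcDiff (-u)) hb2, integral_centeredLcDiff,
      mul_zero]
  have sA : ∫ h, A h ^ 2 ∂(fieldLaw n μ) ≤ S.card * (2 * u) ^ 2 := by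
    rw [hA, integral_siteSum_sq (measurable_centeredLcDiff u) hb1 (integral_centeredLcDiff u)]
    exact mul_le_mul_of_nonneg_left
      (integral_sq_le_of_abs_le (measurable_centeredLcDiff u) hb1) hk.le
  have sA' : ∫ h, A' h ^ 2 ∂(fieldLaw n μ) ≤ S.card * (2 * u) ^ 2 := by
    rw [hA', integral_siteSum_sq (measurable_centeredLcDiff (-u)) hb2 (integral_centeredLcDiff (-u))]
    exact mul_le_mul_of_nonneg_left
      (integral_sq_le_of_abs_le (measurable_centeredLcDiff (-u)) hb2) hk.le
  have eJ : ∫ h, J h ∂(fieldLaw n μ) ≤ N * (√S.card * (4 * (θ / S.card))) := by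
    rw [hJ, integral_add (integrable_gridVariation _ N) (integrable_gridVariation _ N)]
    have h1 := integral_gridVariation_le (μ := μ) (S := S) (θ / S.card) N
    have h2 := integral_gridVariation_le (μ := μ) (S := S) (-(θ / S.card)) N
    rw [abs_of_pos (by positivity)] at h1
    rw [abs_neg, abs_of_pos (by positivity)] at h2
    linarith
  have eψ : (1 - meanSechSq μ) ^ 2 / 512 * (√S.card * u)
      ≤ ∫ h, |siteSum ψ S h| ∂(fieldLaw n μ) := by
    have h1 : (1 - meanSechSq μ) / 16 * (2 * u) ^ 2 ≤ ∫ x, ψ x ^ 2 ∂μ := by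
      have h2 : ∫ x, (u / 2) ^ 2 * Real.tanh x ^ 2 ∂μ ≤ ∫ x, ψ x ^ 2 ∂μ := by
        refine integral_mono ((integrable_of_abs_le (B := 1) (measurable_tanh.pow_const 2)
          fun x => ?_).const_mul _) (integrable_of_abs_le (B := (2 * u) ^ 2) (hψm.pow_const 2)
          fun x => ?_) fun x => ?_
        · rw [abs_pow]; exact pow_le_one₀ (abs_nonneg _) (abs_tanh_le x)
        · rw [abs_pow]; exact pow_le_pow_left₀ (abs_nonneg _) (hψb x) 2
        · show (u / 2) ^ 2 * Real.tanh x ^ 2 ≤ ψ x ^ 2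
          rw [← sq_abs (ψ x), ← sq_abs (Real.tanh x), ← mul_pow]
          exact pow_le_pow_left₀ (by positivity) (le_abs_lcDiff_sub_lcDiff_neg hu.le hu1 x) 2
      rw [integral_const_mul, integral_tanh_sq] at h2
      refine le_trans (le_of_eq ?_) h2
      ring
    have h3 := le_integral_abs_siteSum hψm hψb (by linarith) hψ0
      (div_pos (sub_pos.mpr hκ) (by norm_num)) h1 hS
    refine le_trans (le_of_eq ?_) h3
    ring
  set P : ℝ := (N : ℝ) ^ 2 / S.card with hP
  have hP0 : 0 ≤ P := by positivity
  have hpt : ∀ h, P / M * ((A h + A' h + |siteSum ψ S h|) / 2 - J h)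
      - 2 * P / M ^ 2 * (A h ^ 2 + A' h ^ 2) - P * ((d + lN) / M + 2 * d ^ 2 / M ^ 2)
      ≤ gibbsMean θ S h (energy S) := by
    intro h
    set l := (A h + A' h + |siteSum ψ S h|) / 2 - d with hl
    have hZ0 : 0 < partition θ S h := zero_lt_one.trans_le (one_le_partition hθ.le)
    have hmax : l = max (A h - d) (A' h - d) := by
      rw [hl, ← hAA]
      rcases le_total (A h) (A' h) with h1 | h1
      · rw [max_eq_right (by linarith), abs_of_nonpos (by linarith)]; ring
      · rw [max_eq_left (by linarith), abs_of_nonneg (by linarith)]; ring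
    have hlZ : l ≤ Real.log (partition θ S h) := by
      rw [hmax]
      have h1 := le_log_partition (h := h) hθ hS u
      have h2 := le_log_partition (h := h) hθ hS (-u)
      rw [logLaplace_eq_siteSum] at h1 h2
      have h3 := siteSum_centeredLcDiff (μ := μ) (S := S) u h
      have h4 := siteSum_centeredLcDiff (μ := μ) (S := S) (-u) h
      rw [hsym] at h4
      rw [neg_sq] at h2
      refine max_le ?_ ?_
      · rw [hA, h3, hd]; linarith
      · rw [hA', h4, hd]; linarith
    have hl2 : l ^ 2 ≤ 2 * d ^ 2 + 2 * (A h ^ 2 + A' h ^ 2) := by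
      rcases max_choice (A h - d) (A' h - d) with h1 | h1 <;> rw [hmax, h1] <;>
        nlinarith [sq_nonneg (A h + d), sq_nonneg (A' h + d), sq_nonneg (A h), sq_nonneg (A' h)]
    have hsm := avg_small_mag_le_exp_gridVariation hint hθ hmin hS N h
    change _ ≤ (2 * N + 1) * Real.exp (J h) at hsm
    refine le_trans ?_ (le_gibbsMean_energy_of_small_mag hθ.le hS N h)
    rw [← hP]
    set W := avg h (fun σ => if |mag S σ| ≤ N then Real.exp (θ / 2 * energy S σ) else 0)
    have hJ0 : 0 ≤ J h := add_nonneg (gridVariation_nonneg _ N h) (gridVariation_nonneg _ N h)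
    have hlN0 : 0 ≤ lN := Real.log_nonneg (by linarith [Nat.cast_nonneg (α := ℝ) N])
    have hW1 : W / partition θ S h ≤ 1 := by
      rw [div_le_one hZ0]
      refine avg_mono h fun σ => ?_
      split_ifs
      · exact le_rfl
      · exact (Real.exp_pos _).le
    have hWd : W / partition θ S h ≤ Real.exp (-(l - lN - J h)) := by
      rw [div_le_iff₀ hZ0]
      refine hsm.trans ?_
      have h1 : Real.exp l ≤ partition θ S h := by
        rw [← Real.exp_log hZ0]; exact Real.exp_le_exp.mpr hlZ
      have h2 : (2 * (N : ℝ) + 1) = Real.exp lN := (Real.exp_log (by positivity)).symm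
      have h3 : (2 * (N : ℝ) + 1) * Real.exp (J h)
          = Real.exp (-(l - lN - J h)) * Real.exp l := by
        rw [h2, ← Real.exp_add, ← Real.exp_add]; ring_nf
      rw [h3]
      exact mul_le_mul_of_nonneg_left h1 (Real.exp_pos _).le
    have h1 := mul_le_mul_of_nonneg_left (div_sub_sq_div_le (l := l) hM
      (by linarith [le_abs_self l]) hW1 hWd) hP0
    refine le_trans ?_ h1
    have h2 : l ^ 2 / M ^ 2 ≤ (2 * d ^ 2 + 2 * (A h ^ 2 + A' h ^ 2)) / M ^ 2 :=
      div_le_div_of_nonneg_right hl2 (by positivity)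
    have h3 := mul_le_mul_of_nonneg_left h2 hP0
    refine le_trans (le_of_eq ?_) ((sub_le_sub_left h3 _).trans (mul_sub P _ _).ge)
    rw [hl]
    have hM0 : M ≠ 0 := by linarith
    field_simp
    ring
  have i1 : Integrable (fun h => (A h + A' h + |siteSum ψ S h|) / 2) (fieldLaw n μ) :=
    ((hIA.add hIA').add hIψ.abs).div_const 2
  have i2 : Integrable (fun h => P / M * ((A h + A' h + |siteSum ψ S h|) / 2 - J h))
    (fieldLaw n μ) := (i1.sub hIJ).const_mul _
  have i3 : Integrable (fun h => 2 * P / M ^ 2 * (A h ^ 2 + A' h ^ 2)) (fieldLaw n μ) :=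
    (hIA2.add hIA2').const_mul _
  have i4 : Integrable (fun h => P / M * ((A h + A' h + |siteSum ψ S h|) / 2 - J h)
      - 2 * P / M ^ 2 * (A h ^ 2 + A' h ^ 2)) (fieldLaw n μ) := i2.sub i3
  have e1 : ∫ h, (A h + A' h + |siteSum ψ S h|) / 2 ∂(fieldLaw n μ)
      = (∫ h, |siteSum ψ S h| ∂(fieldLaw n μ)) / 2 := by
    have i0 : Integrable (fun h => A h + A' h) (fieldLaw n μ) := hIA.add hIA'
    rw [integral_div, integral_add i0 hIψ.abs, integral_add hIA hIA', zA, zA']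
    ring
  have hmain := integral_mono (i4.sub (integrable_const (P * ((d + lN) / M + 2 * d ^ 2 / M ^ 2))))
    (integrable_gibbsMean (abs_energy_le (S := S))) hpt
  simp only [Pi.sub_apply] at hmain
  rw [integral_sub i4 (integrable_const _), integral_sub i2 i3, integral_const_mul,
    integral_const_mul, integral_sub i1 hIJ, e1, integral_add hIA2 hIA2'] at hmain
  simp only [integral_const, probReal_univ, smul_eq_mul, one_mul] at hmain
  rw [integral_configLaw]
  refine le_trans ?_ hmain
  have hM0 : 0 < M := by linarith
  have b1 := mul_le_mul_of_nonneg_left (sub_le_sub (div_le_div_of_nonneg_right eψ zero_le_two) eJ)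
    (div_nonneg hP0 hM0.le)
  have b2 := mul_le_mul_of_nonneg_left (add_le_add sA sA') (by positivity : 0 ≤ 2 * P / M ^ 2)
  refine le_trans (le_of_eq ?_) (sub_le_sub_right (sub_le_sub b1 b2) _)
  field_simp
  ring

end


/-! ### The critical temperature -/

theorem exists_freeEnergy_le_of_hasFlatness {μ : Measure ℝ} {θ : ℝ} {τ : ℕ} (h : HasFlatness μ θ τ) :
    ∃ a, 0 < a ∧ ∀ᶠ x in 𝓝 (0 : ℝ), freeEnergy μ θ x - freeEnergy μ θ 0 ≤ a * x ^ (2 * τ) := by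
  obtain ⟨-, ha, hO⟩ := h
  set b := iteratedDeriv (2 * τ) (freeEnergy μ θ) 0 / ((2 * τ).factorial : ℝ) with hb
  have hb0 : 0 < b := div_pos ha (by positivity)
  obtain ⟨C, hC, hO⟩ := hO.exists_pos
  refine ⟨b + C, by positivity, ?_⟩
  have h1 : ∀ᶠ x in 𝓝 (0 : ℝ), |x| ≤ 1 := by
    filter_upwards [Metric.closedBall_mem_nhds (0 : ℝ) one_pos] with x hx
    simpa using hx
  filter_upwards [hO.bound, h1] with x hx hx1
  rw [Real.norm_eq_abs, Real.norm_eq_abs, abs_pow, pow_succ] at hx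
  have h2 : |x| ^ (2 * τ) = x ^ (2 * τ) := by rw [pow_mul, sq_abs, ← pow_mul]
  have h3 : 0 ≤ x ^ (2 * τ) := h2 ▸ by positivity
  rw [h2] at hx
  have h4 := (le_abs_self _).trans hx
  have h5 : C * (x ^ (2 * τ) * |x|) ≤ C * x ^ (2 * τ) :=
    mul_le_mul_of_nonneg_left (mul_le_of_le_one_right h3 hx1) hC.le
  linarith
section

variable {μ : Measure ℝ} [IsProbabilityMeasure μ] {θ : ℝ}

theorem meanSechSq_lt_one (h : μ ≠ Measure.dirac 0) : meanSechSq μ < 1 := by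
  refine lt_of_le_of_ne meanSechSq_le_one fun h1 => h ?_
  have h2 : ∫ x, Real.tanh x ^ 2 ∂μ = 0 := by rw [integral_tanh_sq, h1, sub_self]
  have hI : Integrable (fun x => Real.tanh x ^ 2) μ :=
    integrable_of_abs_le (B := 1) (measurable_tanh.pow_const 2) fun x => by
      rw [abs_pow]; exact pow_le_one₀ (abs_nonneg _) (abs_tanh_le x)
  rw [integral_eq_zero_iff_of_nonneg (fun x => sq_nonneg _) hI] at h2
  have h3 : ∀ᵐ x ∂μ, x = 0 := by
    filter_upwards [h2] with x hx
    have h4 : Real.tanh x = 0 := by simpa using hx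
    rw [tanh_eq_div, div_eq_zero_iff] at h4
    exact Real.sinh_eq_zero.mp (h4.resolve_right (Real.cosh_pos x).ne')
  have h4 : μ.map (fun x => x) = μ.map (fun _ => (0 : ℝ)) := Measure.map_congr h3
  rw [Measure.map_id', Measure.map_const, measure_univ, one_smul] at h4
  exact h4

theorem le_mean_energy_of_scale (hμ : μ.map (fun h => -h) = μ)
    (hint : Integrable (fun h : ℝ => h) μ) (hθ : 0 < θ) (hmin : ZeroIsGlobalMin μ θ)
    (hκ : meanSechSq μ < 1) {τ : ℕ} (hτ : HasFlatness μ θ τ) :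
    ∃ ρ δ c p₀ K₀ : ℝ, 0 < ρ ∧ 0 < δ ∧ 0 < c ∧ 0 < p₀ ∧
      ∀ (n : ℕ) (S : Finset (Fin n)) (p K : ℝ), S.Nonempty → 0 < p → p ≤ p₀ → K = √S.card * p →
        S.card * p ^ (2 * τ) = K → K₀ ≤ K → 2 ≤ ρ * (√S.card * K) →
        Real.log (2 * (ρ * (√S.card * K)) + 1) ≤ δ * K →
        c * K ^ 2 ≤ ∫ σ, energy S σ ∂(configLaw μ θ S) := by
  obtain ⟨a, ha, hflat⟩ := exists_freeEnergy_le_of_hasFlatness hτ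
  obtain ⟨r, hr, hball⟩ := Metric.eventually_nhds_iff.mp hflat
  set b := (1 - meanSechSq μ) ^ 2 / 1024 with hb
  have hb0 : 0 < b := by have := sub_pos.mpr hκ; positivity
  have hs : 0 < √θ := Real.sqrt_pos.mpr hθ
  set ε := min 1 (b * √θ / (4 * a)) with hε
  have hε0 : 0 < ε := lt_min one_pos (by positivity)
  set g := √θ * ε with hg
  have hg0 : 0 < g := by positivity
  set w := b * g / 4 with hw
  have hw0 : 0 < w := by positivity
  set V := 16 * g ^ 2 + 2 * w ^ 2 with hV
  have hV0 : 0 < V := by positivity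
  set ρ := w / (4 * θ) with hρ
  have hρ0 : 0 < ρ := by positivity
  refine ⟨ρ, w, ρ ^ 2 / 4 * (w ^ 2 / (4 * V)), min (r / 2) (1 / √θ), w / (2 * V), hρ0, hw0,
    by positivity, by positivity, fun n S p K hS hp hpp hK hKp hK0 hbig hlog => ?_⟩
  have hk : (0 : ℝ) < S.card := by exact_mod_cast hS.card_pos
  have hsk : 0 < √(S.card : ℝ) := Real.sqrt_pos.mpr hk
  have hsk2 : √(S.card : ℝ) ^ 2 = S.card := Real.sq_sqrt hk.le
  have hKpos : 0 < K := hK ▸ by positivity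
  set u := √θ * (ε * p) with hu
  have hu0 : 0 < u := by positivity
  have hεp : ε * p ≤ p := mul_le_of_le_one_left hp.le (min_le_left _ _)
  have hu1 : u ≤ 1 := by
    calc u ≤ √θ * (1 / √θ) :=
          mul_le_mul_of_nonneg_left (hεp.trans (hpp.trans (min_le_right _ _))) hs.le
      _ = 1 := by field_simp
  set N := ⌊ρ * (√S.card * K)⌋₊ with hN
  have hN1 : (N : ℝ) ≤ ρ * (√S.card * K) := Nat.floor_le (by positivity)
  have hN2 : ρ * (√S.card * K) / 2 ≤ N := by
    have := Nat.lt_floor_add_one (ρ * (√S.card * K))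
    rw [← hN] at this
    linarith
  set M := 2 * V / w * K with hM
  have hM0 : 0 < M := by positivity
  have hM1 : 1 ≤ M := by
    calc (1 : ℝ) = 2 * V / w * (w / (2 * V)) := by field_simp
      _ ≤ M := mul_le_mul_of_nonneg_left hK0 (by positivity)
  set d := S.card * (u ^ 2 / (2 * θ) - meanLcDiff μ u) with hd
  have hd0 : 0 ≤ d := mul_nonneg hk.le
    (sub_nonneg.mpr (meanLcDiff_le_of_zeroIsGlobalMin hint hθ hmin u))
  have hdw : d ≤ w * K := by
    have h1 := hball (y := ε * p) (by
      rw [Real.dist_eq, sub_zero, abs_of_pos (by positivity)]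
      linarith [hpp.trans (min_le_left _ _)])
    have h2 := freeEnergy_zero_sub (θ := θ) hint (ε * p)
    have h3 : u ^ 2 / (2 * θ) = (ε * p) ^ 2 / 2 := by
      rw [hu, mul_pow, Real.sq_sqrt hθ.le]; field_simp
    have h4 : u ^ 2 / (2 * θ) - meanLcDiff μ u ≤ a * (ε * p) ^ (2 * τ) := by
      rw [h3]; linarith
    have h5 : ε ^ (2 * τ) ≤ ε ^ 2 :=
      pow_le_pow_of_le_one hε0.le (min_le_left _ _) (by have := hτ.1; omega)
    have h6 : a * ε ^ 2 ≤ w := by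
      have h7 : ε ≤ b * √θ / (4 * a) := min_le_right _ _
      rw [le_div_iff₀ (by positivity)] at h7
      rw [hw, hg]
      nlinarith
    calc d ≤ S.card * (a * (ε * p) ^ (2 * τ)) := mul_le_mul_of_nonneg_left h4 hk.le
      _ = a * ε ^ (2 * τ) * (S.card * p ^ (2 * τ)) := by rw [mul_pow]; ring
      _ = a * ε ^ (2 * τ) * K := by rw [hKp]
      _ ≤ w * K := mul_le_mul_of_nonneg_right
          ((mul_le_mul_of_nonneg_left h5 ha.le).trans h6) hKpos.le
  refine le_trans ?_ (le_mean_energy_of_fluctuation hμ hint hθ hmin hκ hS hu0 hu1 N hM1 hd)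
  rw [← hb]
  have hsu : √S.card * u = g * K := by rw [hu, hg, hK]; ring
  have hlogN : Real.log (2 * N + 1) ≤ w * K :=
    (Real.log_le_log (by positivity) (by linarith)).trans hlog
  have hgrid : N * (√S.card * (4 * (θ / S.card))) ≤ w * K := by
    calc _ ≤ ρ * (√S.card * K) * (√S.card * (4 * (θ / S.card))) := by gcongr
      _ = 4 * (ρ * K * θ) * (√S.card ^ 2 / S.card) := by ring
      _ = w * K := by rw [hsk2, div_self hk.ne', hρ]; field_simp
  have h1 : w * K ≤ b * (√S.card * u) - d - Real.log (2 * N + 1)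
      - N * (√S.card * (4 * (θ / S.card))) := by
    rw [hsu]
    have : b * (g * K) = 4 * (w * K) := by rw [hw]; ring
    linarith
  have h2 : 4 * (S.card * (2 * u) ^ 2) + 2 * d ^ 2 ≤ V * K ^ 2 := by
    have h3 : S.card * (2 * u) ^ 2 = 4 * (g * K) ^ 2 := by
      rw [← hsu]; linear_combination (-4 * u ^ 2) * hsk2
    have h4 : d ^ 2 ≤ (w * K) ^ 2 := pow_le_pow_left₀ hd0 hdw 2
    rw [h3, hV]
    linarith
  have h5 : w ^ 2 / (4 * V) ≤ (b * (√S.card * u) - d - Real.log (2 * N + 1)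
      - N * (√S.card * (4 * (θ / S.card)))) / M - (4 * (S.card * (2 * u) ^ 2) + 2 * d ^ 2) / M ^ 2 := by
    refine le_trans (le_of_eq ?_) (sub_le_sub (div_le_div_of_nonneg_right h1 hM0.le)
      (div_le_div_of_nonneg_right h2 (by positivity)))
    rw [hM]
    field_simp
    ring
  have h6 : ρ ^ 2 / 4 * K ^ 2 ≤ (N : ℝ) ^ 2 / S.card := by
    rw [le_div_iff₀ hk]
    calc ρ ^ 2 / 4 * K ^ 2 * S.card = (ρ * (√S.card * K) / 2) ^ 2 := by
          linear_combination (-(ρ ^ 2 * K ^ 2 / 4)) * hsk2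
      _ ≤ _ := pow_le_pow_left₀ (by positivity) hN2 2
  calc ρ ^ 2 / 4 * (w ^ 2 / (4 * V)) * K ^ 2 = ρ ^ 2 / 4 * K ^ 2 * (w ^ 2 / (4 * V)) := by ring
    _ ≤ _ := mul_le_mul h6 h5 (by positivity) (by positivity)

theorem mean_energy_critical (hμ : μ.map (fun h => -h) = μ)
    (hint : Integrable (fun h : ℝ => h) μ) (hθ : 0 < θ) (hmin : ZeroIsGlobalMin μ θ)
    (hdirac : μ ≠ Measure.dirac 0) {τ : ℕ} (hτ : HasFlatness μ θ τ) :
    ∃ c, 0 < c ∧ ∀ᶠ k : ℕ in atTop, ∀ (n : ℕ) (S : Finset (Fin n)), S.card = k →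
      c * k / √((k : ℝ) ^ (2 / (2 * (τ : ℝ) - 1))) ≤ ∫ σ, energy S σ ∂(configLaw μ θ S) - 1 := by
  rcases Nat.lt_or_ge 1 τ with h2 | h2
  · obtain ⟨ρ, δ, c, p₀, K₀, hρ, hδ, hc, hp₀, hmain⟩ :=
      le_mean_energy_of_scale hμ hint hθ hmin (meanSechSq_lt_one hdirac) hτ
    have hτ2 : (2 : ℝ) ≤ τ := by exact_mod_cast h2
    set s : ℝ := 1 / (2 * (2 * (τ : ℝ) - 1)) with hs
    have hden : 0 < 2 * (2 * (τ : ℝ) - 1) := by linarith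
    have hs0 : 0 < s := by positivity
    have hne : 2 * (τ : ℝ) - 1 ≠ 0 := by linarith
    have hs6 : s ≤ 1 / 6 := by
      rw [hs]; exact one_div_le_one_div_of_le (by norm_num) (by linarith)
    have hcast := tendsto_natCast_atTop_atTop (R := ℝ)
    have t1 : Tendsto (fun k : ℕ => (k : ℝ) ^ (-s)) atTop (𝓝 0) :=
      (tendsto_rpow_neg_atTop hs0).comp hcast
    have t2 : Tendsto (fun k : ℕ => (k : ℝ) ^ (1 / 2 - s)) atTop atTop :=
      (tendsto_rpow_atTop (by linarith)).comp hcast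
    have t3 : ∀ᶠ k : ℕ in atTop, Real.log (k : ℝ) ≤ δ / 2 * (k : ℝ) ^ (1 / 2 - s) := by
      have h3 := (isLittleO_log_rpow_atTop (by linarith : (0 : ℝ) < 1 / 2 - s)).bound
        (half_pos hδ)
      filter_upwards [hcast.eventually h3] with k hk
      rw [Real.norm_eq_abs, Real.norm_eq_abs, abs_of_nonneg (Real.rpow_nonneg (Nat.cast_nonneg k) _)]
        at hk
      exact (le_abs_self _).trans hk
    refine ⟨c / 2, by positivity, ?_⟩
    filter_upwards [eventually_ge_atTop 1, t1.eventually (ge_mem_nhds hp₀), t3,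
      t2.eventually_ge_atTop (max K₀ (max (2 / ρ) (max 1 (max (2 / c)
        (2 / δ * Real.log (2 * ρ + 1))))))] with k hk hp hlog hK n S hS
    subst hS
    have hSn : S.Nonempty := Finset.card_pos.mp hk
    have hk0 : (0 : ℝ) < S.card := by exact_mod_cast hk
    have hk1 : (1 : ℝ) ≤ S.card := by exact_mod_cast hk
    simp only [max_le_iff] at hK
    obtain ⟨hK1, hK2, hK3, hK4, hK5⟩ := hK
    set p := (S.card : ℝ) ^ (-s) with hpdef
    set K := (S.card : ℝ) ^ (1 / 2 - s) with hKdef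
    have hp0 : 0 < p := Real.rpow_pos_of_pos hk0 _
    have hsk1 : 1 ≤ √(S.card : ℝ) := by rw [Real.one_le_sqrt]; exact hk1
    have hKp : K = √S.card * p := by
      rw [hKdef, hpdef, Real.sqrt_eq_rpow, ← Real.rpow_add hk0]; ring_nf
    have hKp2 : S.card * p ^ (2 * τ) = K := by
      rw [hpdef, hKdef, ← Real.rpow_natCast, ← Real.rpow_mul hk0.le]
      nth_rw 1 [← Real.rpow_one (S.card : ℝ)]
      rw [← Real.rpow_add hk0]
      congr 1
      push_cast
      rw [hs]
      field_simp
      ring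
    have hp1 : p ≤ 1 := Real.rpow_le_one_of_one_le_of_nonpos hk1 (by linarith)
    have hsK : √S.card * K ≤ S.card := by
      calc √S.card * K = √S.card ^ 2 * p := by rw [hKp]; ring
        _ = S.card * p := by rw [Real.sq_sqrt hk0.le]
        _ ≤ S.card := mul_le_of_le_one_right hk0.le hp1
    have hbig : 2 ≤ ρ * (√S.card * K) := by
      rw [div_le_iff₀ hρ] at hK2
      have : K ≤ √S.card * K := le_mul_of_one_le_left (by linarith) hsk1
      nlinarith
    have hl : Real.log (2 * (ρ * (√S.card * K)) + 1) ≤ δ * K := by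
      have h3 : 2 * (ρ * (√S.card * K)) + 1 ≤ (2 * ρ + 1) * S.card := by nlinarith
      have h4 := Real.log_le_log (by linarith) h3
      rw [Real.log_mul (by positivity) hk0.ne'] at h4
      have h5 : Real.log (2 * ρ + 1) ≤ δ / 2 * K := by
        rw [div_mul_eq_mul_div, div_le_iff₀ hδ] at hK5
        linarith
      linarith
    have hE := hmain n S p K hSn hp0 hp hKp hKp2 hK1 hbig hl
    have hrate : c / 2 * S.card / √((S.card : ℝ) ^ (2 / (2 * (τ : ℝ) - 1))) = c / 2 * K ^ 2 := by
      have h3 : √((S.card : ℝ) ^ (2 / (2 * (τ : ℝ) - 1))) = (S.card : ℝ) ^ (2 * s) := by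
        rw [Real.sqrt_eq_rpow, ← Real.rpow_mul hk0.le]
        congr 1
        rw [hs]
        field_simp
      rw [h3, mul_div_assoc]
      congr 1
      rw [hKdef, ← Real.rpow_natCast, ← Real.rpow_mul hk0.le]
      nth_rw 1 [← Real.rpow_one (S.card : ℝ)]
      rw [← Real.rpow_sub hk0]
      congr 1
      push_cast
      ring
    rw [hrate]
    rw [div_le_iff₀ hc] at hK4
    nlinarith
  · have hτ1 : τ = 1 := le_antisymm h2 hτ.1
    obtain ⟨c, hc, h⟩ := mean_energy_gt_one hμ hθ
    refine ⟨c, hc, ?_⟩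
    filter_upwards [h, eventually_ge_atTop 1] with k hk hk1 n S hS
    refine le_trans (le_of_eq ?_) (hk n S hS)
    have hk0 : (0 : ℝ) < k := by exact_mod_cast hk1
    have h3 : (2 : ℝ) / (2 * (τ : ℝ) - 1) = (2 : ℕ) := by rw [hτ1]; norm_num
    rw [h3, Real.rpow_natCast, Real.sqrt_sq hk0.le]
    field_simp

end

theorem detectsAtRate_sdpTest_and_programTest {μ : Measure ℝ} [IsProbabilityMeasure μ]
    (hμ : μ.map (fun h => -h) = μ) {θ : ℝ} {r : ℕ → ℝ} (hr : ∀ k, 1 ≤ k → 0 < r k)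
    (hE : ∃ c, 0 < c ∧ ∀ᶠ k : ℕ in atTop, ∀ (n : ℕ) (S : Finset (Fin n)), S.card = k →
      c * k / √(r k) ≤ ∫ σ, energy S σ ∂(configLaw μ θ S) - 1) :
    DetectsAtRate μ θ (sdpTest 20) r ∧ DetectsAtRate μ θ programTest r := by
  obtain ⟨c, hc, hE⟩ := hE
  refine ⟨detectsAtRate_of_energy (C := 20) hμ (by norm_num)
    (fun n m k x _ _ _ _ h => not_le.mpr h) (fun n m k x _ _ _ _ h => ?_) hr hc hE,
    detectsAtRate_of_energy (C := 20) hμ (by norm_num)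
    (fun n m k x hn hm hk hkn h => (thresholdsSDP_programTest n m k x hn hm hk hkn).1 h.le)
    (fun n m k x hn hm hk hkn => (thresholdsSDP_programTest n m k x hn hm hk hkn).2) hr hc hE⟩
  refine le_trans ?_ h
  unfold threshold
  gcongr
  norm_num

end PlantedRFCW

theorem mainTheorem12 :
    (∀ (n k : ℕ) (A : Matrix (Fin n) (Fin n) ℝ), A.IsSymm → 1 ≤ k → k ≤ n →
      sparseEig k A ≤ sdp k A ∧
      ∀ z : ℝ, 0 ≤ z → sdp k A ≤ lamMax (A + softCert z A) + (k : ℝ) * z) ∧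
    ∃ (C₁ : ℝ) (ψ : Test), 0 < C₁ ∧ PolynomialTime ψ ∧ ThresholdsSDP C₁ ψ ∧
      ∀ (μ : Measure ℝ) [IsProbabilityMeasure μ] (θ : ℝ),
        μ.map (fun h => -h) = μ → Integrable (fun h : ℝ => h) μ → 0 < θ →
        (θ * meanSechSq μ < 1 →
          DetectsAtRate μ θ (sdpTest C₁) (fun k => (k : ℝ) ^ 2) ∧
          DetectsAtRate μ θ ψ (fun k => (k : ℝ) ^ 2)) ∧
        (1 < θ * meanSechSq μ ∨ (θ * meanSechSq μ = 1 ∧ ¬ ZeroIsGlobalMin μ θ) →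
          DetectsAtRate μ θ (sdpTest C₁) (fun _ => 1) ∧
          DetectsAtRate μ θ ψ (fun _ => 1)) ∧
        (∀ τ : ℕ, θ * meanSechSq μ = 1 → ZeroIsGlobalMin μ θ → HasFlatness μ θ τ →
          μ ≠ Measure.dirac 0 →
          DetectsAtRate μ θ (sdpTest C₁) (fun k => (k : ℝ) ^ (2 / (2 * (τ : ℝ) - 1))) ∧
          DetectsAtRate μ θ ψ (fun k => (k : ℝ) ^ (2 / (2 * (τ : ℝ) - 1)))) := by
  refine ⟨fun n k A hA hk hkn => ⟨sparseEig_le_sdp A hk hkn,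
    fun z hz => sdp_le_lamMax_softCert hA hk hkn hz⟩, 20, programTest, by norm_num,
    polynomialTime_programTest, thresholdsSDP_programTest, fun μ _ θ hμ hint hθ => ⟨fun _ => ?_,
    fun h => ?_, fun τ _ hmin hτ hdirac => ?_⟩⟩
  · refine detectsAtRate_sdpTest_and_programTest hμ (fun k hk => by positivity) ?_
    obtain ⟨c, hc, h⟩ := mean_energy_gt_one hμ hθ
    refine ⟨c, hc, ?_⟩
    filter_upwards [h, eventually_ge_atTop 1] with k hk hk1 n S hS
    rw [Real.sqrt_sq (Nat.cast_nonneg k), mul_div_cancel_right₀ _ (by positivity)]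
    exact hk n S hS
  · exact detectsAtRate_sdpTest_and_programTest hμ (fun _ _ => one_pos)
      (mean_energy_low_temperature hμ hint hθ h)
  · exact detectsAtRate_sdpTest_and_programTest hμ
      (fun k hk => Real.rpow_pos_of_pos (by exact_mod_cast hk) _)
      (mean_energy_critical hμ hint hθ hmin hdirac hτ)
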